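/- Let $\mathbb T=\mathbb R/2\pi\mathbb Z$, and equip $\mathbb T$ and $\mathbb T^2$ with the normalized (probability) Haar measures. For $f\in L^2(\mathbb T^2)$ let $\hat f(k,l)=\int_{\mathbb T^2} f\,e^{-ikx-ily}$ and $$\|f\|_{\dot H^{-1}}^2=\sum_{(k,l)\neq(0,0)}\frac{|\hat f(k,l)|^2}{k^2+l^2}.$$ Let $U\in L^\infty((0,\infty)\times\mathbb T)$ be real-valued, $M=\|U\|_{L^\infty}$, and let $\rho_0\in C^\infty(\mathbb T^2)$ (real- or complex-valued) be mean-zero and not identically zero. For $\nu>0$ consider $$\partial_t\rho+U(t,y)\,\partial_x\rho=\nu\Delta\rho\quad\text{on }(0,\infty)\times\mathbb T^2,\qquad \rho(0)=\rho_0,\tag{1}$$ where a solution is a function $\rho\in C([0,\infty);L^2(\mathbb T^2))$ that satisfies the equation in the sense of distributions and has $\rho(0)=\rho_0$. *Notation.* Put $\mathcal N=\|\rho_0\|_{L^2}$, $g_k(y)=\int_{\mathbb T}\rho_0(x,y)e^{-ikx}\,dx$, $a_k=\|g_k\|_{L^2(\mathbb T)}$, $g_k^l=\hat\rho_0(k,l)$,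 $A_k=k^2-\partial_{yy}$ and $$\beta_0=\frac{2(\nu\|\Delta\rho_0\|_{L^2}+M\|\partial_x\rho_0\|_{L^2})}{\mathcal N}.$$ For $k\neq0$ with $a_k>0$ put $$\beta_k=\frac{2(\nu\|A_kg_k\|_{L^2}+|k|Ma_k)}{a_k},\qquad \delta_k=\beta_k^{-1};$$ let $m_k$ be the least integer $m\ge1$ with $10^4\frac{k^2M^2}{\nu^2m^2}\le\frac14$ and $\frac{10^4}{\nu m}\le\frac{\delta_k}{16}$; and put $$\Lambda_k=\nu\left(k^2+m_k^2+m_k+\tfrac12\right),\quad D_k=\frac{10^4}{\nu m_k},\quad \theta_k=\min\left\{1,\left(\tfrac{\delta_k}{32D_k}\right)^{1/2}\right\},\quad \gamma_k=\max\left\{\beta_k,\ \Lambda_k+\delta_k^{-1}\log(\theta_k^{-1})\right\}.$$ *The exponent $c_2=c_2(\rho_0,U,\nu)$.* If $a_k>0$ for some $k\neq0$, let $$c_2=\min_{k\ne0,\ a_k>0}\max\left\{\beta_0,\ \gamma_k+\beta_0\log\frac{\mathcal N}{a_k}\right\};$$ otherwise let $$c_2=\min_{l\neq0,\ g_0^l\ne0}\max\left\{\beta_0,\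 \nu l^2+\beta_0\log\frac{\mathcal N}{|g_0^l|}\right\}.$$ *The constant $C(\rho_0,U)$.* Let $B_0$ be the value of $\beta_0$ at $\nu=1$, and for $k\neq0$ with $a_k>0$ let $B_k=2\left(\frac{\|A_kg_k\|_{L^2}}{a_k}+|k|M\right)$, $\bar m_k=1+200|k|M+160000\,B_k$ and $$\Gamma_k=\max\left\{B_k,\ k^2+\bar m_k^2+\bar m_k+\tfrac12+\tfrac{B_k}{2}\bigl(\max\{0,\log(320000B_k)\}+1\bigr)\right\}.$$ If $a_k>0$ for some $k\neq0$, let $$C(\rho_0,U)=\inf_{k\neq0,\ a_k>0}\max\left\{B_0,\ \Gamma_k+B_0\log\frac{\mathcal N}{a_k}\right\};$$ otherwise let $$C(\rho_0,U)=\inf_{l\ne0,\ g_0^l\neq0}\max\left\{B_0,\ l^2+B_0\log\frac{\mathcal N}{|g_0^l|}\right\}.$$ *The radius $R_*=R_*(\rho_0,U,\nu)$.* Let $K_0$ be the least integer $J\ge0$ with $\sum_{|k|>J}a_k^2\le\mathcal N^2/2$, and put $K=\max\{\lceil(2c_2/\nu)^{1/2}\rceil,K_0\}$ and $\mathcal K=\{k\in\mathbb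 Z:\ |k|\le K,\ a_k>0\}$. For $k\in\mathcal K$ let $J_k$ be the least integer $J\ge1$ with $\sum_{|l|>J}|g_k^l|^2\le a_k^2/2$. Put $N_0=J_0$ and $N_k=\max\{J_k,\lceil|k|M/\nu\rceil,1\}$ for $k\neq0$, and $$R_*^2=\max_{k\in\mathcal K}\,(k^2+N_k^2).$$ **Theorem.** $C(\rho_0,U)>0$, and for every $\nu>0$ one has $0<c_2<\infty$ and $0<R_*<\infty$. Moreover $c_2\le C(\rho_0,U)/\nu$ whenever $0<\nu\le1$. For every $\nu>0$, the solution $\rho$ of (1) satisfies, for all $t\ge0$, $$\|\rho(t)\|_{L^2}\ge\|\rho_0\|_{L^2}\,e^{-c_2t}\qquad\text{and}\qquad \frac{\|\rho(t)\|_{\dot H^{-1}}}{\|\rho(t)\|_{L^2}}\ \ge\ c_*:=\frac1{2R_*}>0.$$ -/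

import Mathlib

open MeasureTheory Set Real

namespace ShearFlow

noncomputable section

instance instFactTwoPiPos : Fact (0 < 2 * Real.pi) := ⟨Real.two_pi_pos⟩

/-- The circle `ℝ / 2πℤ`. -/
abbrev T1 : Type := AddCircle (2 * Real.pi)

/-- The torus `𝕋² = (ℝ / 2πℤ)²`, with points `(x, y)`. -/
abbrev T2 : Type := T1 × T1

/-- Normalized Lebesgue (Haar) measure on the circle. -/
abbrev μ1 : Measure T1 := AddCircle.haarAddCircle

/-- Normalized Lebesgue (Haar) measure on the torus. -/
abbrev μ2 : Measure T2 := μ1.prod μ1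

/-! ### Derivatives of functions on the circle and on the torus -/

/-- The derivative of a function on the circle. -/
def d1 (g : T1 → ℂ) (y : T1) : ℂ := deriv (fun s : ℝ => g (y + (s : T1))) 0

/-- `∂ₓ f` on the torus. -/
def dx (f : T2 → ℂ) (p : T2) : ℂ := d1 (fun x => f (x, p.2)) p.1

/-- `∂_y f` on the torus. -/
def dy (f : T2 → ℂ) (p : T2) : ℂ := d1 (fun y => f (p.1, y)) p.2

/-- `Δ f = ∂ₓₓ f + ∂_yy f` on the torus. -/
def lap (f : T2 → ℂ) (p : T2) : ℂ := dx (dx f) p + dy (dy f) p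

/-- `f ∈ C^∞(𝕋²)`: the doubly periodic lift of `f` to `ℝ²` is smooth. -/
def SmoothTorus (f : T2 → ℂ) : Prop :=
  ContDiff ℝ (⊤ : ℕ∞) (fun p : ℝ × ℝ => f ((p.1 : T1), (p.2 : T1)))

/-! ### Norms and Fourier coefficients -/

/-- The `L²` norm of a function on the circle. -/
def norm1 (g : T1 → ℂ) : ℝ := (eLpNorm g 2 μ1).toReal

/-- The `L²` norm of a function on the torus. -/
def norm2 (f : T2 → ℂ) : ℝ := (eLpNorm f 2 μ2).toReal

/-- The Fourier coefficient of `f` with respect to `e^{ikx} e^{ily}`. -/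
def coeff (f : T2 → ℂ) (k l : ℤ) : ℂ :=
  ∫ p, fourier (-k) p.1 * fourier (-l) p.2 * f p ∂μ2

/-- The `k`-th Fourier mode in `x`: `y ↦ ∫ f(x, y) e^{-ikx} dx`. -/
def xMode (f : T2 → ℂ) (k : ℤ) : T1 → ℂ := fun y => ∫ x, fourier (-k) x * f (x, y) ∂μ1

/-- The homogeneous norm
`‖f‖_{Ḣ⁻¹} = (∑_{(k,l) ≠ (0,0)} |f̂(k,l)|² / (k² + l²))^{1/2}`. -/
def normHneg (f : T2 → ℂ) : ℝ :=
  Real.sqrt (∑' q : ℤ × ℤ,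
    if q = 0 then 0 else ‖coeff f q.1 q.2‖ ^ 2 / ((q.1 : ℝ) ^ 2 + (q.2 : ℝ) ^ 2))

/-! ### The equation -/

/-- Space-time measure on `(0, ∞) × 𝕋`, the domain of the shear `U(t, y)`. -/
abbrev μtime : Measure (ℝ × T1) := (volume.restrict (Ioi (0 : ℝ))).prod μ1

/-- `U ∈ L^∞((0, ∞) × 𝕋)`. -/
def BoundedShear (U : ℝ → T1 → ℝ) : Prop :=
  MemLp (fun q : ℝ × T1 => U q.1 q.2) ⊤ μtime

/-- `M = ‖U‖_{L^∞}`. -/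
def supNorm (U : ℝ → T1 → ℝ) : ℝ :=
  (eLpNorm (fun q : ℝ × T1 => U q.1 q.2) ⊤ μtime).toReal

/-- Test functions: smooth on `ℝ × 𝕋²`, with support in `[a, b] × 𝕋²` for some `0 < a ≤ b`. -/
def IsTest (φ : ℝ → T2 → ℂ) : Prop :=
  ContDiff ℝ (⊤ : ℕ∞)
    (fun q : ℝ × ℝ × ℝ => φ q.1 ((q.2.1 : T1), (q.2.2 : T1))) ∧
  ∃ a b : ℝ, 0 < a ∧ a ≤ b ∧ ∀ t, t ∉ Icc a b → ∀ p, φ t p = 0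

/-- `ρ ∈ C([0, ∞); L²(𝕋²))` solves `∂ₜρ + U(t,y) ∂ₓρ = ν Δρ` in the sense of distributions on
`(0, ∞) × 𝕋²`, with `ρ(0) = ρ₀`. (The usual energy solutions, which lie in
`C([0, ∞); L²) ∩ L²_loc([0, ∞); H¹)`, are of this kind.) -/
structure IsSolution (U : ℝ → T1 → ℝ) (ν : ℝ) (ρ₀ : T2 → ℂ) (ρ : ℝ → Lp ℂ 2 μ2) : Prop where
  continuousOn : ContinuousOn ρ (Ici 0)
  initial : (ρ 0 : T2 → ℂ) =ᵐ[μ2] ρ₀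
  weak : ∀ φ : ℝ → T2 → ℂ, IsTest φ →
    ∫ t in Ioi (0 : ℝ), ∫ p, (ρ t : T2 → ℂ) p *
      (deriv (fun s => φ s p) t + (U t p.2 : ℂ) * dx (φ t) p + (ν : ℂ) * lap (φ t) p) ∂μ2 = 0

/-! ### The exponent `c₂` -/

section Exponent

variable (U : ℝ → T1 → ℝ) (ν : ℝ) (ρ₀ : T2 → ℂ)

/-- `a_k`, the `L²` norm of the `k`-th `x`-mode of the datum. -/
def modeNorm (k : ℤ) : ℝ := norm1 (xMode ρ₀ k)

/-- `‖A_k g_k‖_{L²}`, where `g_k` is the `k`-th `x`-mode of the datum and `A_k = k² - ∂_yy`. -/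
def modeA (k : ℤ) : ℝ :=
  norm1 (fun y => (k : ℂ) ^ 2 * xMode ρ₀ k y - d1 (d1 (xMode ρ₀ k)) y)

/-- `β₀ = 2 (ν ‖Δρ₀‖ + M ‖∂ₓρ₀‖) / ‖ρ₀‖`. -/
def beta0 : ℝ := 2 * (ν * norm2 (lap ρ₀) + supNorm U * norm2 (dx ρ₀)) / norm2 ρ₀

/-- `β_k = 2 (ν ‖A_k g_k‖ + |k| M a_k) / a_k`. -/
def beta (k : ℤ) : ℝ :=
  2 * (ν * modeA ρ₀ k + |(k : ℝ)| * supNorm U * modeNorm ρ₀ k) / modeNorm ρ₀ k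

/-- `δ_k = 1 / β_k`. -/
def delta (k : ℤ) : ℝ := (beta U ν ρ₀ k)⁻¹

/-- `m_k`, the least integer `m ≥ 1` with `10⁴ k² M² / (ν² m²) ≤ 1/4` and
`10⁴ / (ν m) ≤ δ_k / 16`. -/
def mIdx (k : ℤ) : ℕ :=
  sInf {m : ℕ | 1 ≤ m ∧
    10 ^ 4 * ((k : ℝ) ^ 2 * supNorm U ^ 2 / (ν ^ 2 * (m : ℝ) ^ 2)) ≤ 1 / 4 ∧
    10 ^ 4 * (1 / (ν * (m : ℝ))) ≤ delta U ν ρ₀ k / 16}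

/-- `Λ_k = ν (k² + m_k² + m_k + 1/2)`. -/
def bigLambda (k : ℤ) : ℝ :=
  ν * ((k : ℝ) ^ 2 + (mIdx U ν ρ₀ k : ℝ) ^ 2 + (mIdx U ν ρ₀ k : ℝ) + 1 / 2)

/-- `D_k = 10⁴ / (ν m_k)`. -/
def bigD (k : ℤ) : ℝ := 10 ^ 4 / (ν * (mIdx U ν ρ₀ k : ℝ))

/-- `θ_k = min {1, (δ_k / (32 D_k))^{1/2}}`. -/
def theta (k : ℤ) : ℝ := min 1 (Real.sqrt (delta U ν ρ₀ k / (32 * bigD U ν ρ₀ k)))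

/-- `γ_k = max {β_k, Λ_k + δ_k⁻¹ log(θ_k⁻¹)}`. -/
def gamma (k : ℤ) : ℝ :=
  max (beta U ν ρ₀ k)
    (bigLambda U ν ρ₀ k + (delta U ν ρ₀ k)⁻¹ * Real.log ((theta U ν ρ₀ k)⁻¹))

open Classical in
/-- The exponent `c₂`: the least of the numbers `max {β₀, γ_k + β₀ log(‖ρ₀‖ / a_k)}` over the
`k ≠ 0` with `a_k > 0` or, if there is no such `k`, the least of the numbers
`max {β₀, ν l² + β₀ log(‖ρ₀‖ / |ρ̂₀(0,l)|)}` over the `l ≠ 0` with `ρ̂₀(0,l) ≠ 0`. -/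
def c2 : ℝ :=
  if ∃ k : ℤ, k ≠ 0 ∧ 0 < modeNorm ρ₀ k then
    sInf {c : ℝ | ∃ k : ℤ, k ≠ 0 ∧ 0 < modeNorm ρ₀ k ∧
      c = max (beta0 U ν ρ₀)
        (gamma U ν ρ₀ k + beta0 U ν ρ₀ * Real.log (norm2 ρ₀ / modeNorm ρ₀ k))}
  else
    sInf {c : ℝ | ∃ l : ℤ, l ≠ 0 ∧ 0 < ‖coeff ρ₀ 0 l‖ ∧
      c = max (beta0 U ν ρ₀)
        (ν * (l : ℝ) ^ 2 + beta0 U ν ρ₀ * Real.log (norm2 ρ₀ / ‖coeff ρ₀ 0 l‖))}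

/-! ### The constant `C(ρ₀, U)` that bounds `ν c₂` for `0 < ν ≤ 1` -/

/-- `B_k = 2 (‖A_k g_k‖ / a_k + |k| M)`. -/
def bigB (k : ℤ) : ℝ := 2 * (modeA ρ₀ k / modeNorm ρ₀ k + |(k : ℝ)| * supNorm U)

/-- `m̄_k = 1 + 200 |k| M + 160000 B_k`. -/
def mBar (k : ℤ) : ℝ := 1 + 200 * |(k : ℝ)| * supNorm U + 160000 * bigB U ρ₀ k

/-- `Γ_k = max {B_k, k² + m̄_k² + m̄_k + 1/2 + (B_k / 2) (log⁺(320000 B_k) + 1)}`. -/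
def bigGamma (k : ℤ) : ℝ :=
  max (bigB U ρ₀ k)
    ((k : ℝ) ^ 2 + mBar U ρ₀ k ^ 2 + mBar U ρ₀ k + 1 / 2 +
      bigB U ρ₀ k / 2 * (max 0 (Real.log (320000 * bigB U ρ₀ k)) + 1))

/-- `B₀`, the value of `β₀` at `ν = 1`. -/
abbrev bigB0 : ℝ := beta0 U 1 ρ₀

open Classical in
/-- The explicit constant `C(ρ₀, U)`. -/
def constC : ℝ :=
  if ∃ k : ℤ, k ≠ 0 ∧ 0 < modeNorm ρ₀ k then
    sInf {c : ℝ | ∃ k : ℤ, k ≠ 0 ∧ 0 < modeNorm ρ₀ k ∧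
      c = max (bigB0 U ρ₀)
        (bigGamma U ρ₀ k + bigB0 U ρ₀ * Real.log (norm2 ρ₀ / modeNorm ρ₀ k))}
  else
    sInf {c : ℝ | ∃ l : ℤ, l ≠ 0 ∧ 0 < ‖coeff ρ₀ 0 l‖ ∧
      c = max (bigB0 U ρ₀)
        ((l : ℝ) ^ 2 + bigB0 U ρ₀ * Real.log (norm2 ρ₀ / ‖coeff ρ₀ 0 l‖))}

/-! ### The radius `R_*` -/

/-- `K₀`, the least `J ≥ 0` with `∑_{|k| > J} a_k² ≤ ‖ρ₀‖² / 2`. -/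
def cutK0 : ℕ :=
  sInf {J : ℕ | (∑' k : ℤ, if (J : ℤ) < |k| then modeNorm ρ₀ k ^ 2 else 0) ≤ norm2 ρ₀ ^ 2 / 2}

/-- `K = max {⌈(2 c₂ / ν)^{1/2}⌉, K₀}`. -/
def cutK : ℕ := max ⌈Real.sqrt (2 * c2 U ν ρ₀ / ν)⌉₊ (cutK0 ρ₀)

/-- `J_k`, the least `J ≥ 1` with `∑_{|l| > J} |ρ̂₀(k,l)|² ≤ a_k² / 2`. -/
def cutJ (k : ℤ) : ℕ :=
  sInf {J : ℕ | 1 ≤ J ∧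
    (∑' l : ℤ, if (J : ℤ) < |l| then ‖coeff ρ₀ k l‖ ^ 2 else 0) ≤ modeNorm ρ₀ k ^ 2 / 2}

/-- `N_0 = J_0`, and `N_k = max {J_k, ⌈|k| M / ν⌉, 1}` for `k ≠ 0`. -/
def cutN (k : ℤ) : ℕ :=
  if k = 0 then cutJ ρ₀ 0 else max (max (cutJ ρ₀ k) ⌈|(k : ℝ)| * supNorm U / ν⌉₊) 1

/-- `R_*`, where `R_*²` is the largest of the numbers `k² + N_k²` over the (finitely many) `k` with
`|k| ≤ K` and `a_k > 0`. -/
def RStar : ℝ :=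
  Real.sqrt (sSup {r : ℝ | ∃ k : ℤ, |k| ≤ (cutK U ν ρ₀ : ℤ) ∧ 0 < modeNorm ρ₀ k ∧
    r = (k : ℝ) ^ 2 + (cutN U ν ρ₀ k : ℝ) ^ 2})

end Exponent

end

end ShearFlow

namespace ShearFlow

/-! ### Parseval's identity on the circle and on the torus -/

/-! The shear does not depend on `x`, so the `x`-modes decouple. The mode `f = f_k` solves `f' =
-ν(k² - ∂_yy) f - i k U f` in `L²(𝕋)`. In the Fourier basis the first term is diagonal with entries
`λ_l = ν(k² + l²)`, and multiplication by `U` is symmetric with norm at most `M`. `isEvolution_mode`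
extracts this system, coefficient by coefficient, from the weak formulation.

The engine is `IsEvolution.signed_energy_le`. Let `P` project onto `|l| ≤ N`. By symmetry the shear
enters the derivative of `‖Pf‖² - ‖(1-P)f‖²` only through the cross term between `Pf` and `(1-P)f`,
of size at most `2|k|M ‖f‖²`. The gap `ν(2N+1)` between `λ_N` and `λ_{N+1}` beats it once `|k|M ≤
νN`. With a suitable weight `e^{2Λt}` the signed energy is then nondecreasing. This gives two
things: low-frequency dominance persists for all time (an invariant cone), and the norm of a mode
that starts in the cone cannot decay faster than `e^{-Λt}`, up to a constant.

Exponential lower bound: for short times, pairing with the datum gives `‖f(t)‖ ≥ a_k(1 - β_k t/2)`,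
which dominates `a_k e^{-β_k t}` while `β_k t ≤ 1`. For later times the cone with `N = m_k` applies,
and its constant loss is absorbed by spare room in `γ_k` (`mode_lower_bound`). The same splitting
with `β₀` turns the bound for one mode into one for `ρ` with no constant in front
(`mul_exp_neg_le_of_short_of_long`). If only the mode `k = 0` is present, the shear is invisible and
each coefficient decays exactly (`norm_coeff_zero_mode`).

Ratio: modes with `|k| > K` decay faster than the lower bound just found, so at every time the modes
with `|k| ≤ K` carry half of the energy (`sum_low_modes_ge`). Inside each of them the cone keeps
half of the energy in `|l| ≤ N_k` (`cone_mode`). A quarter of the energy therefore stays at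
frequencies at most `R_*`, and the square root of `1/4` gives `1/(2 R_*)`. -/

theorem eLpNorm_two_sq {α : Type*} [MeasurableSpace α] (μ : Measure α) (f : α → ℂ) :
    eLpNorm f 2 μ ^ 2 = ∫⁻ x, ‖f x‖ₑ ^ 2 ∂μ := by
  have h := eLpNorm_nnreal_pow_eq_lintegral (μ := μ) (f := f) (p := 2) two_ne_zero
  simpa using h

theorem enorm_sq_eq_ofReal (z : ℂ) : ‖z‖ₑ ^ 2 = ENNReal.ofReal (‖z‖ ^ 2) := by
  rw [← ofReal_norm, ENNReal.ofReal_pow (norm_nonneg _)]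

theorem toReal_eLpNorm_two_sq {α : Type*} [MeasurableSpace α] (μ : Measure α) (f : α → ℂ) :
    (eLpNorm f 2 μ).toReal ^ 2 = (∫⁻ x, ‖f x‖ₑ ^ 2 ∂μ).toReal := by
  rw [← ENNReal.toReal_pow, eLpNorm_two_sq]

theorem tsum_enorm_fourierCoeff_sq {g : T1 → ℂ} (hg : MemLp g 2 μ1) :
    ∑' n : ℤ, ‖fourierCoeff g n‖ₑ ^ 2 = ∫⁻ y, ‖g y‖ₑ ^ 2 ∂μ1 := by
  have h := hasSum_sq_fourierCoeff (hg.toLp g)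
  have hae : (hg.toLp g : T1 → ℂ) =ᵐ[μ1] g := hg.coeFn_toLp
  rw [fourierCoeff_congr_ae hae] at h
  have hint : ∫ y, ‖(hg.toLp g : T1 → ℂ) y‖ ^ 2 ∂μ1 = ∫ y, ‖g y‖ ^ 2 ∂μ1 :=
    integral_congr_ae (by filter_upwards [hae] with y hy; rw [hy])
  have h' : HasSum (fun n => ‖fourierCoeff g n‖ ^ 2) (∫ y, ‖g y‖ ^ 2 ∂μ1) := by
    rw [← hint]; exact h
  simp_rw [enorm_sq_eq_ofReal]
  rw [← ENNReal.ofReal_tsum_of_nonneg (fun n => sq_nonneg _) h'.summable, h'.tsum_eq,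
    ofReal_integral_eq_lintegral_ofReal
      ((memLp_two_iff_integrable_sq_norm hg.aestronglyMeasurable).1 hg)
      (Filter.Eventually.of_forall fun y => sq_nonneg _)]

theorem xMode_eq_fourierCoeff (f : T2 → ℂ) (k : ℤ) (y : T1) :
    xMode f k y = fourierCoeff (fun x => f (x, y)) k := by
  simp [xMode, fourierCoeff]

theorem continuous_fourier_fst (k : ℤ) : Continuous (fun p : T2 => fourier k p.1) :=
  (fourier k).continuous.comp continuous_fst

theorem continuous_fourier_snd (k : ℤ) : Continuous (fun p : T2 => fourier k p.2) :=
  (fourier k).continuous.comp continuous_snd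

theorem norm_fourier_apply (k : ℤ) (x : T1) : ‖fourier k x‖ = 1 := by
  rw [fourier_apply]; exact Circle.norm_coe _

theorem aestronglyMeasurable_xMode {f : T2 → ℂ} (hf : AEStronglyMeasurable f μ2) (k : ℤ) :
    AEStronglyMeasurable (xMode f k) μ1 := by
  have h : AEStronglyMeasurable (fun p : T2 => fourier (-k) p.1 * f p) μ2 :=
    (continuous_fourier_fst (-k)).aestronglyMeasurable.mul hf
  exact h.prod_swap.integral_prod_right'

theorem ae_memLp_slice {f : T2 → ℂ} (hf : MemLp f 2 μ2) :
    ∀ᵐ y ∂μ1, MemLp (fun x => f (x, y)) 2 μ1 := by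
  have h1 := hf.aestronglyMeasurable.prodMk_right
  have h2 : Integrable (fun p => ‖f p‖ ^ 2) μ2 :=
    (memLp_two_iff_integrable_sq_norm hf.aestronglyMeasurable).1 hf
  filter_upwards [h1, h2.prod_left_ae] with y hy1 hy2
  exact (memLp_two_iff_integrable_sq_norm hy1).2 hy2

/-- Parseval in `x` on almost every slice, followed by Tonelli. Working in `ENNReal` requires no
prior integrability of the modes; `memLp_xMode` is then read off from this identity. -/
theorem tsum_lintegral_xMode {f : T2 → ℂ} (hf : MemLp f 2 μ2) :
    ∑' k : ℤ, ∫⁻ y, ‖xMode f k y‖ₑ ^ 2 ∂μ1 = ∫⁻ p, ‖f p‖ₑ ^ 2 ∂μ2 := by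
  rw [lintegral_prod_symm _ (hf.aestronglyMeasurable.enorm.pow_const 2),
    ← lintegral_tsum fun k =>
      ((aestronglyMeasurable_xMode hf.aestronglyMeasurable k).enorm.pow_const 2)]
  refine lintegral_congr_ae ?_
  filter_upwards [ae_memLp_slice hf] with y hy
  simp_rw [xMode_eq_fourierCoeff]
  exact tsum_enorm_fourierCoeff_sq hy

theorem lintegral_enorm_sq_ne_top {α : Type*} [MeasurableSpace α] {μ : Measure α} {f : α → ℂ}
    (hf : MemLp f 2 μ) : ∫⁻ x, ‖f x‖ₑ ^ 2 ∂μ ≠ ⊤ := by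
  rw [← eLpNorm_two_sq]; exact ENNReal.pow_ne_top hf.2.ne

theorem memLp_xMode {f : T2 → ℂ} (hf : MemLp f 2 μ2) (k : ℤ) : MemLp (xMode f k) 2 μ1 := by
  refine ⟨aestronglyMeasurable_xMode hf.aestronglyMeasurable k, ?_⟩
  have h1 : ∫⁻ y, ‖xMode f k y‖ₑ ^ 2 ∂μ1 ≤ ∫⁻ p, ‖f p‖ₑ ^ 2 ∂μ2 :=
    (ENNReal.le_tsum k).trans (tsum_lintegral_xMode hf).le
  have h2 : eLpNorm (xMode f k) 2 μ1 ^ 2 < ⊤ := by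
    rw [eLpNorm_two_sq]
    exact h1.trans_lt (lintegral_enorm_sq_ne_top hf).lt_top
  by_contra h
  rw [not_lt, top_le_iff] at h
  simp [h] at h2

theorem hasSum_toReal_of_tsum {ι : Type*} {u : ι → ENNReal} {c : ENNReal} (h : ∑' i, u i = c)
    (hc : c ≠ ⊤) : HasSum (fun i => (u i).toReal) c.toReal := by
  subst h
  rw [ENNReal.tsum_toReal_eq fun i => ENNReal.ne_top_of_tsum_ne_top hc i]
  exact (ENNReal.summable_toReal hc).hasSum

theorem hasSum_norm1_xMode_sq {f : T2 → ℂ} (hf : MemLp f 2 μ2) :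
    HasSum (fun k : ℤ => norm1 (xMode f k) ^ 2) (norm2 f ^ 2) := by
  simp_rw [norm1, norm2, toReal_eLpNorm_two_sq]
  exact hasSum_toReal_of_tsum (tsum_lintegral_xMode hf) (lintegral_enorm_sq_ne_top hf)

theorem hasSum_fourierCoeff_sq {g : T1 → ℂ} (hg : MemLp g 2 μ1) :
    HasSum (fun l : ℤ => ‖fourierCoeff g l‖ ^ 2) (norm1 g ^ 2) := by
  have := hasSum_toReal_of_tsum (tsum_enorm_fourierCoeff_sq hg) (lintegral_enorm_sq_ne_top hg)
  simpa [norm1, toReal_eLpNorm_two_sq] using this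

theorem integrable_fourier_mul {f : T2 → ℂ} (hf : Integrable f μ2) (k l : ℤ) :
    Integrable (fun p : T2 => fourier k p.1 * fourier l p.2 * f p) μ2 := by
  refine hf.bdd_mul (c := 1)
    ((continuous_fourier_fst k).mul (continuous_fourier_snd l)).aestronglyMeasurable
    (Filter.Eventually.of_forall fun p => ?_)
  rw [norm_mul, norm_fourier_apply, norm_fourier_apply, one_mul]

theorem integral_fourier_mul {f : T2 → ℂ} (hf : Integrable f μ2) (k l : ℤ) :
    ∫ p, fourier (-k) p.1 * fourier l p.2 * f p ∂μ2 = ∫ y, fourier l y * xMode f k y ∂μ1 := by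
  rw [integral_prod_symm _ (integrable_fourier_mul hf _ _)]
  refine integral_congr_ae (Filter.Eventually.of_forall fun y => ?_)
  simp only [xMode]
  rw [← integral_const_mul]
  congr 1; ext x; ring

theorem coeff_eq_fourierCoeff {f : T2 → ℂ} (hf : Integrable f μ2) (k l : ℤ) :
    coeff f k l = fourierCoeff (xMode f k) l := by
  rw [coeff, integral_fourier_mul hf]; simp [fourierCoeff]

theorem hasSum_coeff_sq {f : T2 → ℂ} (hf : MemLp f 2 μ2) (k : ℤ) :
    HasSum (fun l : ℤ => ‖coeff f k l‖ ^ 2) (norm1 (xMode f k) ^ 2) := by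
  simp_rw [coeff_eq_fourierCoeff (hf.integrable one_le_two)]
  exact hasSum_fourierCoeff_sq (memLp_xMode hf k)

theorem hasSum_coeff_sq_prod {f : T2 → ℂ} (hf : MemLp f 2 μ2) :
    HasSum (fun q : ℤ × ℤ => ‖coeff f q.1 q.2‖ ^ 2) (norm2 f ^ 2) := by
  have hs : Summable (fun q : ℤ × ℤ => ‖coeff f q.1 q.2‖ ^ 2) := by
    rw [summable_prod_of_nonneg fun q => sq_nonneg _]
    refine ⟨fun k => (hasSum_coeff_sq hf k).summable, ?_⟩
    simp_rw [(hasSum_coeff_sq hf _).tsum_eq]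
    exact (hasSum_norm1_xMode_sq hf).summable
  have := hs.hasSum.prod_fiberwise (hasSum_coeff_sq hf)
  rw [(hasSum_norm1_xMode_sq hf).unique this]
  exact hs.hasSum

theorem coeff_congr {f g : T2 → ℂ} (h : f =ᵐ[μ2] g) (k l : ℤ) : coeff f k l = coeff g k l :=
  integral_congr_ae (by filter_upwards [h] with p hp; rw [hp])

theorem norm1_nonneg (g : T1 → ℂ) : 0 ≤ norm1 g := ENNReal.toReal_nonneg

theorem norm2_nonneg (f : T2 → ℂ) : 0 ≤ norm2 f := ENNReal.toReal_nonneg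

theorem norm1_xMode_le {f : T2 → ℂ} (hf : MemLp f 2 μ2) (k : ℤ) :
    norm1 (xMode f k) ≤ norm2 f :=
  le_of_sq_le_sq (le_hasSum (hasSum_norm1_xMode_sq hf) k fun _ _ => sq_nonneg _) (norm2_nonneg _)

theorem norm_coeff_le {f : T2 → ℂ} (hf : MemLp f 2 μ2) (k l : ℤ) :
    ‖coeff f k l‖ ≤ norm1 (xMode f k) :=
  le_of_sq_le_sq (le_hasSum (hasSum_coeff_sq hf k) l fun _ _ => sq_nonneg _) (norm1_nonneg _)

/-! ### Smooth functions on the circle and on the torus -/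

theorem d1_coe (g : T1 → ℂ) (s : ℝ) : d1 g (s : T1) = deriv (fun r : ℝ => g (r : T1)) s := by
  have h := deriv_comp_const_add (f := fun r : ℝ => g (r : T1)) s 0
  simp only [add_zero, AddCircle.coe_add] at h
  exact h

theorem integral_d1 {g : T1 → ℂ} (hg : ContDiff ℝ 1 (fun s : ℝ => g (s : T1))) :
    ∫ y, d1 g y ∂μ1 = 0 := by
  rw [AddCircle.integral_haarAddCircle, ← AddCircle.intervalIntegral_preimage (2 * π) 0]
  simp_rw [d1_coe]
  rw [intervalIntegral.integral_deriv_eq_sub (fun s _ => (hg.differentiable one_ne_zero) s)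
    ((hg.continuous_deriv le_rfl).intervalIntegrable _ _), zero_add, AddCircle.coe_period]
  simp

theorem hasDerivAt_fourier_circle (n : ℤ) (s : ℝ) :
    HasDerivAt (fun r : ℝ => fourier n (r : T1)) (Complex.I * n * fourier n (s : T1)) s := by
  have h := _root_.hasDerivAt_fourier (2 * π) n s
  convert h using 1
  have : (π : ℂ) ≠ 0 := by exact_mod_cast Real.pi_ne_zero
  push_cast
  field_simp

theorem contDiff_fourier_circle (n : ℤ) {m : WithTop ℕ∞} :
    ContDiff ℝ m (fun r : ℝ => fourier n (r : T1)) := by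
  simp_rw [fourier_coe_apply]
  have h1 : ContDiff ℝ m (fun r : ℝ => (r : ℂ)) := Complex.ofRealCLM.contDiff
  exact (((contDiff_const (c := 2 * (π : ℂ) * Complex.I * n)).mul h1).div_const _).cexp

theorem exists_coe_eq (y : T1) : ∃ s : ℝ, (s : T1) = y := QuotientAddGroup.mk_surjective y

theorem d1_fourier_mul {g : T1 → ℂ} (hg : ContDiff ℝ 1 (fun s : ℝ => g (s : T1))) (n : ℤ)
    (y : T1) : d1 (fun y => fourier n y * g y) y =
      Complex.I * n * (fourier n y * g y) + fourier n y * d1 g y := by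
  obtain ⟨s, rfl⟩ := exists_coe_eq y
  rw [d1_coe, d1_coe]
  have h := (hasDerivAt_fourier_circle n s).mul
    ((hg.differentiable one_ne_zero) s).hasDerivAt
  refine h.deriv.trans ?_
  ring

theorem isOpenQuotientMap_coe : IsOpenQuotientMap (fun s : ℝ => (s : T1)) :=
  QuotientAddGroup.isOpenQuotientMap_mk

theorem continuous_of_lift {g : T1 → ℂ} (hg : Continuous (fun s : ℝ => g (s : T1))) :
    Continuous g :=
  isOpenQuotientMap_coe.isQuotientMap.continuous_iff.2 hg

theorem continuous_d1 {g : T1 → ℂ} (hg : ContDiff ℝ 1 (fun s : ℝ => g (s : T1))) :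
    Continuous (d1 g) := by
  refine continuous_of_lift ?_
  simp_rw [d1_coe]
  exact hg.continuous_deriv le_rfl

/-- Integration by parts: the derivative of the periodic function `e^{-iny} g` has integral zero. -/
theorem fourierCoeff_d1 {g : T1 → ℂ} (hg : ContDiff ℝ 1 (fun s : ℝ => g (s : T1))) (n : ℤ) :
    fourierCoeff (d1 g) n = Complex.I * n * fourierCoeff g n := by
  have hcd : ContDiff ℝ 1 (fun s : ℝ => fourier (-n) (s : T1) * g (s : T1)) :=
    (contDiff_fourier_circle (-n)).mul hg
  have h := integral_d1 (g := fun y => fourier (-n) y * g y) hcd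
  simp_rw [d1_fourier_mul hg] at h
  have hgc : Continuous g := continuous_of_lift hg.continuous
  have i1 : Integrable (fun y => Complex.I * ((-n : ℤ) : ℂ) * (fourier (-n) y * g y)) μ1 :=
    Continuous.integrable_of_hasCompactSupport (by fun_prop) (HasCompactSupport.of_compactSpace _)
  have i2 : Integrable (fun y => fourier (-n) y * d1 g y) μ1 :=
    ((fourier (-n)).continuous.mul (continuous_d1 hg)).integrable_of_hasCompactSupport
      (HasCompactSupport.of_compactSpace _)
  rw [integral_add i1 i2, integral_const_mul] at h
  simp only [fourierCoeff, smul_eq_mul]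
  push_cast at h
  linear_combination h

theorem SmoothTorus.continuous {f : T2 → ℂ} (hf : SmoothTorus f) : Continuous f := by
  have h := ContDiff.continuous hf
  exact (isOpenQuotientMap_coe.prodMap isOpenQuotientMap_coe).isQuotientMap.continuous_iff.2 h

theorem SmoothTorus.memLp {f : T2 → ℂ} (hf : SmoothTorus f) {p : ENNReal} : MemLp f p μ2 := by
  obtain ⟨C, hC⟩ := isCompact_univ.exists_bound_of_continuousOn hf.continuous.continuousOn
  exact MemLp.of_bound hf.continuous.aestronglyMeasurable C
    (Filter.Eventually.of_forall fun p => hC p (mem_univ p))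

theorem SmoothTorus.integrable {f : T2 → ℂ} (hf : SmoothTorus f) : Integrable f μ2 :=
  memLp_one_iff_integrable.1 hf.memLp

theorem SmoothTorus.contDiff_fst {f : T2 → ℂ} (hf : SmoothTorus f) (y : T1) :
    ContDiff ℝ 1 (fun s : ℝ => f ((s : T1), y)) := by
  obtain ⟨r, rfl⟩ := exists_coe_eq y
  have h1 : ContDiff ℝ (⊤ : ℕ∞) (fun s : ℝ => ((s, r) : ℝ × ℝ)) := by fun_prop
  exact (ContDiff.comp hf h1).of_le (by exact_mod_cast le_top)

theorem SmoothTorus.contDiff_snd {f : T2 → ℂ} (hf : SmoothTorus f) (x : T1) :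
    ContDiff ℝ 1 (fun s : ℝ => f (x, (s : T1))) := by
  obtain ⟨r, rfl⟩ := exists_coe_eq x
  have h1 : ContDiff ℝ (⊤ : ℕ∞) (fun s : ℝ => ((r, s) : ℝ × ℝ)) := by fun_prop
  exact (ContDiff.comp hf h1).of_le (by exact_mod_cast le_top)

theorem contDiff_fderiv_apply {F : ℝ × ℝ → ℂ} (hF : ContDiff ℝ (⊤ : ℕ∞) F) (v : ℝ × ℝ) :
    ContDiff ℝ (⊤ : ℕ∞) (fun q => fderiv ℝ F q v) :=
  (hF.fderiv_right (m := (⊤ : ℕ∞)) (by exact_mod_cast le_rfl)).clm_apply contDiff_const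

theorem SmoothTorus.dx {f : T2 → ℂ} (hf : SmoothTorus f) : SmoothTorus (dx f) := by
  set F := fun p : ℝ × ℝ => f ((p.1 : T1), (p.2 : T1)) with hF
  have hFs : ContDiff ℝ (⊤ : ℕ∞) F := hf
  have : (fun q : ℝ × ℝ => ShearFlow.dx f ((q.1 : T1), (q.2 : T1))) =
      fun q => fderiv ℝ F q (1, 0) := by
    ext q
    have h1 : HasDerivAt (fun s : ℝ => ((s, q.2) : ℝ × ℝ)) (1, 0) q.1 :=
      (hasDerivAt_id q.1).prodMk (hasDerivAt_const q.1 q.2)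
    have h2 := ((hFs.differentiable (by simp)) q).hasFDerivAt.comp_hasDerivAt q.1 h1
    rw [ShearFlow.dx, d1_coe]
    exact h2.deriv
  rw [SmoothTorus, this]
  exact contDiff_fderiv_apply hFs _

theorem SmoothTorus.dy {f : T2 → ℂ} (hf : SmoothTorus f) : SmoothTorus (dy f) := by
  set F := fun p : ℝ × ℝ => f ((p.1 : T1), (p.2 : T1)) with hF
  have hFs : ContDiff ℝ (⊤ : ℕ∞) F := hf
  have : (fun q : ℝ × ℝ => ShearFlow.dy f ((q.1 : T1), (q.2 : T1))) =
      fun q => fderiv ℝ F q (0, 1) := by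
    ext q
    have h1 : HasDerivAt (fun s : ℝ => ((q.1, s) : ℝ × ℝ)) (0, 1) q.2 :=
      (hasDerivAt_const q.2 q.1).prodMk (hasDerivAt_id q.2)
    have h2 := ((hFs.differentiable (by simp)) q).hasFDerivAt.comp_hasDerivAt q.2 h1
    rw [ShearFlow.dy, d1_coe]
    exact h2.deriv
  rw [SmoothTorus, this]
  exact contDiff_fderiv_apply hFs _

theorem SmoothTorus.add {f g : T2 → ℂ} (hf : SmoothTorus f) (hg : SmoothTorus g) :
    SmoothTorus (fun p => f p + g p) := ContDiff.add hf hg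

theorem SmoothTorus.lap {f : T2 → ℂ} (hf : SmoothTorus f) : SmoothTorus (lap f) :=
  hf.dx.dx.add hf.dy.dy

theorem SmoothTorus.conj {f : T2 → ℂ} (hf : SmoothTorus f) :
    SmoothTorus (fun p => (starRingEnd ℂ) (f p)) :=
  Complex.conjCLE.contDiff.comp hf

theorem d1_conj (g : T1 → ℂ) (y : T1) :
    d1 (fun y => (starRingEnd ℂ) (g y)) y = (starRingEnd ℂ) (d1 g y) :=
  deriv.star (f := fun s : ℝ => g (y + (s : T1))) (x := 0)

theorem dx_conj (f : T2 → ℂ) :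
    dx (fun p => (starRingEnd ℂ) (f p)) = fun p => (starRingEnd ℂ) (dx f p) := by
  ext p; exact d1_conj _ _

theorem dy_conj (f : T2 → ℂ) :
    dy (fun p => (starRingEnd ℂ) (f p)) = fun p => (starRingEnd ℂ) (dy f p) := by
  ext p; exact d1_conj _ _

theorem lap_conj (f : T2 → ℂ) :
    lap (fun p => (starRingEnd ℂ) (f p)) = fun p => (starRingEnd ℂ) (lap f p) := by
  ext p; simp [lap, dx_conj, dy_conj]

theorem smoothTorus_fourier (k l : ℤ) :
    SmoothTorus (fun p : T2 => fourier k p.1 * fourier l p.2) := by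
  have h1 : ContDiff ℝ (⊤ : ℕ∞) (fun p : ℝ × ℝ => fourier k (p.1 : T1)) :=
    (contDiff_fourier_circle k).comp contDiff_fst
  have h2 : ContDiff ℝ (⊤ : ℕ∞) (fun p : ℝ × ℝ => fourier l (p.2 : T1)) :=
    (contDiff_fourier_circle l).comp contDiff_snd
  exact h1.mul h2

theorem d1_const_mul (c : ℂ) (g : T1 → ℂ) (y : T1) : d1 (fun y => c * g y) y = c * d1 g y :=
  deriv_const_mul_field (u := c) (v := fun s : ℝ => g (y + (s : T1)))

theorem d1_fourier (n : ℤ) (y : T1) : d1 (fun y => fourier n y) y = Complex.I * n * fourier n y := by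
  obtain ⟨s, rfl⟩ := exists_coe_eq y
  rw [d1_coe]
  exact (hasDerivAt_fourier_circle n s).deriv

theorem dx_const_mul (c : ℂ) (f : T2 → ℂ) : dx (fun p => c * f p) = fun p => c * dx f p := by
  ext p; exact d1_const_mul _ _ _

theorem dy_const_mul (c : ℂ) (f : T2 → ℂ) : dy (fun p => c * f p) = fun p => c * dy f p := by
  ext p; exact d1_const_mul _ _ _

theorem lap_const_mul (c : ℂ) (f : T2 → ℂ) : lap (fun p => c * f p) = fun p => c * lap f p := by
  ext p; simp [lap, dx_const_mul, dy_const_mul, mul_add]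

theorem dx_fourier (k l : ℤ) : dx (fun p : T2 => fourier k p.1 * fourier l p.2) =
    fun p => Complex.I * k * (fourier k p.1 * fourier l p.2) := by
  ext p
  have : (fun x : T1 => fourier k x * fourier l p.2) = fun x => fourier l p.2 * fourier k x := by
    ext x; ring
  rw [dx, this, d1_const_mul, d1_fourier]
  ring

theorem dy_fourier (k l : ℤ) : dy (fun p : T2 => fourier k p.1 * fourier l p.2) =
    fun p => Complex.I * l * (fourier k p.1 * fourier l p.2) := by
  ext p
  change d1 (fun y : T1 => fourier k p.1 * fourier l y) p.2 = _
  rw [d1_const_mul, d1_fourier]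
  ring

theorem lap_fourier (k l : ℤ) : lap (fun p : T2 => fourier k p.1 * fourier l p.2) =
    fun p => -((k : ℂ) ^ 2 + (l : ℂ) ^ 2) * (fourier k p.1 * fourier l p.2) := by
  ext p
  rw [lap, dx_fourier, dx_const_mul, dx_fourier, dy_fourier, dy_const_mul, dy_fourier]
  linear_combination ((k : ℂ) ^ 2 + (l : ℂ) ^ 2) * (fourier k p.1 * fourier l p.2) * Complex.I_sq

/-! ### Fourier modes of derivatives -/

theorem xMode_dx {f : T2 → ℂ} (hf : SmoothTorus f) (k : ℤ) (y : T1) :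
    xMode (dx f) k y = Complex.I * k * xMode f k y := by
  rw [xMode_eq_fourierCoeff, xMode_eq_fourierCoeff]
  exact fourierCoeff_d1 (g := fun x => f (x, y)) (hf.contDiff_fst y) k

theorem continuous_xMode {f : T2 → ℂ} (hf : Continuous f) (k : ℤ) : Continuous (xMode f k) := by
  obtain ⟨C, hC⟩ := isCompact_univ.exists_bound_of_continuousOn hf.continuousOn
  refine continuous_of_dominated (bound := fun _ => C) (fun y => ?_) (fun y => ?_)
    (integrable_const C) (Filter.Eventually.of_forall fun x => ?_)
  · exact Continuous.aestronglyMeasurable (by fun_prop)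
  · refine Filter.Eventually.of_forall fun x => ?_
    rw [norm_mul, norm_fourier_apply, one_mul]
    exact hC _ (mem_univ _)
  · fun_prop

theorem hasDerivAt_xMode {f : T2 → ℂ} (hf : SmoothTorus f) (k : ℤ) (s : ℝ) :
    HasDerivAt (fun r : ℝ => xMode f k (r : T1)) (xMode (dy f) k (s : T1)) s := by
  obtain ⟨C, hC⟩ := isCompact_univ.exists_bound_of_continuousOn hf.dy.continuous.continuousOn
  have hc := hf.continuous
  have hc' := hf.dy.continuous
  refine (hasDerivAt_integral_of_dominated_loc_of_deriv_le (μ := μ1) (s := univ)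
    (F := fun (r : ℝ) x => fourier (-k) x * f (x, (r : T1)))
    (F' := fun (r : ℝ) x => fourier (-k) x * dy f (x, (r : T1))) (bound := fun _ => C)
    Filter.univ_mem (Filter.Eventually.of_forall fun r => ?_) ?_ ?_
    (Filter.Eventually.of_forall fun x r _ => ?_) (integrable_const C)
    (Filter.Eventually.of_forall fun x r _ => ?_)).2
  · exact Continuous.aestronglyMeasurable (by fun_prop)
  · exact Continuous.integrable_of_hasCompactSupport (by fun_prop)
      (HasCompactSupport.of_compactSpace _)
  · exact Continuous.aestronglyMeasurable (by fun_prop)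
  · rw [norm_mul, norm_fourier_apply, one_mul]
    exact hC _ (mem_univ _)
  · refine HasDerivAt.const_mul _ ?_
    have h := ((hf.contDiff_snd x).differentiable one_ne_zero r).hasDerivAt
    rw [← d1_coe (fun y => f (x, y))] at h
    exact h

theorem d1_xMode {f : T2 → ℂ} (hf : SmoothTorus f) (k : ℤ) : d1 (xMode f k) = xMode (dy f) k := by
  ext y
  obtain ⟨s, rfl⟩ := exists_coe_eq y
  rw [d1_coe]
  exact (hasDerivAt_xMode hf k s).deriv

theorem contDiff_xMode {f : T2 → ℂ} (hf : SmoothTorus f) (k : ℤ) :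
    ContDiff ℝ 1 (fun s : ℝ => xMode f k (s : T1)) := by
  rw [contDiff_one_iff_deriv]
  refine ⟨fun s => (hasDerivAt_xMode hf k s).differentiableAt, ?_⟩
  have : deriv (fun s : ℝ => xMode f k (s : T1)) = fun s : ℝ => xMode (dy f) k (s : T1) := by
    ext s; exact (hasDerivAt_xMode hf k s).deriv
  rw [this]
  exact (continuous_xMode hf.dy.continuous k).comp (AddCircle.continuous_mk' _)

theorem coeff_dx {f : T2 → ℂ} (hf : SmoothTorus f) (k l : ℤ) :
    coeff (dx f) k l = Complex.I * k * coeff f k l := by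
  rw [coeff_eq_fourierCoeff hf.dx.integrable, coeff_eq_fourierCoeff hf.integrable,
    ← fourierCoeff.const_mul]
  congr 1; ext y; exact xMode_dx hf k y

theorem coeff_dy {f : T2 → ℂ} (hf : SmoothTorus f) (k l : ℤ) :
    coeff (dy f) k l = Complex.I * l * coeff f k l := by
  rw [coeff_eq_fourierCoeff hf.dy.integrable, coeff_eq_fourierCoeff hf.integrable, ← d1_xMode hf,
    fourierCoeff_d1 (contDiff_xMode hf k)]

theorem coeff_add {f g : T2 → ℂ} (hf : Integrable f μ2) (hg : Integrable g μ2) (k l : ℤ) :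
    coeff (fun p => f p + g p) k l = coeff f k l + coeff g k l := by
  simp only [coeff, mul_add]
  exact integral_add (integrable_fourier_mul hf _ _) (integrable_fourier_mul hg _ _)

theorem coeff_lap {f : T2 → ℂ} (hf : SmoothTorus f) (k l : ℤ) :
    coeff (lap f) k l = -((k : ℂ) ^ 2 + (l : ℂ) ^ 2) * coeff f k l := by
  have : lap f = fun p => dx (dx f) p + dy (dy f) p := rfl
  rw [this, coeff_add hf.dx.dx.integrable hf.dy.dy.integrable, coeff_dx hf.dx, coeff_dx hf,
    coeff_dy hf.dy, coeff_dy hf]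
  linear_combination ((k : ℂ) ^ 2 + (l : ℂ) ^ 2) * coeff f k l * Complex.I_sq

theorem integrable_slice_fst {f : T2 → ℂ} (hf : Continuous f) (k : ℤ) (y : T1) :
    Integrable (fun x => fourier k x * f (x, y)) μ1 :=
  Continuous.integrable_of_hasCompactSupport (by fun_prop) (HasCompactSupport.of_compactSpace _)

theorem xMode_lap {f : T2 → ℂ} (hf : SmoothTorus f) (k : ℤ) (y : T1) :
    xMode (lap f) k y = -((k : ℂ) ^ 2 * xMode f k y - d1 (d1 (xMode f k)) y) := by
  rw [d1_xMode hf, d1_xMode hf.dy]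
  have h : xMode (lap f) k y = xMode (dx (dx f)) k y + xMode (dy (dy f)) k y := by
    simp only [xMode, lap, mul_add]
    exact integral_add (integrable_slice_fst hf.dx.dx.continuous _ y)
      (integrable_slice_fst hf.dy.dy.continuous _ y)
  rw [h, xMode_dx hf.dx, xMode_dx hf]
  linear_combination (k : ℂ) ^ 2 * xMode f k y * Complex.I_sq

/-- `A_k g_k` is minus the `k`-th mode of `Δρ₀`, so Parseval for the Laplacian computes its norm. -/
theorem modeA_eq {f : T2 → ℂ} (hf : SmoothTorus f) (k : ℤ) :
    modeA f k = norm1 (xMode (lap f) k) := by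
  have : xMode (lap f) k = -(fun y => (k : ℂ) ^ 2 * xMode f k y - d1 (d1 (xMode f k)) y) := by
    ext y; exact xMode_lap hf k y
  rw [this, norm1, eLpNorm_neg]; rfl

theorem hasSum_modeA_sq {f : T2 → ℂ} (hf : SmoothTorus f) (k : ℤ) :
    HasSum (fun l : ℤ => (((k : ℝ) ^ 2 + (l : ℝ) ^ 2) * ‖coeff f k l‖) ^ 2) (modeA f k ^ 2) := by
  rw [modeA_eq hf]
  convert hasSum_coeff_sq hf.lap.memLp k using 3 with l
  rw [coeff_lap hf, norm_mul, norm_neg]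
  congr 1
  have : ((k : ℂ) ^ 2 + (l : ℂ) ^ 2) = (((k : ℝ) ^ 2 + (l : ℝ) ^ 2 : ℝ) : ℂ) := by push_cast; rfl
  rw [this, Complex.norm_real, Real.norm_of_nonneg (by positivity)]

/-! ### Weak derivatives of functions of one real variable -/

/-- A smooth function on the line that is supported in a compact subset of `(0, ∞)`. -/
def IsCutoff (χ : ℝ → ℝ) : Prop :=
  ContDiff ℝ (⊤ : ℕ∞) χ ∧ ∃ a b : ℝ, 0 < a ∧ a ≤ b ∧ ∀ t, t ∉ Icc a b → χ t = 0

/-- The smooth step from `0` to `1` on the interval `[s, s + 1 / n]`. -/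
noncomputable def smoothStep (n s t : ℝ) : ℝ := smoothTransition (n * (t - s))

theorem contDiff_smoothStep (n s : ℝ) : ContDiff ℝ (⊤ : ℕ∞) (smoothStep n s) :=
  smoothTransition.contDiff.comp (contDiff_const.mul (contDiff_id.sub contDiff_const))

theorem smoothStep_mem_Icc (n s t : ℝ) : smoothStep n s t ∈ Icc (0 : ℝ) 1 :=
  ⟨smoothTransition.nonneg _, smoothTransition.le_one _⟩

theorem smoothStep_of_le {n s t : ℝ} (hn : 0 ≤ n) (h : t ≤ s) : smoothStep n s t = 0 :=
  smoothTransition.zero_of_nonpos (mul_nonpos_of_nonneg_of_nonpos hn (by linarith))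

theorem smoothStep_of_ge {n s t : ℝ} (hn : 0 < n) (h : s + 1 / n ≤ t) : smoothStep n s t = 1 := by
  refine smoothTransition.one_of_one_le ?_
  have : n * (1 / n) ≤ n * (t - s) := by gcongr; linarith
  rwa [mul_one_div_cancel hn.ne'] at this

theorem continuous_deriv_smoothTransition : Continuous (deriv smoothTransition) :=
  (smoothTransition.contDiff (n := 1)).continuous_deriv le_rfl

theorem deriv_smoothStep (n s t : ℝ) :
    deriv (smoothStep n s) t = n * deriv smoothTransition (n * (t - s)) := by
  have h1 : HasDerivAt (fun t : ℝ => n * (t - s)) n t := by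
    simpa using ((hasDerivAt_id t).sub_const s).const_mul n
  have h2 : DifferentiableAt ℝ smoothTransition (n * (t - s)) :=
    (smoothTransition.contDiff (n := 1)).differentiable one_ne_zero _
  have := h2.hasDerivAt.comp t h1
  rw [mul_comm]
  exact this.deriv

theorem deriv_smoothTransition_of_notMem {r : ℝ} (hr : r ∉ Icc (0 : ℝ) 1) :
    deriv smoothTransition r = 0 := by
  rw [mem_Icc, not_and_or, not_le, not_le] at hr
  rcases hr with hr | hr
  · have : smoothTransition =ᶠ[nhds r] fun _ => 0 := by
      filter_upwards [gt_mem_nhds hr] with x hx using smoothTransition.zero_of_nonpos (le_of_lt hx)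
    rw [this.deriv_eq, deriv_const]
  · have : smoothTransition =ᶠ[nhds r] fun _ => 1 := by
      filter_upwards [lt_mem_nhds hr] with x hx using smoothTransition.one_of_one_le (le_of_lt hx)
    rw [this.deriv_eq, deriv_const]

theorem integral_deriv_smoothTransition : ∫ r, deriv smoothTransition r = 1 := by
  have hsupp : Function.support (deriv smoothTransition) ⊆ Ioc (-1) 2 := fun r hr => by
    by_contra h
    refine hr (deriv_smoothTransition_of_notMem fun h' => h ⟨?_, ?_⟩)
    · linarith [h'.1]
    · linarith [h'.2]
  rw [← intervalIntegral.integral_eq_integral_of_support_subset hsupp,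
    intervalIntegral.integral_deriv_eq_sub
      (fun r _ => (smoothTransition.contDiff (n := 1)).differentiable one_ne_zero r)
      (continuous_deriv_smoothTransition.intervalIntegrable _ _),
    smoothTransition.one_of_one_le (by norm_num), smoothTransition.zero_of_nonpos (by norm_num)]
  norm_num

-- The derivative of the step is an approximate identity on `[s, s + 1/(n+1)]`. The substitution `t
-- = s + r/(n+1)` turns it into a fixed density of mass one on `[0, 1]`.
open Filter Topology in
theorem tendsto_integral_deriv_smoothStep {c : ℝ → ℂ} (hc : Continuous c) (s : ℝ) :
    Tendsto (fun n : ℕ => ∫ t, ((deriv (smoothStep ((n : ℝ) + 1) s) t : ℝ) : ℂ) * c t) atTop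
      (𝓝 (c s)) := by
  have hcv : ∀ n : ℕ, ∫ t, ((deriv (smoothStep ((n : ℝ) + 1) s) t : ℝ) : ℂ) * c t =
      ∫ r, ((deriv smoothTransition r : ℝ) : ℂ) * c (s + r / ((n : ℝ) + 1)) := fun n => by
    have hn : (0 : ℝ) < (n : ℝ) + 1 := by positivity
    have h1 := integral_sub_right_eq_self (μ := volume)
      (fun t : ℝ => (((n : ℝ) + 1 : ℝ) : ℂ) *
        (((deriv smoothTransition (((n : ℝ) + 1) * t) : ℝ) : ℂ) * c (s + t))) s
    have h2 := Measure.integral_comp_mul_left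
      (fun r : ℝ => ((deriv smoothTransition r : ℝ) : ℂ) * c (s + r / ((n : ℝ) + 1))) ((n : ℝ) + 1)
    have h3 : ∀ t : ℝ, ((n : ℝ) + 1) * t / ((n : ℝ) + 1) = t := fun t => by field_simp
    simp_rw [h3] at h2
    rw [integral_const_mul, integral_const_mul, h2, abs_of_pos (inv_pos.2 hn), Complex.real_smul,
      ← mul_assoc, ← Complex.ofReal_mul, mul_inv_cancel₀ hn.ne', Complex.ofReal_one, one_mul] at h1
    rw [← h1, ← integral_const_mul]
    congr 1; ext t
    rw [deriv_smoothStep, add_sub_cancel]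
    push_cast; ring
  simp_rw [hcv]
  have hlim : ∫ r, ((deriv smoothTransition r : ℝ) : ℂ) * c s = c s := by
    rw [integral_mul_const, integral_complex_ofReal, integral_deriv_smoothTransition]
    simp
  rw [← hlim]
  obtain ⟨A, hA⟩ := isCompact_Icc.exists_bound_of_continuousOn
    (continuous_deriv_smoothTransition.continuousOn (s := Icc (0 : ℝ) 1))
  obtain ⟨B, hB⟩ := isCompact_Icc.exists_bound_of_continuousOn
    (hc.continuousOn (s := Icc s (s + 1)))
  have hσ := continuous_deriv_smoothTransition
  refine tendsto_integral_of_dominated_convergence ((Icc (0 : ℝ) 1).indicator fun _ => A * B)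
    (fun n => Continuous.aestronglyMeasurable ?_)
    ((integrable_indicator_iff measurableSet_Icc).2
      (integrableOn_const measure_Icc_lt_top.ne))
    (fun n => Eventually.of_forall fun r => ?_) (Eventually.of_forall fun r => ?_)
  · exact (Complex.continuous_ofReal.comp hσ).mul (hc.comp (by fun_prop))
  · by_cases hr : r ∈ Icc (0 : ℝ) 1
    · rw [indicator_of_mem hr, norm_mul, Complex.norm_real]
      have hn : (0 : ℝ) < (n : ℝ) + 1 := by positivity
      have h1 : r / ((n : ℝ) + 1) ≤ 1 := by
        rw [div_le_one hn]; have := hr.2; have : (0 : ℝ) ≤ n := by positivity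
        linarith
      have h0 : 0 ≤ r / ((n : ℝ) + 1) := div_nonneg hr.1 hn.le
      exact mul_le_mul (hA r hr) (hB _ ⟨by linarith, by linarith⟩) (norm_nonneg _)
        ((norm_nonneg _).trans (hA r hr))
    · rw [indicator_of_notMem hr, deriv_smoothTransition_of_notMem hr]; simp
  · refine Tendsto.const_mul _ ((hc.tendsto' s _ rfl).comp ?_)
    have : Tendsto (fun n : ℕ => r * (1 / ((n : ℝ) + 1))) atTop (𝓝 (r * 0)) :=
      tendsto_one_div_add_atTop_nhds_zero_nat.const_mul r
    have := this.const_add s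
    simpa [div_eq_mul_inv] using this

open Filter Topology in
theorem tendsto_smoothStep (s t : ℝ) :
    Tendsto (fun n : ℕ => smoothStep ((n : ℝ) + 1) s t) atTop (𝓝 ((Ioi s).indicator 1 t)) := by
  by_cases h : s < t
  · rw [indicator_of_mem (show t ∈ Ioi s from h)]
    have h1 : Tendsto (fun n : ℕ => s + 1 / ((n : ℝ) + 1)) atTop (𝓝 (s + 0)) :=
      tendsto_one_div_add_atTop_nhds_zero_nat.const_add s
    rw [add_zero] at h1
    refine Tendsto.congr' ?_ tendsto_const_nhds
    filter_upwards [h1.eventually (gt_mem_nhds h)] with n hn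
    exact (smoothStep_of_ge (by positivity) (le_of_lt hn)).symm
  · rw [indicator_of_notMem (show t ∉ Ioi s from h)]
    refine Tendsto.congr (fun n => ?_) tendsto_const_nhds
    exact (smoothStep_of_le (by positivity) (not_lt.1 h)).symm

theorem isCutoff_smoothStep_sub {n s t : ℝ} (hn : 1 ≤ n) (hs : 0 < s) (hst : s ≤ t) :
    IsCutoff (fun τ => smoothStep n s τ - smoothStep n t τ) := by
  refine ⟨(contDiff_smoothStep n s).sub (contDiff_smoothStep n t), s, t + 1, hs, by linarith,
    fun τ hτ => ?_⟩
  rw [mem_Icc, not_and_or, not_le, not_le] at hτ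
  have h1 : 1 / n ≤ 1 := by rw [div_le_one (by linarith)]; exact hn
  beta_reduce
  rcases hτ with h | h
  · rw [smoothStep_of_le (by linarith) h.le, smoothStep_of_le (by linarith) (by linarith), sub_self]
  · rw [smoothStep_of_ge (by linarith) (by linarith), smoothStep_of_ge (by linarith) (by linarith),
      sub_self]

theorem integrable_deriv_smoothStep_mul {c : ℝ → ℂ} (hc : Continuous c) {n : ℝ} (hn : 1 ≤ n)
    (s : ℝ) : Integrable (fun t => ((deriv (smoothStep n s) t : ℝ) : ℂ) * c t) := by
  refine Continuous.integrable_of_hasCompactSupport ?_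
    (HasCompactSupport.intro (isCompact_Icc (a := s) (b := s + 1)) fun t ht => ?_)
  · exact (Complex.continuous_ofReal.comp
      ((contDiff_smoothStep n s).continuous_deriv (by simp))).mul hc
  · rw [deriv_smoothStep, deriv_smoothTransition_of_notMem]
    · simp
    · intro h
      have h0 : 0 ≤ t - s := nonneg_of_mul_nonneg_right h.1 (by linarith)
      refine ht ⟨by linarith, ?_⟩
      nlinarith [h.2]

-- The difference of the steps at `s` and `t` is an admissible cutoff. It tends to the indicator of
-- `(s, t]`, while its derivative tends to `δ_s - δ_t`.
open Filter Topology in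
theorem sub_eq_integral_of_weak_deriv_of_pos {c h : ℝ → ℂ} (hc : Continuous c)
    (hh : ∀ T : ℝ, 0 ≤ T → IntegrableOn h (Ioc 0 T))
    (hweak : ∀ χ : ℝ → ℝ, IsCutoff χ →
      ∫ t in Ioi (0 : ℝ), (((deriv χ t : ℝ) : ℂ) * c t + (χ t : ℂ) * h t) = 0)
    {s t : ℝ} (hs : 0 < s) (hst : s ≤ t) : c t - c s = ∫ τ in s..t, h τ := by
  have hpos : ∀ {r : ℝ}, 0 < r → ∀ n : ℕ,
      ∫ τ in Ioi (0 : ℝ), ((deriv (smoothStep ((n : ℝ) + 1) r) τ : ℝ) : ℂ) * c τ =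
        ∫ τ, ((deriv (smoothStep ((n : ℝ) + 1) r) τ : ℝ) : ℂ) * c τ := fun {r} hr n => by
    refine setIntegral_eq_integral_of_forall_compl_eq_zero fun τ hτ => ?_
    rw [deriv_smoothStep, deriv_smoothTransition_of_notMem]
    · simp
    · intro h'
      have hτ0 : τ ≤ 0 := not_lt.1 hτ
      have := nonneg_of_mul_nonneg_right h'.1 (by positivity : (0 : ℝ) < (n : ℝ) + 1)
      linarith
  -- Beyond `t + 1` both steps equal `1`, since their widths are at most `1`, so this function
  -- dominates for every `n`.
  set B : ℝ → ℝ := (Ioc 0 (t + 1)).indicator fun τ => ‖h τ‖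
  have hB : IntegrableOn B (Ioi 0) := by
    refine Integrable.integrableOn ?_
    rw [integrable_indicator_iff measurableSet_Ioc]
    exact (hh (t + 1) (by linarith)).norm
  have hb : ∀ n : ℕ, ∀ τ ∈ Ioi (0 : ℝ), ‖((smoothStep ((n : ℝ) + 1) s τ -
      smoothStep ((n : ℝ) + 1) t τ : ℝ) : ℂ) * h τ‖ ≤ B τ := fun n τ hτ => by
    by_cases hτ' : τ ≤ t + 1
    · rw [show B τ = ‖h τ‖ from indicator_of_mem (show τ ∈ Ioc 0 (t + 1) from ⟨hτ, hτ'⟩) _,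
        norm_mul, Complex.norm_real]
      refine mul_le_of_le_one_left (norm_nonneg _) (abs_le.2 ?_)
      have h1 := smoothStep_mem_Icc ((n : ℝ) + 1) s τ
      have h2 := smoothStep_mem_Icc ((n : ℝ) + 1) t τ
      exact ⟨by linarith [h1.1, h2.2], by linarith [h1.2, h2.1]⟩
    · have hn : (1 : ℝ) ≤ (n : ℝ) + 1 := by have : (0 : ℝ) ≤ n := by positivity
                                            linarith
      have h1 : 1 / ((n : ℝ) + 1) ≤ 1 := by rw [div_le_one (by linarith)]; exact hn
      rw [smoothStep_of_ge (by linarith) (by linarith),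
        smoothStep_of_ge (by linarith) (by linarith)]
      simpa using indicator_nonneg (fun _ _ => norm_nonneg _) τ
  have hmeas : ∀ n : ℕ, AEStronglyMeasurable (fun τ => ((smoothStep ((n : ℝ) + 1) s τ -
      smoothStep ((n : ℝ) + 1) t τ : ℝ) : ℂ) * h τ) (volume.restrict (Ioi 0)) := fun n => by
    refine AEStronglyMeasurable.mul (Continuous.aestronglyMeasurable ?_) ?_
    · exact Complex.continuous_ofReal.comp
        ((contDiff_smoothStep _ s).continuous.sub (contDiff_smoothStep _ t).continuous)
    · have hU : Ioi (0 : ℝ) = ⋃ N : ℕ, Ioc 0 (N : ℝ) := by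
        ext τ
        simp only [mem_Ioi, mem_iUnion, mem_Ioc]
        exact ⟨fun hτ => (exists_nat_ge τ).imp fun N hN => ⟨hτ, hN⟩, fun ⟨_, hN⟩ => hN.1⟩
      rw [hU, aestronglyMeasurable_iUnion_iff]
      exact fun N => (hh N (by positivity)).aestronglyMeasurable
  have hzero : ∀ n : ℕ,
      (∫ τ, ((deriv (smoothStep ((n : ℝ) + 1) s) τ : ℝ) : ℂ) * c τ) -
        (∫ τ, ((deriv (smoothStep ((n : ℝ) + 1) t) τ : ℝ) : ℂ) * c τ) +
        ∫ τ in Ioi (0 : ℝ), ((smoothStep ((n : ℝ) + 1) s τ -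
          smoothStep ((n : ℝ) + 1) t τ : ℝ) : ℂ) * h τ = 0 := fun n => by
    have hn : (1 : ℝ) ≤ (n : ℝ) + 1 := by have : (0 : ℝ) ≤ n := by positivity
                                          linarith
    have h0 := hweak _ (isCutoff_smoothStep_sub hn hs hst)
    have i1 := (integrable_deriv_smoothStep_mul hc hn s).integrableOn (s := Ioi 0)
    have i2 := (integrable_deriv_smoothStep_mul hc hn t).integrableOn (s := Ioi 0)
    have i3 : IntegrableOn (fun τ => ((smoothStep ((n : ℝ) + 1) s τ -
        smoothStep ((n : ℝ) + 1) t τ : ℝ) : ℂ) * h τ) (Ioi 0) :=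
      Integrable.mono' hB (hmeas n) ((ae_restrict_iff' measurableSet_Ioi).2
        (Eventually.of_forall (hb n)))
    have hd : ∀ τ, ((deriv (fun τ => smoothStep ((n : ℝ) + 1) s τ -
        smoothStep ((n : ℝ) + 1) t τ) τ : ℝ) : ℂ) * c τ =
        ((deriv (smoothStep ((n : ℝ) + 1) s) τ : ℝ) : ℂ) * c τ -
        ((deriv (smoothStep ((n : ℝ) + 1) t) τ : ℝ) : ℂ) * c τ := fun τ => by
      rw [deriv_fun_sub ((contDiff_smoothStep _ s).differentiable (by simp) τ)
        ((contDiff_smoothStep _ t).differentiable (by simp) τ)]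
      push_cast; ring
    simp_rw [hd] at h0
    rw [integral_add (by exact i1.sub i2) i3, integral_sub i1 i2, hpos hs, hpos (hs.trans_le hst)] at h0
    exact h0
  have hlim : Tendsto (fun n : ℕ => ∫ τ in Ioi (0 : ℝ), ((smoothStep ((n : ℝ) + 1) s τ -
      smoothStep ((n : ℝ) + 1) t τ : ℝ) : ℂ) * h τ) atTop (𝓝 (∫ τ in s..t, h τ)) := by
    have e : ∫ τ in s..t, h τ = ∫ τ in Ioi (0 : ℝ), (Ioc s t).indicator h τ := by
      rw [intervalIntegral.integral_of_le hst, integral_indicator measurableSet_Ioc,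
        Measure.restrict_restrict measurableSet_Ioc]
      congr 2
      exact (inter_eq_left.2 fun τ hτ => hs.trans hτ.1).symm
    rw [e]
    refine tendsto_integral_of_dominated_convergence B hmeas hB (fun n =>
      (ae_restrict_iff' measurableSet_Ioi).2 (Eventually.of_forall (hb n)))
      (Eventually.of_forall fun τ => ?_)
    have h1 := ((tendsto_smoothStep s τ).sub (tendsto_smoothStep t τ))
    have h2 := ((Complex.continuous_ofReal.tendsto _).comp h1).mul_const (h τ)
    convert h2 using 2
    · rfl
    simp only [indicator, mem_Ioc, mem_Ioi, Pi.one_apply]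
    by_cases h3 : s < τ <;> by_cases h4 : t < τ
    · simp [h3, h4]
    · simp [h3, h4, not_lt.1 h4]
    · exact absurd (hst.trans_lt h4) h3
    · simp [h3, h4]
  have := (((tendsto_integral_deriv_smoothStep hc s).sub
    (tendsto_integral_deriv_smoothStep hc t)).add hlim)
  have := tendsto_nhds_unique (this.congr hzero) tendsto_const_nhds
  linear_combination -this

-- Cutoffs only see positive times. The initial value is recovered by letting `s → 0⁺`, using
-- continuity of `c` and integrability of `h` up to `0`.
open Filter Topology in
theorem eq_add_integral_of_weak_deriv {c h : ℝ → ℂ} (hc : Continuous c)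
    (hh : ∀ T : ℝ, 0 ≤ T → IntegrableOn h (Ioc 0 T))
    (hweak : ∀ χ : ℝ → ℝ, IsCutoff χ →
      ∫ t in Ioi (0 : ℝ), (((deriv χ t : ℝ) : ℂ) * c t + (χ t : ℂ) * h t) = 0)
    {t : ℝ} (ht : 0 ≤ t) : c t = c 0 + ∫ τ in (0 : ℝ)..t, h τ := by
  rcases ht.eq_or_lt with rfl | ht
  · simp
  have hi : IntervalIntegrable h volume 0 t :=
    (intervalIntegrable_iff_integrableOn_Ioc_of_le ht.le).2 (hh t ht.le)
  have hev : ∀ᶠ s in 𝓝[>] (0 : ℝ), c t - c s + ∫ τ in (0 : ℝ)..s, h τ = ∫ τ in (0 : ℝ)..t, h τ := by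
    filter_upwards [Ioo_mem_nhdsGT ht] with s hs
    rw [sub_eq_integral_of_weak_deriv_of_pos hc hh hweak hs.1 hs.2.le, add_comm]
    refine intervalIntegral.integral_add_adjacent_intervals ?_ ?_
    · exact (intervalIntegrable_iff_integrableOn_Ioc_of_le hs.1.le).2 (hh s hs.1.le)
    · exact (intervalIntegrable_iff_integrableOn_Ioc_of_le hs.2.le).2
        ((hh t ht.le).mono_set (Ioc_subset_Ioc_left hs.1.le))
  have hprim : Tendsto (fun s => ∫ τ in (0 : ℝ)..s, h τ) (𝓝[>] 0) (𝓝 0) := by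
    have h1 := intervalIntegral.continuousOn_primitive_interval' hi left_mem_uIcc 0 left_mem_uIcc
    rw [ContinuousWithinAt, intervalIntegral.integral_same, uIcc_of_le ht.le] at h1
    refine h1.mono_left (le_trans ?_ (nhdsWithin_mono 0 Ioo_subset_Icc_self))
    rw [nhdsWithin_Ioo_eq_nhdsGT ht]
  have hl := ((hc.tendsto 0).mono_left nhdsWithin_le_nhds).const_sub (c t) |>.add hprim
  have := tendsto_nhds_unique (hl.congr' hev) tendsto_const_nhds
  linear_combination this

/-! ### An energy identity for absolutely continuous functions -/

theorem absolutelyContinuousOnInterval_const_add_integral {f : ℝ → ℝ} {T : ℝ} (a : ℝ)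
    (hf : IntervalIntegrable f volume 0 T) :
    AbsolutelyContinuousOnInterval (fun t => a + ∫ s in (0 : ℝ)..t, f s) 0 T :=
  AbsolutelyContinuousOnInterval.fun_add
    ((LipschitzWith.const a).lipschitzOnWith (s := uIcc 0 T)).absolutelyContinuousOnInterval
    (hf.absolutelyContinuousOnInterval_intervalIntegral left_mem_uIcc)

theorem intervalIntegral_re {h : ℝ → ℂ} {t : ℝ} (hh : IntervalIntegrable h volume 0 t) :
    (∫ s in (0 : ℝ)..t, h s).re = ∫ s in (0 : ℝ)..t, (h s).re :=
  (Complex.reCLM.intervalIntegral_comp_comm hh).symm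

theorem intervalIntegral_im {h : ℝ → ℂ} {t : ℝ} (hh : IntervalIntegrable h volume 0 t) :
    (∫ s in (0 : ℝ)..t, h s).im = ∫ s in (0 : ℝ)..t, (h s).im :=
  (Complex.imCLM.intervalIntegral_comp_comm hh).symm

/-- `h` is merely integrable. The real and imaginary parts of `c` are absolutely continuous, and so
is the weighted square; the product rule holds almost everywhere and the fundamental theorem
applies. -/
theorem exp_mul_norm_sq_sub_eq_integral {c h : ℝ → ℂ} {T : ℝ} (Λ : ℝ) (hT : 0 ≤ T)
    (hh : IntervalIntegrable h volume 0 T)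
    (hc : ∀ t ∈ Icc 0 T, c t = c 0 + ∫ s in (0 : ℝ)..t, h s) :
    exp (2 * Λ * T) * ‖c T‖ ^ 2 - ‖c 0‖ ^ 2 = ∫ t in (0 : ℝ)..T,
      exp (2 * Λ * t) * (2 * Λ * ‖c t‖ ^ 2 + 2 * ((starRingEnd ℂ) (c t) * h t).re) := by
  have hre : IntervalIntegrable (fun s => (h s).re) volume 0 T :=
    ⟨hh.1.re, hh.2.re⟩
  have him : IntervalIntegrable (fun s => (h s).im) volume 0 T :=
    ⟨hh.1.im, hh.2.im⟩
  -- `c` is controlled only on `[0, T]`; `u` and `v` are given by the integral formula everywhere,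
  -- so they can be differentiated in its place.
  set u : ℝ → ℝ := fun t => (c 0).re + ∫ s in (0 : ℝ)..t, (h s).re with hu
  set v : ℝ → ℝ := fun t => (c 0).im + ∫ s in (0 : ℝ)..t, (h s).im with hv
  have hsub : ∀ t ∈ Icc 0 T, IntervalIntegrable h volume 0 t := fun t ht =>
    hh.mono_set (by rw [uIcc_of_le ht.1, uIcc_of_le hT]; exact Icc_subset_Icc_right ht.2)
  have hcu : ∀ t ∈ Icc 0 T, (c t).re = u t := fun t ht => by
    rw [hc t ht, Complex.add_re, intervalIntegral_re (hsub t ht)]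
  have hcv : ∀ t ∈ Icc 0 T, (c t).im = v t := fun t ht => by
    rw [hc t ht, Complex.add_im, intervalIntegral_im (hsub t ht)]
  have hn : ∀ t ∈ Icc 0 T, ‖c t‖ ^ 2 = u t * u t + v t * v t := fun t ht => by
    rw [Complex.sq_norm, Complex.normSq_apply, hcu t ht, hcv t ht]
  have hE : ∀ t, HasDerivAt (fun t => exp (2 * Λ * t)) (2 * Λ * exp (2 * Λ * t)) t := fun t => by
    have := ((hasDerivAt_id t).const_mul (2 * Λ)).exp
    simpa [mul_comm] using this
  have hEc : Continuous (fun t => 2 * Λ * exp (2 * Λ * t)) := by fun_prop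
  have hEac : AbsolutelyContinuousOnInterval (fun t => exp (2 * Λ * t)) 0 T := by
    have := absolutelyContinuousOnInterval_const_add_integral 1 (hEc.intervalIntegrable 0 T)
    convert this using 2 with t
    rw [intervalIntegral.integral_eq_sub_of_hasDerivAt (fun s _ => hE s)
      (hEc.intervalIntegrable 0 t)]
    simp
  have huac := absolutelyContinuousOnInterval_const_add_integral (c 0).re hre
  have hvac := absolutelyContinuousOnInterval_const_add_integral (c 0).im him
  have hac := hEac.fun_mul ((huac.fun_mul huac).fun_add (hvac.fun_mul hvac))
  have hfin := hac.integral_deriv_eq_sub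
  have h0 : (0 : ℝ) ∈ Icc 0 T := ⟨le_rfl, hT⟩
  have hTT : T ∈ Icc 0 T := ⟨hT, le_rfl⟩
  rw [hn T hTT, hn 0 h0]
  rw [mul_zero, Real.exp_zero, one_mul] at hfin
  rw [← hfin]
  refine intervalIntegral.integral_congr_ae ?_
  filter_upwards [hre.ae_hasDerivAt_integral, him.ae_hasDerivAt_integral] with t h1 h2 ht
  have ht' : t ∈ uIcc 0 T := uIoc_subset_uIcc ht
  have hd1 := (h1 ht' 0 left_mem_uIcc).const_add (c 0).re
  have hd2 := (h2 ht' 0 left_mem_uIcc).const_add (c 0).im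
  have hd := (hE t).fun_mul ((hd1.fun_mul hd1).fun_add (hd2.fun_mul hd2))
  refine hd.deriv.trans ?_
  rw [uIcc_of_le hT] at ht'
  simp only [Complex.mul_re, Complex.conj_re, Complex.conj_im]
  rw [hn t ht', hcu t ht', hcv t ht']
  simp only [hu, hv]
  ring

/-! ### Evolution equations `f' = -λ f - i κ B(t) f` in a Hilbert space -/

section Evolution

variable {ι H : Type*} [NormedAddCommGroup H] [InnerProductSpace ℂ H]

/-- `f` solves `f' = -λ f - i κ B(t) f` coefficientwise, where `λ` acts diagonally in the Hilbert
basis `b` and the operators `B(t)` are symmetric with norm at most `M`. -/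
structure IsEvolution (b : HilbertBasis ι ℂ H) (lam : ι → ℝ) (κ M : ℝ) (B : ℝ → H → H)
    (f : ℝ → H) : Prop where
  map_add : ∀ t x y, B t (x + y) = B t x + B t y
  symm : ∀ t x y, inner ℂ (B t x) y = inner ℂ x (B t y)
  norm_le : ∀ t x, ‖B t x‖ ≤ M * ‖x‖
  bounded : ∀ T : ℝ, ∃ C : ℝ, ∀ t, t ≤ T → ‖f t‖ ≤ C
  continuous : ∀ l, Continuous fun t => inner ℂ (b l) (f t)
  measurable : ∀ l, AEStronglyMeasurable (fun t => inner ℂ (b l) (B t (f t))) volume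
  eq_integral : ∀ l t, 0 ≤ t → inner ℂ (b l) (f t) = inner ℂ (b l) (f 0) +
    ∫ s in (0 : ℝ)..t, (-(lam l : ℂ) * inner ℂ (b l) (f s) -
      Complex.I * κ * inner ℂ (b l) (B s (f s)))

variable {b : HilbertBasis ι ℂ H}

theorem sum_norm_inner_sq_le (b : HilbertBasis ι ℂ H) (F : Finset ι) (x : H) :
    ∑ l ∈ F, ‖inner ℂ (b l) x‖ ^ 2 ≤ ‖x‖ ^ 2 :=
  b.orthonormal.sum_inner_products_le x

theorem hasSum_norm_inner_sq (b : HilbertBasis ι ℂ H) (x : H) :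
    HasSum (fun l => ‖inner ℂ (b l) x‖ ^ 2) (‖x‖ ^ 2) := by
  have h := b.hasSum_inner_mul_inner x x
  rw [inner_self_eq_norm_sq_to_K] at h
  have h2 : ∀ l, inner ℂ x (b l) * inner ℂ (b l) x = ((‖inner ℂ (b l) x‖ ^ 2 : ℝ) : ℂ) := fun l => by
    rw [← inner_conj_symm, Complex.conj_mul']
    push_cast; rfl
  simp_rw [h2] at h
  have h3 : ((‖x‖ : ℂ)) ^ 2 = ((‖x‖ ^ 2 : ℝ) : ℂ) := by push_cast; rfl
  have := Complex.reCLM.hasSum h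
  simpa only [Complex.reCLM_apply, Function.comp_def, Complex.ofReal_re, h3,
    Complex.coe_algebraMap] using this

-- The sign is `2·1_S - 1`, so only a finite sum and the full sum occur, never a sum over the
-- complement of `S`.
open Classical in
theorem hasSum_signed {E : Type*} [NormedRing E] {a : ι → E} {A : E} (S : Finset ι)
    (h : HasSum a A) :
    HasSum (fun l => (if l ∈ S then 1 else -1) * a l) (2 * ∑ l ∈ S, a l - A) := by
  have h1 : HasSum (fun l => if l ∈ S then a l else 0) (∑ l ∈ S, a l) := by
    have : HasSum (fun l => if l ∈ S then a l else 0) (∑ l ∈ S, if l ∈ S then a l else 0) :=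
      hasSum_sum_of_ne_finset_zero (fun l hl => by simp [hl])
    rwa [Finset.sum_congr rfl fun l hl => if_pos hl] at this
  have e : (fun l => (if l ∈ S then 1 else -1) * a l) =
      fun l => 2 * (if l ∈ S then a l else 0) - a l := by
    ext l
    split_ifs <;> simp [two_mul]
  rw [e]
  exact (h1.mul_left 2).sub h

/-- The bound does not depend on `F`; it serves as the dominating constant when `F` exhausts the
basis. -/
theorem norm_sum_signed_le {x y : H} {w : ι → ℂ} (hw : ∀ l, ‖w l‖ ≤ 1) (F : Finset ι) :
    ‖∑ l ∈ F, w l * (inner ℂ x (b l) * inner ℂ (b l) y)‖ ≤ ‖x‖ * ‖y‖ := by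
  calc ‖∑ l ∈ F, w l * (inner ℂ x (b l) * inner ℂ (b l) y)‖
      ≤ ∑ l ∈ F, ‖inner ℂ (b l) x‖ * ‖inner ℂ (b l) y‖ := by
        refine (norm_sum_le _ _).trans (Finset.sum_le_sum fun l _ => ?_)
        rw [norm_mul, norm_mul, norm_inner_symm x]
        exact mul_le_of_le_one_left (by positivity) (hw l)
    _ ≤ √(∑ l ∈ F, ‖inner ℂ (b l) x‖ ^ 2) * √(∑ l ∈ F, ‖inner ℂ (b l) y‖ ^ 2) :=
        Real.sum_mul_le_sqrt_mul_sqrt _ _ _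
    _ ≤ ‖x‖ * ‖y‖ := by
        gcongr
        · exact Real.sqrt_le_iff.2 ⟨norm_nonneg _, sum_norm_inner_sq_le b F x⟩
        · exact Real.sqrt_le_iff.2 ⟨norm_nonneg _, sum_norm_inner_sq_le b F y⟩

namespace IsEvolution

variable {lam : ι → ℝ} {κ M : ℝ} {B : ℝ → H → H} {f : ℝ → H}

theorem intervalIntegrable (hf : IsEvolution b lam κ M B f) (l : ι) (T : ℝ) (hT : 0 ≤ T) :
    IntervalIntegrable (fun s => -(lam l : ℂ) * inner ℂ (b l) (f s) -
      Complex.I * κ * inner ℂ (b l) (B s (f s))) volume 0 T := by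
  obtain ⟨C, hC⟩ := hf.bounded T
  refine ((continuous_const.mul (hf.continuous l)).intervalIntegrable _ _).sub
    (IntervalIntegrable.const_mul ?_ _)
  rw [intervalIntegrable_iff_integrableOn_Ioc_of_le hT]
  refine Measure.integrableOn_of_bounded (M := |M| * C) (by simp) (hf.measurable l) ?_
  refine (ae_restrict_iff' measurableSet_Ioc).2 (Filter.Eventually.of_forall fun s hs => ?_)
  refine (norm_inner_le_norm _ _).trans ?_
  rw [b.orthonormal.1 l, one_mul]
  refine (hf.norm_le s _).trans ?_
  exact mul_le_mul (le_abs_self M) (hC s hs.2) (norm_nonneg _) (abs_nonneg _)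

theorem integrand_eq (lam κ Λ : ℝ) (c g : ℂ) :
    2 * Λ * ‖c‖ ^ 2 + 2 * ((starRingEnd ℂ) c * (-(lam : ℂ) * c - Complex.I * κ * g)).re =
      2 * ((Λ - lam) * ‖c‖ ^ 2 + κ * ((starRingEnd ℂ) c * g).im) := by
  rw [Complex.sq_norm, Complex.normSq_apply]
  simp
  ring

theorem im_inner_map_self (hf : IsEvolution b lam κ M B f) (t : ℝ) (x : H) :
    (inner ℂ x (B t x)).im = 0 := by
  have h := inner_conj_symm (𝕜 := ℂ) x (B t x)
  rw [hf.symm] at h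
  exact Complex.conj_eq_iff_im.1 h

/-- `⟨x, Bx⟩` is real, so only the cross term survives, and `2‖x‖‖y‖ ≤ ‖x‖² + ‖y‖² = ‖x + y‖²` by
orthogonality. -/
theorem abs_im_inner_map_le (hf : IsEvolution b lam κ M B f) (hM : 0 ≤ M) (t : ℝ) {x y : H}
    (hxy : inner ℂ x y = 0) : 2 * |(inner ℂ x (B t (x + y))).im| ≤ M * ‖x + y‖ ^ 2 := by
  rw [hf.map_add, inner_add_right, Complex.add_im, hf.im_inner_map_self, zero_add]
  have h1 : |(inner ℂ x (B t y)).im| ≤ ‖x‖ * (M * ‖y‖) :=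
    (Complex.abs_im_le_norm _).trans ((norm_inner_le_norm _ _).trans
      (mul_le_mul_of_nonneg_left (hf.norm_le t y) (norm_nonneg _)))
  have h2 : ‖x + y‖ ^ 2 = ‖x‖ ^ 2 + ‖y‖ ^ 2 := by
    have := norm_add_sq_eq_norm_sq_add_norm_sq_of_inner_eq_zero x y hxy
    nlinarith [this]
  rw [h2]
  nlinarith [mul_nonneg hM (sq_nonneg (‖x‖ - ‖y‖))]

/-- With `P` the projection onto `S`, the imaginary part is that of `⟨x, (2P - 1)Bx⟩`, which reduces
to `2 Im⟨Px, B(1-P)x⟩`. For empty `S` there is no cross term, hence no condition on `|κ| M`. -/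
theorem nonneg_of_gap (hf : IsEvolution b lam κ M B f) (hM : 0 ≤ M) (S : Finset ι) {η : ℝ}
    (hη : 0 ≤ η) (hS : S = ∅ ∨ |κ| * M ≤ η) (t : ℝ) (x : H) :
    0 ≤ η * ‖x‖ ^ 2 +
      κ * (2 * ∑ l ∈ S, inner ℂ x (b l) * inner ℂ (b l) (B t x) - inner ℂ x (B t x)).im := by
  rw [Complex.sub_im, hf.im_inner_map_self, sub_zero]
  rcases hS with rfl | hS
  · simp; positivity
  set p : H := ∑ l ∈ S, inner ℂ (b l) x • b l with hp
  have h1 : ∑ l ∈ S, inner ℂ x (b l) * inner ℂ (b l) (B t x) = inner ℂ p (B t x) := by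
    rw [hp, sum_inner]
    refine Finset.sum_congr rfl fun l _ => ?_
    rw [inner_smul_left, inner_conj_symm]
  have hpq : inner ℂ p (x - p) = 0 := by
    rw [hp, sum_inner]
    refine Finset.sum_eq_zero fun l hl => ?_
    rw [inner_smul_left, inner_sub_right, b.orthonormal.inner_right_sum _ hl, sub_self, mul_zero]
  have h2 := hf.abs_im_inner_map_le hM t hpq
  rw [add_sub_cancel] at h2
  rw [h1]
  have h3 : (2 * inner ℂ p (B t x)).im = 2 * (inner ℂ p (B t x)).im := by simp
  rw [h3]
  have h4 : |κ * (2 * (inner ℂ p (B t x)).im)| ≤ η * ‖x‖ ^ 2 := by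
    rw [abs_mul, abs_mul, abs_two]
    calc |κ| * (2 * |(inner ℂ p (B t x)).im|) ≤ |κ| * (M * ‖x‖ ^ 2) := by gcongr
      _ = |κ| * M * ‖x‖ ^ 2 := by ring
      _ ≤ η * ‖x‖ ^ 2 := by gcongr
  linarith [neg_abs_le (κ * (2 * (inner ℂ p (B t x)).im))]

open Classical Filter Topology in
/-- If `λ` has a gap of width `2 η` around `Λ` that separates the modes in `S` from the others,
then the signed energy `‖P f‖² - ‖(1 - P) f‖²`, where `P` is the projection to the modes in `S`,
decays at most at rate `2 Λ`. -/
theorem signed_energy_le [Countable ι] (hf : IsEvolution b lam κ M B f) (hM : 0 ≤ M)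
    (S : Finset ι) {Λ η : ℝ} (hη : 0 ≤ η) (hlow : ∀ l ∈ S, lam l + η ≤ Λ)
    (hhigh : ∀ l ∉ S, Λ + η ≤ lam l) (hS : S = ∅ ∨ |κ| * M ≤ η) {T : ℝ} (hT : 0 ≤ T) :
    2 * ∑ l ∈ S, ‖inner ℂ (b l) (f 0)‖ ^ 2 - ‖f 0‖ ^ 2 ≤
      exp (2 * Λ * T) * (2 * ∑ l ∈ S, ‖inner ℂ (b l) (f T)‖ ^ 2 - ‖f T‖ ^ 2) := by
  set σ : ι → ℝ := fun l => if l ∈ S then 1 else -1 with hσ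
  -- `Ψ F` bounds from below the derivative of the weighted signed energy of the modes in `F`, with
  -- `λ` already traded for the gap `η`. Its limit `Ψ'` therefore does not involve the possibly
  -- unbounded `λ`, and no regularity of `f t` is required.
  set Ψ : Finset ι → ℝ → ℝ := fun F t => exp (2 * Λ * t) * (2 * (η * ∑ l ∈ F,
    ‖inner ℂ (b l) (f t)‖ ^ 2 + κ * (∑ l ∈ F, ((if l ∈ S then 1 else -1 : ℂ)) *
      (inner ℂ (f t) (b l) * inner ℂ (b l) (B t (f t)))).im)) with hΨ
  set Ψ' : ℝ → ℝ := fun t => exp (2 * Λ * t) * (2 * (η * ‖f t‖ ^ 2 + κ *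
    (2 * ∑ l ∈ S, inner ℂ (f t) (b l) * inner ℂ (b l) (B t (f t)) -
      inner ℂ (f t) (B t (f t))).im)) with hΨ'
  have hconj : ∀ l t, inner ℂ (f t) (b l) = (starRingEnd ℂ) (inner ℂ (b l) (f t)) := fun l t =>
    (inner_conj_symm _ _).symm
  have hmeas : ∀ F, AEStronglyMeasurable (Ψ F) (volume.restrict (Ioc 0 T)) := fun F => by
    have hg : ∀ l, AEStronglyMeasurable (fun t => inner ℂ (b l) (B t (f t)))
      (volume.restrict (Ioc 0 T)) := fun l => (hf.measurable l).restrict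
    have hc : ∀ l, AEStronglyMeasurable (fun t => inner ℂ (b l) (f t))
      (volume.restrict (Ioc 0 T)) := fun l => (hf.continuous l).aestronglyMeasurable
    refine AEStronglyMeasurable.mul (Continuous.aestronglyMeasurable (by fun_prop))
      (AEStronglyMeasurable.const_mul (AEStronglyMeasurable.add
        (AEStronglyMeasurable.const_mul (Finset.aestronglyMeasurable_fun_sum _ fun l _ =>
          (hc l).norm.pow 2) _)
        (AEStronglyMeasurable.const_mul (Complex.continuous_im.comp_aestronglyMeasurable
          (Finset.aestronglyMeasurable_fun_sum _ fun l _ => ?_)) _)) _)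
    simp_rw [hconj]
    exact ((Complex.continuous_conj.comp_aestronglyMeasurable (hc l)).mul (hg l)).const_mul _
  obtain ⟨C, hC⟩ := hf.bounded T
  have hbound : ∀ F, ∀ᵐ t ∂(volume.restrict (Ioc 0 T)),
      ‖Ψ F t‖ ≤ exp (2 * |Λ| * T) * (2 * (η * C ^ 2 + |κ| * (C * (M * C)))) := fun F => by
    refine (ae_restrict_iff' measurableSet_Ioc).2 (Eventually.of_forall fun t ht => ?_)
    have hCt := hC t ht.2
    have hC0 : 0 ≤ C := (norm_nonneg _).trans hCt
    have h1 := sum_norm_inner_sq_le b F (f t)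
    have h2 : ‖∑ l ∈ F, ((if l ∈ S then 1 else -1 : ℂ)) *
        (inner ℂ (f t) (b l) * inner ℂ (b l) (B t (f t)))‖ ≤ ‖f t‖ * ‖B t (f t)‖ :=
      norm_sum_signed_le (fun l => by split_ifs <;> simp) F
    have h3 : ‖f t‖ * ‖B t (f t)‖ ≤ C * (M * C) := by
      have := hf.norm_le t (f t)
      gcongr
      exact this.trans (by gcongr)
    rw [hΨ, norm_mul, Real.norm_of_nonneg (exp_pos _).le, norm_mul, Real.norm_two]
    have hexp : 2 * Λ * t ≤ 2 * |Λ| * T := by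
      have : Λ * t ≤ |Λ| * T := mul_le_mul (le_abs_self Λ) ht.2 ht.1.le (abs_nonneg _)
      linarith
    refine mul_le_mul (exp_le_exp.2 hexp) ?_ (by positivity) (exp_pos _).le
    refine mul_le_mul_of_nonneg_left ((norm_add_le _ _).trans (add_le_add ?_ ?_)) zero_le_two
    · rw [Real.norm_of_nonneg (by positivity)]
      gcongr
      exact h1.trans (by gcongr)
    · rw [norm_mul]
      refine mul_le_mul_of_nonneg_left ?_ (norm_nonneg _)
      exact (Complex.abs_im_le_norm _).trans (h2.trans h3)
  have hlim : ∀ t, Tendsto (fun F => Ψ F t) atTop (𝓝 (Ψ' t)) := fun t => by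
    refine Tendsto.const_mul _ (Tendsto.const_mul _ (Tendsto.add ?_ (Tendsto.const_mul _ ?_)))
    · exact (hasSum_norm_inner_sq b (f t)).const_mul η
    · exact (Complex.continuous_im.tendsto _).comp
        (hasSum_signed S (b.hasSum_inner_mul_inner (f t) (B t (f t))))
  -- Countability of `ι` makes `atTop` on `Finset ι` countably generated, as dominated convergence
  -- requires.
  have hI := tendsto_integral_filter_of_dominated_convergence
    (fun _ => exp (2 * |Λ| * T) * (2 * (η * C ^ 2 + |κ| * (C * (M * C)))))
    (Eventually.of_forall hmeas) (Eventually.of_forall hbound)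
    (integrableOn_const measure_Ioc_lt_top.ne) (Eventually.of_forall hlim)
  have hI0 : 0 ≤ ∫ t in Ioc 0 T, Ψ' t := integral_nonneg fun t =>
    mul_nonneg (exp_pos _).le (mul_nonneg zero_le_two (hf.nonneg_of_gap hM S hη hS t (f t)))
  have hW : ∀ t, Tendsto (fun F : Finset ι => ∑ l ∈ F, σ l * ‖inner ℂ (b l) (f t)‖ ^ 2) atTop
      (𝓝 (2 * ∑ l ∈ S, ‖inner ℂ (b l) (f t)‖ ^ 2 - ‖f t‖ ^ 2)) := fun t =>
    hasSum_signed S (hasSum_norm_inner_sq b (f t))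
  have hle : ∀ F : Finset ι, ∫ t in Ioc 0 T, Ψ F t ≤
      exp (2 * Λ * T) * (∑ l ∈ F, σ l * ‖inner ℂ (b l) (f T)‖ ^ 2) -
        ∑ l ∈ F, σ l * ‖inner ℂ (b l) (f 0)‖ ^ 2 := fun F => by
    have hid : ∀ l, exp (2 * Λ * T) * ‖inner ℂ (b l) (f T)‖ ^ 2 - ‖inner ℂ (b l) (f 0)‖ ^ 2 =
        ∫ t in (0 : ℝ)..T, exp (2 * Λ * t) * (2 * Λ * ‖inner ℂ (b l) (f t)‖ ^ 2 +
          2 * ((starRingEnd ℂ) (inner ℂ (b l) (f t)) * (-(lam l : ℂ) * inner ℂ (b l) (f t) -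
            Complex.I * κ * inner ℂ (b l) (B t (f t)))).re) := fun l =>
      exp_mul_norm_sq_sub_eq_integral Λ hT (hf.intervalIntegrable l T hT)
        fun t ht => hf.eq_integral l t ht.1
    have hint : ∀ l, IntervalIntegrable (fun t => exp (2 * Λ * t) *
        (2 * Λ * ‖inner ℂ (b l) (f t)‖ ^ 2 +
          2 * ((starRingEnd ℂ) (inner ℂ (b l) (f t)) * (-(lam l : ℂ) * inner ℂ (b l) (f t) -
            Complex.I * κ * inner ℂ (b l) (B t (f t)))).re)) volume 0 T := fun l => by
      have hcl := hf.continuous l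
      have hJ := (hf.intervalIntegrable l T hT).continuousOn_mul
        (g := fun t => (starRingEnd ℂ) (inner ℂ (b l) (f t)))
        (Complex.continuous_conj.comp hcl).continuousOn
      have hJ' : IntervalIntegrable (fun t => ((starRingEnd ℂ) (inner ℂ (b l) (f t)) *
        (-(lam l : ℂ) * inner ℂ (b l) (f t) -
            Complex.I * κ * inner ℂ (b l) (B t (f t)))).re) volume 0 T := ⟨hJ.1.re, hJ.2.re⟩
      refine IntervalIntegrable.continuousOn_mul (IntervalIntegrable.add ?_ (hJ'.const_mul 2))
        (Continuous.continuousOn (by fun_prop))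
      exact Continuous.intervalIntegrable (by fun_prop) _ _
    have hsum : exp (2 * Λ * T) * (∑ l ∈ F, σ l * ‖inner ℂ (b l) (f T)‖ ^ 2) -
        ∑ l ∈ F, σ l * ‖inner ℂ (b l) (f 0)‖ ^ 2 = ∑ l ∈ F, σ l *
          (exp (2 * Λ * T) * ‖inner ℂ (b l) (f T)‖ ^ 2 - ‖inner ℂ (b l) (f 0)‖ ^ 2) := by
      rw [Finset.mul_sum, ← Finset.sum_sub_distrib]
      exact Finset.sum_congr rfl fun l _ => by ring
    rw [hsum]
    simp_rw [hid, ← intervalIntegral.integral_const_mul]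
    rw [← intervalIntegral.integral_finsetSum fun l _ => (hint l).const_mul _,
      intervalIntegral.integral_of_le hT]
    refine integral_mono_ae
      (Integrable.of_bound (hmeas F) _ (hbound F))
      ?_ (Eventually.of_forall fun t => ?_)
    · rw [← IntegrableOn, ← intervalIntegrable_iff_integrableOn_Ioc_of_le hT]
      simpa only [Finset.sum_fn] using
        IntervalIntegrable.sum F fun l _ => (hint l).const_mul (σ l)
    · simp only [hΨ]
      rw [Complex.im_sum, Finset.mul_sum, Finset.mul_sum, ← Finset.sum_add_distrib, Finset.mul_sum,
        Finset.mul_sum]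
      refine Finset.sum_le_sum fun l _ => ?_
      rw [integrand_eq, hconj]
      have hn := sq_nonneg ‖inner ℂ (b l) (f t)‖
      -- On `S` the sign is `+1` and `λ ≤ Λ - η`; off `S` it is `-1` and `λ ≥ Λ + η`. In both cases
      -- `σ(Λ - λ) ≥ η`.
      have hcore : η * ‖inner ℂ (b l) (f t)‖ ^ 2 + κ * ((if l ∈ S then 1 else -1) *
          ((starRingEnd ℂ) (inner ℂ (b l) (f t)) * inner ℂ (b l) (B t (f t)))).im ≤
          σ l * ((Λ - lam l) * ‖inner ℂ (b l) (f t)‖ ^ 2 +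
            κ * ((starRingEnd ℂ) (inner ℂ (b l) (f t)) * inner ℂ (b l) (B t (f t))).im) := by
        by_cases hl : l ∈ S
        · simp only [hσ, hl, if_true, one_mul]
          have := mul_le_mul_of_nonneg_right (hlow l hl) hn
          linarith
        · simp only [hσ, hl, if_false, neg_one_mul, Complex.neg_im]
          have := mul_le_mul_of_nonneg_right (hhigh l hl) hn
          linarith
      have := mul_le_mul_of_nonneg_left hcore (exp_pos (2 * Λ * t)).le
      linarith
  have hfin := le_of_tendsto_of_tendsto' hI (((hW T).const_mul (exp (2 * Λ * T))).sub (hW 0)) hle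
  linarith

/-- The case `S = ∅`, `η = 0` of the signed energy bound: the signed energy is then `-‖f‖²`. -/
theorem norm_le_exp [Countable ι] (hf : IsEvolution b lam κ M B f) (hM : 0 ≤ M) {Λ : ℝ}
    (hΛ : ∀ l, Λ ≤ lam l) {t : ℝ} (ht : 0 ≤ t) : ‖f t‖ ≤ exp (-(Λ * t)) * ‖f 0‖ := by
  have h := hf.signed_energy_le hM ∅ le_rfl (by simp) (fun l _ => by simpa using hΛ l)
    (Or.inl rfl) ht
  simp only [Finset.sum_empty, mul_zero, zero_sub, mul_neg, neg_le_neg_iff] at h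
  have h2 : (exp (Λ * t) * ‖f t‖) ^ 2 ≤ ‖f 0‖ ^ 2 := by
    rw [mul_pow, ← Real.exp_nat_mul]
    convert h using 3
    push_cast; ring
  have h3 := le_of_sq_le_sq h2 (norm_nonneg _)
  rw [Real.exp_neg, inv_mul_eq_div, le_div_iff₀ (exp_pos _), mul_comm]
  exact h3

open Filter Topology in
/-- The linear lower bound for short times. -/
theorem sub_mul_le_norm [Countable ι] (hf : IsEvolution b lam κ M B f) (hM : 0 ≤ M)
    (hlam : ∀ l, 0 ≤ lam l) {A : ℝ} (hA : 0 ≤ A)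
    (hAs : HasSum (fun l => (lam l * ‖inner ℂ (b l) (f 0)‖) ^ 2) (A ^ 2)) (h0 : f 0 ≠ 0) {t : ℝ}
    (ht : 0 ≤ t) : ‖f 0‖ - (A + |κ| * M * ‖f 0‖) * t ≤ ‖f t‖ := by
  have hcontr : ∀ s, 0 ≤ s → ‖f s‖ ≤ ‖f 0‖ := fun s hs => by
    have := hf.norm_le_exp hM hlam hs
    simpa using this
  have hpos : 0 < ‖f 0‖ := norm_pos_iff.2 h0
  -- Pair the equation with `f 0`, so that `λ` falls on the coefficients of `f 0`, for which `A`
  -- controls it. Finite `F` lets sum and integral be exchanged.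
  have key : ∀ F : Finset ι, ‖∑ l ∈ F, inner ℂ (f 0) (b l) * inner ℂ (b l) (f t) -
      ∑ l ∈ F, inner ℂ (f 0) (b l) * inner ℂ (b l) (f 0)‖ ≤
        ((A + |κ| * M * ‖f 0‖) * ‖f 0‖) * |t - 0| := fun F => by
    rw [← Finset.sum_sub_distrib]
    have e : ∀ l ∈ F, inner ℂ (f 0) (b l) * inner ℂ (b l) (f t) -
        inner ℂ (f 0) (b l) * inner ℂ (b l) (f 0) = ∫ s in (0 : ℝ)..t, inner ℂ (f 0) (b l) *
          (-(lam l : ℂ) * inner ℂ (b l) (f s) -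
            Complex.I * κ * inner ℂ (b l) (B s (f s))) := fun l _ => by
      rw [hf.eq_integral l t ht, intervalIntegral.integral_const_mul]; ring
    rw [Finset.sum_congr rfl e, ← intervalIntegral.integral_finsetSum fun l _ =>
      (hf.intervalIntegrable l t ht).const_mul _]
    refine intervalIntegral.norm_integral_le_of_norm_le_const fun s hs => ?_
    rw [uIoc_of_le ht] at hs
    have hs' := hcontr s hs.1.le
    have e2 : ∑ l ∈ F, inner ℂ (f 0) (b l) * (-(lam l : ℂ) * inner ℂ (b l) (f s) -
          Complex.I * κ * inner ℂ (b l) (B s (f s))) =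
        -(∑ l ∈ F, inner ℂ (f 0) (b l) * lam l * inner ℂ (b l) (f s)) -
          Complex.I * κ *
            ∑ l ∈ F, 1 * (inner ℂ (f 0) (b l) * inner ℂ (b l) (B s (f s))) := by
      rw [Finset.mul_sum, ← Finset.sum_neg_distrib, ← Finset.sum_sub_distrib]
      exact Finset.sum_congr rfl fun l _ => by ring
    rw [e2]
    have n1 : ‖∑ l ∈ F, inner ℂ (f 0) (b l) * lam l * inner ℂ (b l) (f s)‖ ≤ A * ‖f 0‖ := by
      calc ‖∑ l ∈ F, inner ℂ (f 0) (b l) * lam l * inner ℂ (b l) (f s)‖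
          ≤ ∑ l ∈ F, (lam l * ‖inner ℂ (b l) (f 0)‖) * ‖inner ℂ (b l) (f s)‖ := by
            refine (norm_sum_le _ _).trans (Finset.sum_le_sum fun l _ => ?_)
            rw [norm_mul, norm_mul, norm_inner_symm (f 0), Complex.norm_real,
              Real.norm_of_nonneg (hlam l), mul_comm (lam l)]
        _ ≤ √(∑ l ∈ F, (lam l * ‖inner ℂ (b l) (f 0)‖) ^ 2) *
              √(∑ l ∈ F, ‖inner ℂ (b l) (f s)‖ ^ 2) := Real.sum_mul_le_sqrt_mul_sqrt _ _ _
        _ ≤ A * ‖f 0‖ := by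
            gcongr
            · exact Real.sqrt_le_iff.2 ⟨hA, sum_le_hasSum F (fun _ _ => sq_nonneg _) hAs⟩
            · exact (Real.sqrt_le_iff.2 ⟨norm_nonneg _, sum_norm_inner_sq_le b F (f s)⟩).trans hs'
    have n2 : ‖∑ l ∈ F, 1 * (inner ℂ (f 0) (b l) * inner ℂ (b l) (B s (f s)))‖ ≤
        ‖f 0‖ * (M * ‖f 0‖) :=
      (norm_sum_signed_le (w := fun _ => 1) (by simp) F).trans (by
        gcongr; exact (hf.norm_le s _).trans (by gcongr))
    calc _ ≤ _ := norm_sub_le _ _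
      _ ≤ A * ‖f 0‖ + |κ| * (‖f 0‖ * (M * ‖f 0‖)) := by
        rw [norm_neg]
        refine add_le_add n1 ?_
        rw [norm_mul, norm_mul, Complex.norm_I, one_mul, Complex.norm_real, Real.norm_eq_abs]
        gcongr
      _ = _ := by ring
  have hl := ((b.hasSum_inner_mul_inner (f 0) (f t)).sub
    (b.hasSum_inner_mul_inner (f 0) (f 0))).norm
  have hle := le_of_tendsto' (Tendsto.congr (fun F => by rw [Finset.sum_sub_distrib]) hl) key
  rw [sub_zero, abs_of_nonneg ht, inner_self_eq_norm_sq_to_K] at hle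
  have h1 : ‖f 0‖ ^ 2 - ‖f 0‖ * ‖f t‖ ≤ (A + |κ| * M * ‖f 0‖) * ‖f 0‖ * t := by
    refine le_trans ?_ hle
    have h2 := norm_sub_norm_le ((‖f 0‖ : ℂ) ^ 2) (inner ℂ (f 0) (f t))
    rw [norm_sub_rev] at h2
    have h3 : ‖((‖f 0‖ : ℂ)) ^ 2‖ = ‖f 0‖ ^ 2 := by simp
    rw [h3] at h2
    refine le_trans ?_ h2
    linarith [norm_inner_le_norm (𝕜 := ℂ) (f 0) (f t)]
  have h2 : ‖f 0‖ * (‖f 0‖ - (A + |κ| * M * ‖f 0‖) * t) ≤ ‖f 0‖ * ‖f t‖ := by nlinarith [h1]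
  exact le_of_mul_le_mul_left h2 hpos

end IsEvolution

end Evolution

/-! ### Modes of square integrable functions and multiplication operators -/

theorem norm_eq_norm2 (r : Lp ℂ 2 μ2) : ‖r‖ = norm2 (r : T2 → ℂ) := Lp.norm_def r

/-- The `k`-th `x`-mode of an element of `L²(𝕋²)` as an element of `L²(𝕋)`. -/
noncomputable def modeLp (k : ℤ) (r : Lp ℂ 2 μ2) : Lp ℂ 2 μ1 :=
  (memLp_xMode (Lp.memLp r) k).toLp _

theorem norm_modeLp (k : ℤ) (r : Lp ℂ 2 μ2) : ‖modeLp k r‖ = norm1 (xMode r k) :=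
  Lp.norm_toLp _ _

theorem coeFn_modeLp (k : ℤ) (r : Lp ℂ 2 μ2) : (modeLp k r : T1 → ℂ) =ᵐ[μ1] xMode r k :=
  MemLp.coeFn_toLp _

/-- The Fourier basis of `L²(𝕋)`. -/
noncomputable abbrev basis1 : HilbertBasis ℤ ℂ (Lp ℂ 2 μ1) := fourierBasis

theorem inner_basis1 (l : ℤ) (x : Lp ℂ 2 μ1) : inner ℂ (basis1 l) x = fourierCoeff x l := by
  rw [← HilbertBasis.repr_apply_apply, fourierBasis_repr]

theorem inner_basis1_modeLp (k l : ℤ) (r : Lp ℂ 2 μ2) :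
    inner ℂ (basis1 l) (modeLp k r) = coeff r k l := by
  rw [inner_basis1, fourierCoeff_congr_ae (coeFn_modeLp k r),
    coeff_eq_fourierCoeff ((Lp.memLp r).integrable one_le_two)]

open Classical in
/-- Multiplication by a real function on `L²(𝕋)`. -/
noncomputable def mulOp (v : T1 → ℝ) (x : Lp ℂ 2 μ1) : Lp ℂ 2 μ1 :=
  if h : MemLp (fun y => (v y : ℂ) * x y) 2 μ1 then h.toLp _ else 0

section MulOp

variable {v : T1 → ℝ} {M : ℝ}

theorem memLp_mul_bounded {α : Type*} [MeasurableSpace α] {μ : Measure α} {v : α → ℝ} {M : ℝ}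
    (hv : StronglyMeasurable v) (hM : ∀ y, |v y| ≤ M) {g : α → ℂ} (hg : MemLp g 2 μ) :
    MemLp (fun y => (v y : ℂ) * g y) 2 μ := by
  refine MemLp.of_le_mul (c := M) hg
    ((Complex.continuous_ofReal.comp_stronglyMeasurable hv).aestronglyMeasurable.mul
      hg.aestronglyMeasurable) (Filter.Eventually.of_forall fun y => ?_)
  rw [norm_mul, Complex.norm_real]
  exact mul_le_mul_of_nonneg_right (hM y) (norm_nonneg _)

theorem coeFn_mulOp (hv : StronglyMeasurable v) (hM : ∀ y, |v y| ≤ M) (x : Lp ℂ 2 μ1) :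
    (mulOp v x : T1 → ℂ) =ᵐ[μ1] fun y => (v y : ℂ) * x y := by
  rw [mulOp, dif_pos (memLp_mul_bounded hv hM (Lp.memLp x))]
  exact MemLp.coeFn_toLp _

theorem mulOp_add (hv : StronglyMeasurable v) (hM : ∀ y, |v y| ≤ M) (x y : Lp ℂ 2 μ1) :
    mulOp v (x + y) = mulOp v x + mulOp v y := by
  refine Lp.ext ?_
  filter_upwards [coeFn_mulOp hv hM (x + y), coeFn_mulOp hv hM x, coeFn_mulOp hv hM y,
    Lp.coeFn_add x y, Lp.coeFn_add (mulOp v x) (mulOp v y)] with z h1 h2 h3 h4 h5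
  rw [h1, h5, Pi.add_apply, h2, h3, h4, Pi.add_apply, mul_add]

theorem inner_mulOp (hv : StronglyMeasurable v) (hM : ∀ y, |v y| ≤ M) (x y : Lp ℂ 2 μ1) :
    inner ℂ (mulOp v x) y = inner ℂ x (mulOp v y) := by
  rw [L2.inner_def, L2.inner_def]
  refine integral_congr_ae ?_
  filter_upwards [coeFn_mulOp hv hM x, coeFn_mulOp hv hM y] with z h1 h2
  rw [h1, h2]
  simp only [RCLike.inner_apply, map_mul, Complex.conj_ofReal]
  ring

theorem norm_mulOp_le (hv : StronglyMeasurable v) (hM : ∀ y, |v y| ≤ M) (x : Lp ℂ 2 μ1) :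
    ‖mulOp v x‖ ≤ M * ‖x‖ := by
  refine Lp.norm_le_mul_norm_of_ae_le_mul ?_
  filter_upwards [coeFn_mulOp hv hM x] with z h1
  rw [h1, norm_mul, Complex.norm_real]
  exact mul_le_mul_of_nonneg_right (hM z) (norm_nonneg _)

theorem xMode_mul_snd (v : T1 → ℝ) (f : T2 → ℂ) (k : ℤ) :
    xMode (fun p => (v p.2 : ℂ) * f p) k = fun y => (v y : ℂ) * xMode f k y := by
  ext y
  simp only [xMode]
  rw [← integral_const_mul]
  congr 1; ext x; ring

theorem inner_basis1_mulOp_modeLp (hv : StronglyMeasurable v) (hM : ∀ y, |v y| ≤ M) (k l : ℤ)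
    (r : Lp ℂ 2 μ2) : inner ℂ (basis1 l) (mulOp v (modeLp k r)) =
      coeff (fun p => (v p.2 : ℂ) * r p) k l := by
  have hv2 : StronglyMeasurable (fun p : T2 => v p.2) := hv.comp_measurable measurable_snd
  have hint : MemLp (fun p : T2 => (v p.2 : ℂ) * r p) 2 μ2 :=
    memLp_mul_bounded hv2 (fun p => hM p.2) (Lp.memLp r)
  rw [coeff_eq_fourierCoeff (hint.integrable one_le_two), xMode_mul_snd, inner_basis1]
  refine congrFun (fourierCoeff_congr_ae ?_) l
  filter_upwards [coeFn_mulOp hv hM (modeLp k r), coeFn_modeLp k r] with y h1 h2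
  rw [h1, h2]

end MulOp

/-! ### The duality pairing on the torus -/

theorem integral_mul_eq_inner {g : T2 → ℂ} (hg : MemLp g 2 μ2) (r : Lp ℂ 2 μ2) :
    ∫ p, r p * g p ∂μ2 = inner ℂ (hg.star.toLp _) r := by
  rw [L2.inner_def]
  refine integral_congr_ae ?_
  filter_upwards [hg.star.coeFn_toLp] with p hp
  rw [hp]
  simp

theorem norm_integral_mul_le {g : T2 → ℂ} (hg : MemLp g 2 μ2) (r : Lp ℂ 2 μ2) :
    ‖∫ p, r p * g p ∂μ2‖ ≤ norm2 g * ‖r‖ := by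
  rw [integral_mul_eq_inner hg]
  refine (norm_inner_le_norm _ _).trans (le_of_eq ?_)
  rw [Lp.norm_toLp, norm2]
  congr 2
  exact eLpNorm_congr_norm_ae (Filter.Eventually.of_forall fun p => by simp)

theorem integrable_Lp_mul {g : T2 → ℂ} (hg : MemLp g 2 μ2) (r : Lp ℂ 2 μ2) :
    Integrable (fun p => r p * g p) μ2 :=
  MemLp.integrable_mul (p := 2) (q := 2) (Lp.memLp r) hg

/-- Separating the two occurrences of time gives a function continuous in one variable and
measurable in the other, hence jointly measurable; it is then restricted to the diagonal. No jointly
measurable version of `r` on space-time is needed. -/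
theorem stronglyMeasurable_pairing {r : ℝ → Lp ℂ 2 μ2} (hr : Continuous r) {G : ℝ → T2 → ℂ}
    (hG : StronglyMeasurable (Function.uncurry G)) (hG2 : ∀ t, MemLp (G t) 2 μ2) :
    StronglyMeasurable (fun t => ∫ p, r t p * G t p ∂μ2) := by
  have h : StronglyMeasurable
      (Function.uncurry fun (s : ℝ) (t : ℝ) => ∫ p, r s p * G t p ∂μ2) := by
    refine stronglyMeasurable_uncurry_of_continuous_of_stronglyMeasurable (fun t => ?_)
      (fun s => ?_)
    · simp_rw [integral_mul_eq_inner (hG2 t)]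
      exact continuous_const.inner hr
    · refine StronglyMeasurable.integral_prod_right
        (f := fun (t : ℝ) (p : T2) => r s p * G t p) ?_
      exact ((Lp.stronglyMeasurable (r s)).comp_measurable measurable_snd).mul hG
  exact h.comp_measurable (measurable_id.prodMk measurable_id)

/-! ### The weak formulation tested against functions on the torus -/

theorem supNorm_nonneg (U : ℝ → T1 → ℝ) : 0 ≤ supNorm U := ENNReal.toReal_nonneg

/-- Truncating a measurable representative at `±M` changes it only on a null set, and makes
multiplication by `V t` bounded by `M` for every `t`, not just almost every one. -/
theorem exists_bounded_representative {U : ℝ → T1 → ℝ} (hU : BoundedShear U) :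
    ∃ V : ℝ → T1 → ℝ, StronglyMeasurable (Function.uncurry V) ∧
      (∀ t y, |V t y| ≤ supNorm U) ∧ ∀ᵐ t ∂(volume.restrict (Ioi (0 : ℝ))), U t =ᵐ[μ1] V t := by
  have hM := supNorm_nonneg U
  set W := hU.aestronglyMeasurable.mk _ with hW
  have hWm : StronglyMeasurable W := hU.aestronglyMeasurable.stronglyMeasurable_mk
  refine ⟨fun t y => max (-supNorm U) (min (supNorm U) (W (t, y))), ?_, fun t y => ?_, ?_⟩
  · exact stronglyMeasurable_const.sup (stronglyMeasurable_const.inf hWm)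
  · rw [abs_le]
    exact ⟨le_max_left _ _, max_le (by linarith) (min_le_left _ _)⟩
  · have h1 : ∀ᵐ q ∂μtime, ‖U q.1 q.2‖ₑ ≤ eLpNormEssSup (fun q : ℝ × T1 => U q.1 q.2) μtime :=
      ae_le_eLpNormEssSup
    have h2 := hU.aestronglyMeasurable.ae_eq_mk
    have h3 : ∀ᵐ q ∂μtime, U q.1 q.2 = max (-supNorm U) (min (supNorm U) (W q)) := by
      filter_upwards [h1, h2] with q hq1 hq2
      have hq3 : |U q.1 q.2| ≤ supNorm U := by
        have := ENNReal.toReal_mono (by rw [← eLpNorm_exponent_top]; exact hU.2.ne) hq1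
        rw [supNorm, eLpNorm_exponent_top, ← Real.norm_eq_abs]
        simpa using this
      rw [← hW] at hq2
      rw [← hq2, min_eq_right (abs_le.1 hq3).2, max_eq_right (abs_le.1 hq3).1]
    exact Measure.ae_ae_of_ae_prod h3

theorem isTest_cutoff_mul {χ : ℝ → ℝ} (hχ : IsCutoff χ) {ψ : T2 → ℂ} (hψ : SmoothTorus ψ) :
    IsTest (fun t p => (χ t : ℂ) * ψ p) := by
  obtain ⟨h1, a, b, ha, hab, h⟩ := hχ
  refine ⟨?_, a, b, ha, hab, fun t ht p => by simp [h t ht]⟩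
  have h2 : ContDiff ℝ (⊤ : ℕ∞) (fun q : ℝ × ℝ × ℝ => (χ q.1 : ℂ)) :=
    Complex.ofRealCLM.contDiff.comp (h1.comp contDiff_fst)
  have h3 : ContDiff ℝ (⊤ : ℕ∞) (fun q : ℝ × ℝ × ℝ => ψ ((q.2.1 : T1), (q.2.2 : T1))) :=
    ContDiff.comp (g := fun p : ℝ × ℝ => ψ ((p.1 : T1), (p.2 : T1))) hψ contDiff_snd
  exact h2.mul h3

section Weak

variable {U V : ℝ → T1 → ℝ} {M ν : ℝ} {ρ₀ : T2 → ℂ} {ρ : ℝ → Lp ℂ 2 μ2}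

/-- Freezing the solution at `ρ 0` for negative times gives functions continuous on the whole line,
as the statements about weak derivatives require. -/
theorem continuous_extension (hρ : IsSolution U ν ρ₀ ρ) : Continuous fun t => ρ (max t 0) :=
  hρ.continuousOn.comp_continuous (by fun_prop) fun t => le_max_right t 0

theorem stronglyMeasurable_slice (hV : StronglyMeasurable (Function.uncurry V)) (t : ℝ) :
    StronglyMeasurable (V t) := hV.comp_measurable measurable_prodMk_left

theorem memLp_shear_mul (hV : StronglyMeasurable (Function.uncurry V))
    (hM : ∀ t y, |V t y| ≤ M) (t : ℝ) {g : T2 → ℂ} (hg : MemLp g 2 μ2) :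
    MemLp (fun p => (V t p.2 : ℂ) * g p) 2 μ2 :=
  memLp_mul_bounded (v := fun p : T2 => V t p.2)
    ((stronglyMeasurable_slice hV t).comp_measurable measurable_snd) (fun p => hM t p.2) hg

theorem memLp_generator (hV : StronglyMeasurable (Function.uncurry V))
    (hM : ∀ t y, |V t y| ≤ M) (ν : ℝ) {ψ : T2 → ℂ} (hψ : SmoothTorus ψ) (t : ℝ) :
    MemLp (fun p => (V t p.2 : ℂ) * dx ψ p + (ν : ℂ) * lap ψ p) 2 μ2 :=
  (memLp_shear_mul hV hM t hψ.dx.memLp).add (hψ.lap.memLp.const_mul _)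

theorem norm2_generator_le (hV : StronglyMeasurable (Function.uncurry V))
    (hM0 : 0 ≤ M) (hM : ∀ t y, |V t y| ≤ M) (hν : 0 ≤ ν) {ψ : T2 → ℂ} (hψ : SmoothTorus ψ) (t : ℝ) :
    norm2 (fun p => (V t p.2 : ℂ) * dx ψ p + (ν : ℂ) * lap ψ p) ≤
      M * norm2 (dx ψ) + ν * norm2 (lap ψ) := by
  have m1 := memLp_shear_mul hV hM t (hψ.dx.memLp (p := 2))
  have m2 : MemLp (fun p => (ν : ℂ) * lap ψ p) 2 μ2 := hψ.lap.memLp.const_mul _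
  have h1 : eLpNorm (fun p => (V t p.2 : ℂ) * dx ψ p) 2 μ2 ≤
      ENNReal.ofReal M * eLpNorm (dx ψ) 2 μ2 := by
    refine eLpNorm_le_mul_eLpNorm_of_ae_le_mul (Filter.Eventually.of_forall fun p => ?_) 2
    rw [norm_mul, Complex.norm_real]
    exact mul_le_mul_of_nonneg_right (hM t p.2) (norm_nonneg _)
  have h2 : eLpNorm (fun p => (ν : ℂ) * lap ψ p) 2 μ2 ≤
      ENNReal.ofReal ν * eLpNorm (lap ψ) 2 μ2 := by
    refine eLpNorm_le_mul_eLpNorm_of_ae_le_mul (Filter.Eventually.of_forall fun p => ?_) 2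
    rw [norm_mul, Complex.norm_real, Real.norm_of_nonneg hν]
  have f1 := (hψ.dx.memLp (p := 2)).2.ne
  have f2 := (hψ.lap.memLp (p := 2)).2.ne
  have h := (eLpNorm_add_le m1.1 m2.1 one_le_two).trans (add_le_add h1 h2)
  have h' := ENNReal.toReal_mono (by finiteness) h
  rw [ENNReal.toReal_add (by finiteness) (by finiteness), ENNReal.toReal_mul, ENNReal.toReal_mul,
    ENNReal.toReal_ofReal hM0, ENNReal.toReal_ofReal hν] at h'
  exact h'

theorem stronglyMeasurable_generator (hV : StronglyMeasurable (Function.uncurry V)) (ν : ℝ)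
    {ψ : T2 → ℂ} (hψ : SmoothTorus ψ) : StronglyMeasurable (Function.uncurry
      fun (t : ℝ) (p : T2) => (V t p.2 : ℂ) * dx ψ p + (ν : ℂ) * lap ψ p) := by
  have h1 : StronglyMeasurable (fun q : ℝ × T2 => V q.1 q.2.2) :=
    hV.comp_measurable (measurable_fst.prodMk (measurable_snd.comp measurable_snd))
  have h2 : StronglyMeasurable (fun q : ℝ × T2 => dx ψ q.2) :=
    (hψ.dx.continuous.comp continuous_snd).stronglyMeasurable
  have h3 : StronglyMeasurable (fun q : ℝ × T2 => lap ψ q.2) :=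
    (hψ.lap.continuous.comp continuous_snd).stronglyMeasurable
  exact ((Complex.continuous_ofReal.comp_stronglyMeasurable h1).mul h2).add (h3.const_mul _)

theorem exists_norm_extension_le (hρ : IsSolution U ν ρ₀ ρ) (T : ℝ) :
    ∃ C : ℝ, ∀ t, t ≤ T → ‖ρ (max t 0)‖ ≤ C := by
  obtain ⟨C, hC⟩ := (isCompact_Icc (a := (0 : ℝ)) (b := max T 0)).exists_bound_of_continuousOn
    (hρ.continuousOn.mono Icc_subset_Ici_self)
  exact ⟨C, fun t ht => hC _ ⟨le_max_right _ _, max_le_max_right 0 ht⟩⟩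

/-- Testing with products `χ(t) ψ(x, y)` says that the scalar function `∫ ρ ψ` has the inner
integral on the right as its weak derivative in time. -/
theorem integral_mul_eq_add_integral (hρ : IsSolution U ν ρ₀ ρ)
    (hV : StronglyMeasurable (Function.uncurry V)) (hM0 : 0 ≤ M) (hM : ∀ t y, |V t y| ≤ M)
    (hUV : ∀ᵐ t ∂(volume.restrict (Ioi (0 : ℝ))), U t =ᵐ[μ1] V t) (hν : 0 ≤ ν)
    {ψ : T2 → ℂ} (hψ : SmoothTorus ψ) {t : ℝ} (ht : 0 ≤ t) :
    ∫ p, ρ (max t 0) p * ψ p ∂μ2 = ∫ p, ρ (max 0 0) p * ψ p ∂μ2 +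
      ∫ s in (0 : ℝ)..t, ∫ p, ρ (max s 0) p *
        ((V s p.2 : ℂ) * dx ψ p + (ν : ℂ) * lap ψ p) ∂μ2 := by
  have hcont := continuous_extension hρ
  refine eq_add_integral_of_weak_deriv (c := fun t => ∫ p, ρ (max t 0) p * ψ p ∂μ2) ?_ ?_ ?_ ht
  · simp_rw [integral_mul_eq_inner hψ.memLp]
    exact continuous_const.inner hcont
  · intro T hT
    obtain ⟨C, hC⟩ := exists_norm_extension_le hρ T
    refine Measure.integrableOn_of_bounded (M := (M * norm2 (dx ψ) + ν * norm2 (lap ψ)) * C)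
      (by simp) (stronglyMeasurable_pairing hcont (stronglyMeasurable_generator hV ν hψ)
        (memLp_generator hV hM ν hψ)).aestronglyMeasurable ?_
    refine (ae_restrict_iff' measurableSet_Ioc).2 (Filter.Eventually.of_forall fun s hs => ?_)
    refine (norm_integral_mul_le (memLp_generator hV hM ν hψ s) _).trans ?_
    have h1 := norm2_generator_le hV hM0 hM hν hψ s
    exact mul_le_mul h1 (hC s hs.2) (norm_nonneg _) ((norm2_nonneg _).trans h1)
  · intro χ hχ
    rw [← hρ.weak _ (isTest_cutoff_mul hχ hψ)]
    refine integral_congr_ae ?_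
    filter_upwards [hUV, ae_restrict_mem measurableSet_Ioi] with s hs hs0
    have hs0' : max s 0 = s := max_eq_left (le_of_lt hs0)
    rw [hs0']
    have hae : ∀ᵐ p ∂μ2, U s p.2 = V s p.2 :=
      Measure.quasiMeasurePreserving_snd.ae hs
    have hd : ∀ p, deriv (fun r => (χ r : ℂ) * ψ p) s = ((deriv χ s : ℝ) : ℂ) * ψ p := fun p =>
      (((hχ.1.differentiable (by simp) s).hasDerivAt.ofReal_comp).mul_const (ψ p)).deriv
    have e : ∫ p, ρ s p * (deriv (fun r => (χ r : ℂ) * ψ p) s +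
        (U s p.2 : ℂ) * dx (fun p => (χ s : ℂ) * ψ p) p +
        (ν : ℂ) * lap (fun p => (χ s : ℂ) * ψ p) p) ∂μ2 =
        ∫ p, (((deriv χ s : ℝ) : ℂ) * (ρ s p * ψ p) +
          (χ s : ℂ) * (ρ s p * ((V s p.2 : ℂ) * dx ψ p + (ν : ℂ) * lap ψ p))) ∂μ2 := by
      refine integral_congr_ae ?_
      filter_upwards [hae] with p hp
      rw [hd, hp, dx_const_mul, lap_const_mul]
      ring
    rw [e, integral_add ((integrable_Lp_mul hψ.memLp _).const_mul _)
      ((integrable_Lp_mul (memLp_generator hV hM ν hψ s) _).const_mul _), integral_const_mul,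
      integral_const_mul]

theorem coeff_eq_integral_mul (r : T2 → ℂ) (k l : ℤ) :
    coeff r k l = ∫ p, r p * (fourier (-k) p.1 * fourier (-l) p.2) ∂μ2 := by
  rw [coeff]; congr 1; ext p; ring

/-- The `x`-modes of a solution. -/
theorem isEvolution_mode (hρ : IsSolution U ν ρ₀ ρ)
    (hV : StronglyMeasurable (Function.uncurry V)) (hM0 : 0 ≤ M) (hM : ∀ t y, |V t y| ≤ M)
    (hUV : ∀ᵐ t ∂(volume.restrict (Ioi (0 : ℝ))), U t =ᵐ[μ1] V t) (hν : 0 ≤ ν) (k : ℤ) :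
    IsEvolution basis1 (fun l => ν * ((k : ℝ) ^ 2 + (l : ℝ) ^ 2)) k M (fun t => mulOp (V t))
      (fun t => modeLp k (ρ (max t 0))) := by
  have hcont := continuous_extension hρ
  have hsl := stronglyMeasurable_slice hV
  refine ⟨fun t => mulOp_add (hsl t) (hM t), fun t => inner_mulOp (hsl t) (hM t),
    fun t => norm_mulOp_le (hsl t) (hM t), fun T => ?_, fun l => ?_, fun l => ?_,
    fun l t ht => ?_⟩
  · obtain ⟨C, hC⟩ := exists_norm_extension_le hρ T
    refine ⟨C, fun t ht => le_trans ?_ (hC t ht)⟩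
    rw [norm_modeLp, norm_eq_norm2]
    exact norm1_xMode_le (Lp.memLp _) k
  · simp_rw [inner_basis1_modeLp, coeff_eq_integral_mul,
      integral_mul_eq_inner (smoothTorus_fourier (-k) (-l)).memLp]
    exact continuous_const.inner hcont
  · simp_rw [fun t => inner_basis1_mulOp_modeLp (hsl t) (hM t) k l]
    have hG : StronglyMeasurable (Function.uncurry fun (t : ℝ) (p : T2) =>
        (V t p.2 : ℂ) * (fourier (-k) p.1 * fourier (-l) p.2)) := by
      have h1 : StronglyMeasurable (fun q : ℝ × T2 => V q.1 q.2.2) :=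
        hV.comp_measurable (measurable_fst.prodMk (measurable_snd.comp measurable_snd))
      have h2 : StronglyMeasurable (fun q : ℝ × T2 => fourier (-k) q.2.1 * fourier (-l) q.2.2) :=
        ((smoothTorus_fourier (-k) (-l)).continuous.comp continuous_snd).stronglyMeasurable
      exact (Complex.continuous_ofReal.comp_stronglyMeasurable h1).mul h2
    have h := stronglyMeasurable_pairing hcont hG fun t =>
      memLp_shear_mul hV hM t (smoothTorus_fourier (-k) (-l)).memLp
    refine h.aestronglyMeasurable.congr (Filter.Eventually.of_forall fun t => ?_)
    simp only [coeff]
    congr 1; ext p; ring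
  -- On the test function `e^{-ikx-ily}`, `∂ₓ` acts as `-ik` and `Δ` as `-(k² + l²)`; hence `κ = k`
  -- and the eigenvalues `ν(k² + l²)`.
  · have hψ := smoothTorus_fourier (-k) (-l)
    have h := integral_mul_eq_add_integral hρ hV hM0 hM hUV hν hψ ht
    rw [← coeff_eq_integral_mul, ← coeff_eq_integral_mul] at h
    rw [inner_basis1_modeLp, inner_basis1_modeLp, h]
    congr 1
    refine intervalIntegral.integral_congr fun s _ => ?_
    rw [inner_basis1_mulOp_modeLp (hsl s) (hM s), inner_basis1_modeLp, coeff_eq_integral_mul,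
      coeff_eq_integral_mul]
    have i1 := integrable_Lp_mul hψ.memLp (ρ (max s 0))
    have i2 : Integrable (fun p => (V s p.2 : ℂ) * ρ (max s 0) p *
        (fourier (-k) p.1 * fourier (-l) p.2)) μ2 := by
      refine (integrable_Lp_mul (memLp_shear_mul hV hM s hψ.memLp) (ρ (max s 0))).congr
        (Filter.Eventually.of_forall fun p => ?_)
      ring
    rw [← integral_const_mul, ← integral_const_mul, ← integral_sub (i1.const_mul _)
      (i2.const_mul _)]
    congr 1; ext p
    rw [dx_fourier, lap_fourier]
    push_cast
    ring

theorem norm_mode_le (hρ : IsSolution U ν ρ₀ ρ)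
    (hV : StronglyMeasurable (Function.uncurry V)) (hM0 : 0 ≤ M) (hM : ∀ t y, |V t y| ≤ M)
    (hUV : ∀ᵐ t ∂(volume.restrict (Ioi (0 : ℝ))), U t =ᵐ[μ1] V t) (hν : 0 ≤ ν) (k : ℤ)
    {t : ℝ} (ht : 0 ≤ t) :
    norm1 (xMode (ρ t) k) ≤ exp (-(ν * k ^ 2 * t)) * norm1 (xMode (ρ 0) k) := by
  have h := (isEvolution_mode hρ hV hM0 hM hUV hν k).norm_le_exp hM0 (Λ := ν * k ^ 2)
    (fun l => mul_le_mul_of_nonneg_left (by nlinarith [sq_nonneg (l : ℝ)]) hν) ht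
  rwa [norm_modeLp, norm_modeLp, max_eq_left ht, max_self] at h

theorem norm_solution_le (hρ : IsSolution U ν ρ₀ ρ)
    (hV : StronglyMeasurable (Function.uncurry V)) (hM0 : 0 ≤ M) (hM : ∀ t y, |V t y| ≤ M)
    (hUV : ∀ᵐ t ∂(volume.restrict (Ioi (0 : ℝ))), U t =ᵐ[μ1] V t) (hν : 0 ≤ ν)
    {t : ℝ} (ht : 0 ≤ t) : ‖ρ t‖ ≤ ‖ρ 0‖ := by
  rw [norm_eq_norm2, norm_eq_norm2]
  refine le_of_sq_le_sq ?_ (norm2_nonneg _)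
  refine hasSum_le (fun k => ?_) (hasSum_norm1_xMode_sq (Lp.memLp (ρ t)))
    (hasSum_norm1_xMode_sq (Lp.memLp (ρ 0)))
  refine pow_le_pow_left₀ (norm1_nonneg _)
    ((norm_mode_le hρ hV hM0 hM hUV hν k ht).trans ?_) 2
  refine mul_le_of_le_one_left (norm1_nonneg _) (exp_le_one_iff.2 ?_)
  have : 0 ≤ ν * (k : ℝ) ^ 2 * t := by positivity
  linarith

theorem norm2_star (f : T2 → ℂ) : norm2 (fun p => (starRingEnd ℂ) (f p)) = norm2 f := by
  rw [norm2, norm2]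
  congr 1
  exact eLpNorm_congr_norm_ae (Filter.Eventually.of_forall fun p => by simp)

/-- The linear lower bound for the norm of a solution for short times. -/
theorem sub_mul_le_norm_solution (hρ : IsSolution U ν ρ₀ ρ) (hρ₀ : SmoothTorus ρ₀)
    (hV : StronglyMeasurable (Function.uncurry V)) (hM0 : 0 ≤ M) (hM : ∀ t y, |V t y| ≤ M)
    (hUV : ∀ᵐ t ∂(volume.restrict (Ioi (0 : ℝ))), U t =ᵐ[μ1] V t) (hν : 0 ≤ ν)
    (hpos : 0 < norm2 ρ₀) {t : ℝ} (ht : 0 ≤ t) :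
    norm2 ρ₀ - (ν * norm2 (lap ρ₀) + M * norm2 (dx ρ₀)) * t ≤ ‖ρ t‖ := by
  -- The conjugate datum as test function: the pairing at time `0` is `‖ρ₀‖²`, and all derivatives
  -- fall on the smooth datum.
  have hψ := hρ₀.conj
  have h := integral_mul_eq_add_integral hρ hV hM0 hM hUV hν hψ ht
  have hN : ‖ρ 0‖ = norm2 ρ₀ := by
    rw [norm_eq_norm2, norm2, norm2, eLpNorm_congr_ae hρ.initial]
  have h0 : ∫ p, ρ (max 0 0) p * (starRingEnd ℂ) (ρ₀ p) ∂μ2 = ((norm2 ρ₀ ^ 2 : ℝ) : ℂ) := by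
    rw [max_self, ← hN]
    have h1 := L2.inner_def (𝕜 := ℂ) (ρ 0) (ρ 0)
    rw [inner_self_eq_norm_sq_to_K] at h1
    push_cast
    refine Eq.trans (integral_congr_ae ?_) h1.symm
    filter_upwards [hρ.initial] with p hp
    rw [← hp]; exact (RCLike.inner_apply _ _).symm
  rw [h0, max_eq_left ht] at h
  set K := M * norm2 (dx ρ₀) + ν * norm2 (lap ρ₀) with hK
  have hb : ‖∫ s in (0 : ℝ)..t, ∫ p, ρ (max s 0) p *
      ((V s p.2 : ℂ) * dx (fun p => (starRingEnd ℂ) (ρ₀ p)) p +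
        (ν : ℂ) * lap (fun p => (starRingEnd ℂ) (ρ₀ p)) p) ∂μ2‖ ≤ K * norm2 ρ₀ * |t - 0| := by
    refine intervalIntegral.norm_integral_le_of_norm_le_const fun s _ => ?_
    refine (norm_integral_mul_le (memLp_generator hV hM ν hψ s) _).trans ?_
    have h1 := norm2_generator_le hV hM0 hM hν hψ s
    rw [dx_conj, lap_conj, norm2_star, norm2_star] at h1
    have h2 := norm_solution_le hρ hV hM0 hM hUV hν (le_max_right s 0)
    rw [hN] at h2
    rw [dx_conj, lap_conj]
    exact mul_le_mul h1 h2 (norm_nonneg _) ((norm2_nonneg _).trans h1)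
  rw [sub_zero, abs_of_nonneg ht] at hb
  have hc := norm_integral_mul_le hψ.memLp (ρ t)
  rw [norm2_star, h] at hc
  have h3 := norm_sub_le_norm_add (((norm2 ρ₀ ^ 2 : ℝ) : ℂ)) (∫ s in (0 : ℝ)..t,
    ∫ p, ρ (max s 0) p * ((V s p.2 : ℂ) * dx (fun p => (starRingEnd ℂ) (ρ₀ p)) p +
        (ν : ℂ) * lap (fun p => (starRingEnd ℂ) (ρ₀ p)) p) ∂μ2)
  rw [Complex.norm_real, Real.norm_of_nonneg (sq_nonneg _)] at h3
  refine le_of_mul_le_mul_left ?_ hpos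
  nlinarith [h3, hc, hb]

end Weak

/-! ### Tails of convergent series over the integers -/

theorem hasSum_tail {u : ℤ → ℝ} {A : ℝ} (hu : HasSum u A) (J : ℕ) :
    HasSum (fun l : ℤ => if (J : ℤ) < |l| then u l else 0)
      (A - ∑ l ∈ Finset.Icc (-(J : ℤ)) J, u l) := by
  have h1 : HasSum (fun l => if l ∈ Finset.Icc (-(J : ℤ)) J then u l else 0)
      (∑ l ∈ Finset.Icc (-(J : ℤ)) J, u l) := by
    have : HasSum (fun l => if l ∈ Finset.Icc (-(J : ℤ)) J then u l else 0)
        (∑ l ∈ Finset.Icc (-(J : ℤ)) J, if l ∈ Finset.Icc (-(J : ℤ)) J then u l else 0) :=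
      hasSum_sum_of_ne_finset_zero (fun l hl => by simp only [hl, if_false])
    rwa [Finset.sum_congr rfl fun l hl => if_pos hl] at this
  have e : (fun l : ℤ => if (J : ℤ) < |l| then u l else 0) =
      fun l => u l - if l ∈ Finset.Icc (-(J : ℤ)) J then u l else 0 := by
    ext l
    have : l ∈ Finset.Icc (-(J : ℤ)) J ↔ ¬ (J : ℤ) < |l| := by
      rw [Finset.mem_Icc, ← abs_le, not_lt]
    by_cases h : (J : ℤ) < |l|
    · rw [if_pos h, if_neg (fun hl => this.1 hl h), sub_zero]
    · rw [if_neg h, if_pos (this.2 h), sub_self]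
  rw [e]
  exact hu.sub h1

theorem exists_tail_le {u : ℤ → ℝ} {A : ℝ} (hu : HasSum u A) (hu0 : ∀ l, 0 ≤ u l) (hA : 0 < A) :
    ∃ J : ℕ, 1 ≤ J ∧ (∑' l : ℤ, if (J : ℤ) < |l| then u l else 0) ≤ A / 2 := by
  have hev : ∀ᶠ s : Finset ℤ in Filter.atTop, A / 2 < ∑ l ∈ s, u l :=
    hu.eventually (lt_mem_nhds (by linarith))
  obtain ⟨s, hs⟩ := hev.exists
  refine ⟨s.sup Int.natAbs + 1, by omega, ?_⟩
  rw [(hasSum_tail hu _).tsum_eq]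
  have hsub : s ⊆ Finset.Icc (-((s.sup Int.natAbs + 1 : ℕ) : ℤ)) (s.sup Int.natAbs + 1 : ℕ) :=
    fun l hl => by
      have := Finset.le_sup (f := Int.natAbs) hl
      rw [Finset.mem_Icc]
      omega
  have := Finset.sum_le_sum_of_subset_of_nonneg hsub fun l _ _ => hu0 l
  linarith

/-! ### The datum -/

theorem hasSum_modeNorm_sq {f : T2 → ℂ} (hf : MemLp f 2 μ2) :
    HasSum (fun k : ℤ => modeNorm f k ^ 2) (norm2 f ^ 2) := hasSum_norm1_xMode_sq hf

theorem modeNorm_nonneg (f : T2 → ℂ) (k : ℤ) : 0 ≤ modeNorm f k := norm1_nonneg _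

theorem modeA_nonneg (f : T2 → ℂ) (k : ℤ) : 0 ≤ modeA f k := norm1_nonneg _

section Datum

variable {U : ℝ → T1 → ℝ} {ν : ℝ} {ρ₀ : T2 → ℂ}

theorem modeNorm_le (hs : SmoothTorus ρ₀) (k : ℤ) : modeNorm ρ₀ k ≤ norm2 ρ₀ :=
  norm1_xMode_le hs.memLp k

theorem coeff_zero_zero (f : T2 → ℂ) : coeff f 0 0 = ∫ p, f p ∂μ2 := by simp [coeff]

theorem norm2_pos (hs : SmoothTorus ρ₀) (hne : ρ₀ ≠ 0) : 0 < norm2 ρ₀ := by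
  refine lt_of_le_of_ne (norm2_nonneg _) fun h => hne ?_
  have h0 : eLpNorm ρ₀ 2 μ2 = 0 :=
    ((ENNReal.toReal_eq_zero_iff _).1 h.symm).resolve_right (hs.memLp (p := 2)).2.ne
  rw [eLpNorm_eq_zero_iff hs.continuous.aestronglyMeasurable two_ne_zero] at h0
  exact (hs.continuous.ae_eq_iff_eq μ2 continuous_zero).1 h0

theorem exists_coeff_ne_zero (hs : SmoothTorus ρ₀) (hmean : ∫ p, ρ₀ p ∂μ2 = 0) (hne : ρ₀ ≠ 0) :
    ∃ k l : ℤ, (k ≠ 0 ∨ l ≠ 0) ∧ coeff ρ₀ k l ≠ 0 := by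
  by_contra! h
  have hz : ∀ q : ℤ × ℤ, ‖coeff ρ₀ q.1 q.2‖ ^ 2 = 0 := fun q => by
    by_cases hq : q.1 ≠ 0 ∨ q.2 ≠ 0
    · rw [h _ _ hq]; simp
    · push Not at hq
      rw [hq.1, hq.2, coeff_zero_zero, hmean]; simp
  have h1 := hasSum_coeff_sq_prod (hs.memLp (p := 2))
  simp_rw [hz] at h1
  have h2 := h1.unique hasSum_zero
  have := norm2_pos hs hne
  nlinarith

theorem norm2_lap_pos (hs : SmoothTorus ρ₀) (hmean : ∫ p, ρ₀ p ∂μ2 = 0) (hne : ρ₀ ≠ 0) :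
    0 < norm2 (lap ρ₀) := by
  obtain ⟨k, l, hkl, hc⟩ := exists_coeff_ne_zero hs hmean hne
  have h1 : 0 < ‖coeff (lap ρ₀) k l‖ := by
    rw [norm_pos_iff, coeff_lap hs]
    refine mul_ne_zero (neg_ne_zero.2 ?_) hc
    have : k ^ 2 + l ^ 2 ≠ 0 := by
      rcases hkl with h | h
      · have := pow_pos (abs_pos.2 h) 2; rw [sq_abs] at this; positivity
      · have := pow_pos (abs_pos.2 h) 2; rw [sq_abs] at this; positivity
    exact_mod_cast this
  exact h1.trans_le ((norm_coeff_le hs.lap.memLp k l).trans (norm1_xMode_le hs.lap.memLp k))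

theorem beta0_pos (hs : SmoothTorus ρ₀) (hmean : ∫ p, ρ₀ p ∂μ2 = 0) (hne : ρ₀ ≠ 0)
    (hν : 0 < ν) : 0 < beta0 U ν ρ₀ := by
  have h1 := norm2_lap_pos hs hmean hne
  have h2 := norm2_pos hs hne
  have h3 := supNorm_nonneg U
  have h4 := norm2_nonneg (dx ρ₀)
  rw [beta0]; positivity

/-- For `k ≠ 0` the weights `k² + l²` are at least `1`. This keeps `β_k` positive even when `M = 0`.
-/
theorem modeNorm_le_modeA (hs : SmoothTorus ρ₀) {k : ℤ} (hk : k ≠ 0) :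
    modeNorm ρ₀ k ≤ modeA ρ₀ k := by
  refine le_of_sq_le_sq ?_ (norm1_nonneg _)
  refine hasSum_le (fun l => ?_) (hasSum_coeff_sq hs.memLp k) (hasSum_modeA_sq hs k)
  refine pow_le_pow_left₀ (norm_nonneg _) (le_mul_of_one_le_left (norm_nonneg _) ?_) 2
  have h1 : (1 : ℝ) ≤ (k : ℝ) ^ 2 := by
    have : 1 ≤ k ^ 2 := Int.one_le_abs hk |> fun h => by rw [← sq_abs]; nlinarith
    exact_mod_cast this
  nlinarith [sq_nonneg (l : ℝ)]

theorem beta_pos (hs : SmoothTorus ρ₀) (hν : 0 < ν) {k : ℤ} (hk : k ≠ 0)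
    (ha : 0 < modeNorm ρ₀ k) : 0 < beta U ν ρ₀ k := by
  have h1 : 0 < modeA ρ₀ k := ha.trans_le (modeNorm_le_modeA hs hk)
  have h3 := supNorm_nonneg U
  rw [beta]; positivity

theorem beta_mul_modeNorm {k : ℤ} (ha : 0 < modeNorm ρ₀ k) : beta U ν ρ₀ k * modeNorm ρ₀ k =
    2 * (ν * modeA ρ₀ k + |(k : ℝ)| * supNorm U * modeNorm ρ₀ k) := by
  rw [beta, div_mul_cancel₀ _ ha.ne']

/-! ### The cutoff `m_k` -/

/-- Both conditions become linear in `m`: `4·10⁴ = 200²` after taking a square root, and `16·10⁴ =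
160000`. -/
theorem mem_mIdx_set_iff (hν : 0 < ν) {k : ℤ} (hβ : 0 < beta U ν ρ₀ k) (m : ℕ) :
    (1 ≤ m ∧ 10 ^ 4 * ((k : ℝ) ^ 2 * supNorm U ^ 2 / (ν ^ 2 * (m : ℝ) ^ 2)) ≤ 1 / 4 ∧
      10 ^ 4 * (1 / (ν * (m : ℝ))) ≤ delta U ν ρ₀ k / 16) ↔
    1 ≤ m ∧ 200 * (|(k : ℝ)| * supNorm U) ≤ ν * m ∧ 160000 * beta U ν ρ₀ k ≤ ν * m := by
  refine and_congr_right fun hm => and_congr ?_ ?_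
  · have hm' : (0 : ℝ) < m := by exact_mod_cast hm
    have hkM : 0 ≤ |(k : ℝ)| * supNorm U := mul_nonneg (abs_nonneg _) (supNorm_nonneg U)
    rw [← mul_div_assoc, div_le_iff₀ (by positivity),
      ← pow_le_pow_iff_left₀ (by positivity : 0 ≤ 200 * (|(k : ℝ)| * supNorm U))
        (by positivity : 0 ≤ ν * m) two_ne_zero]
    have e : (200 * (|(k : ℝ)| * supNorm U)) ^ 2 = 40000 * ((k : ℝ) ^ 2 * supNorm U ^ 2) := by
      rw [mul_pow, mul_pow, sq_abs]; norm_num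
    rw [e, mul_pow]
    constructor <;> intro h <;> linarith
  · have hm' : (0 : ℝ) < m := by exact_mod_cast hm
    rw [delta, mul_one_div, inv_eq_one_div, div_div, div_le_div_iff₀ (by positivity) (by positivity)]
    constructor <;> intro h <;> linarith

theorem exists_mIdx_bound (hν : 0 < ν) {k : ℤ} (hβ : 0 < beta U ν ρ₀ k) :
    ∃ m : ℕ, (m : ℝ) ≤ 1 + (200 * (|(k : ℝ)| * supNorm U) + 160000 * beta U ν ρ₀ k) / ν ∧
      1 ≤ m ∧ 200 * (|(k : ℝ)| * supNorm U) ≤ ν * m ∧ 160000 * beta U ν ρ₀ k ≤ ν * m := by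
  have hkM : 0 ≤ |(k : ℝ)| * supNorm U := mul_nonneg (abs_nonneg _) (supNorm_nonneg U)
  set x := (200 * (|(k : ℝ)| * supNorm U) + 160000 * beta U ν ρ₀ k) / ν with hx
  have hx0 : 0 < x := by positivity
  have h1 := Nat.le_ceil x
  have h2 : ν * x = 200 * (|(k : ℝ)| * supNorm U) + 160000 * beta U ν ρ₀ k := by
    rw [hx]; field_simp
  have h3 : ν * x ≤ ν * ⌈x⌉₊ := by gcongr
  refine ⟨⌈x⌉₊, ?_, Nat.one_le_ceil_iff.2 hx0, by linarith, by linarith⟩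
  have := Nat.ceil_lt_add_one hx0.le
  linarith

theorem mIdx_spec (hν : 0 < ν) {k : ℤ} (hβ : 0 < beta U ν ρ₀ k) :
    1 ≤ mIdx U ν ρ₀ k ∧ 200 * (|(k : ℝ)| * supNorm U) ≤ ν * mIdx U ν ρ₀ k ∧
      160000 * beta U ν ρ₀ k ≤ ν * mIdx U ν ρ₀ k := by
  rw [← mem_mIdx_set_iff hν hβ]
  obtain ⟨m, -, hm⟩ := exists_mIdx_bound hν hβ
  exact Nat.sInf_mem (s := {m : ℕ | 1 ≤ m ∧
    10 ^ 4 * ((k : ℝ) ^ 2 * supNorm U ^ 2 / (ν ^ 2 * (m : ℝ) ^ 2)) ≤ 1 / 4 ∧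
    10 ^ 4 * (1 / (ν * (m : ℝ))) ≤ delta U ν ρ₀ k / 16}) ⟨m, (mem_mIdx_set_iff hν hβ m).2 hm⟩

theorem mIdx_le (hν : 0 < ν) {k : ℤ} (hβ : 0 < beta U ν ρ₀ k) : (mIdx U ν ρ₀ k : ℝ) ≤
    1 + (200 * (|(k : ℝ)| * supNorm U) + 160000 * beta U ν ρ₀ k) / ν := by
  obtain ⟨m, hm1, hm⟩ := exists_mIdx_bound hν hβ
  have : mIdx U ν ρ₀ k ≤ m := Nat.sInf_le ((mem_mIdx_set_iff hν hβ m).2 hm)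
  exact le_trans (by exact_mod_cast this) hm1

/-- The last condition on `m_k` reads `D_k ≤ δ_k/16`, so `δ_k/(32 D_k) ≥ 1/2`, `θ_k ≥ 2^{-1/2}`, and
the logarithm is at most `(log 2)/2`. -/
theorem log_theta_inv_mem (hν : 0 < ν) {k : ℤ} (hβ : 0 < beta U ν ρ₀ k) :
    0 ≤ log (theta U ν ρ₀ k)⁻¹ ∧ log (theta U ν ρ₀ k)⁻¹ ≤ 1 / 2 := by
  obtain ⟨hm1, -, hm3⟩ := mIdx_spec hν hβ
  have hm' : (0 : ℝ) < mIdx U ν ρ₀ k := by exact_mod_cast hm1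
  have hq : 1 / 2 ≤ delta U ν ρ₀ k / (32 * bigD U ν ρ₀ k) := by
    rw [delta, bigD, le_div_iff₀ (by positivity), inv_eq_one_div, le_div_iff₀ hβ]
    have : 1 / 2 * (32 * (10 ^ 4 / (ν * mIdx U ν ρ₀ k))) * beta U ν ρ₀ k =
        160000 * beta U ν ρ₀ k / (ν * mIdx U ν ρ₀ k) := by ring
    rw [this, div_le_one (by positivity)]
    exact hm3
  have hθ1 : theta U ν ρ₀ k ≤ 1 := min_le_left _ _
  have hθ2 : √(1 / 2) ≤ theta U ν ρ₀ k :=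
    le_min (Real.sqrt_le_one.2 (by norm_num)) (Real.sqrt_le_sqrt hq)
  have hs : 0 < √(1 / 2 : ℝ) := Real.sqrt_pos.2 (by norm_num)
  have hθ0 := hs.trans_le hθ2
  rw [Real.log_inv]
  refine ⟨neg_nonneg.2 (Real.log_nonpos hθ0.le hθ1), ?_⟩
  have h1 := Real.log_le_log hs hθ2
  rw [Real.log_sqrt (by norm_num), one_div, Real.log_inv] at h1
  have := Real.log_two_lt_d9
  linarith

theorem beta_le_gamma (k : ℤ) : beta U ν ρ₀ k ≤ gamma U ν ρ₀ k := le_max_left _ _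

theorem bigLambda_le_gamma (hν : 0 < ν) {k : ℤ} (hβ : 0 < beta U ν ρ₀ k) :
    bigLambda U ν ρ₀ k ≤ gamma U ν ρ₀ k := by
  refine le_trans ?_ (le_max_right _ _)
  have := (log_theta_inv_mem hν hβ).1
  have hδ : 0 < (delta U ν ρ₀ k)⁻¹ := by rw [delta, inv_inv]; exact hβ
  have := mul_nonneg hδ.le this
  linarith

/-! ### Comparison of `ν c₂` with `C(ρ₀, U)` -/

theorem beta0_mul_le (hν : 0 < ν) (hν1 : ν ≤ 1) : ν * beta0 U ν ρ₀ ≤ bigB0 U ρ₀ := by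
  rw [bigB0, beta0, beta0, ← mul_div_assoc]
  refine div_le_div_of_nonneg_right ?_ (norm2_nonneg _)
  have h1 := norm2_nonneg (lap ρ₀)
  have h2 := mul_nonneg (supNorm_nonneg U) (norm2_nonneg (dx ρ₀))
  have h3 : ν * ν ≤ 1 := by nlinarith
  nlinarith [mul_le_mul_of_nonneg_right h3 h1, mul_le_mul_of_nonneg_right hν1 h2]

/-- For `ν ≤ 1` one has `β_k ≤ B_k` and `ν m_k ≤ m̄_k`. As `log θ_k⁻¹ ≤ 1/2`, the summand `1` beside
the `log⁺` in `Γ_k` already suffices. -/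
theorem gamma_mul_le (hs : SmoothTorus ρ₀) (hν : 0 < ν) (hν1 : ν ≤ 1) {k : ℤ} (hk : k ≠ 0)
    (ha : 0 < modeNorm ρ₀ k) : ν * gamma U ν ρ₀ k ≤ bigGamma U ρ₀ k := by
  have hβ : 0 < beta U ν ρ₀ k := beta_pos hs hν hk ha
  have hkM : 0 ≤ |(k : ℝ)| * supNorm U := mul_nonneg (abs_nonneg _) (supNorm_nonneg U)
  have hA := modeA_nonneg ρ₀ k
  have hβB : beta U ν ρ₀ k ≤ bigB U ρ₀ k := by
    have e : beta U ν ρ₀ k = 2 * (ν * (modeA ρ₀ k / modeNorm ρ₀ k) + |(k : ℝ)| * supNorm U) := by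
      rw [beta]; field_simp
    rw [e, bigB]
    have : ν * (modeA ρ₀ k / modeNorm ρ₀ k) ≤ modeA ρ₀ k / modeNorm ρ₀ k :=
      mul_le_of_le_one_left (by positivity) hν1
    linarith
  have hνβ : ν * beta U ν ρ₀ k ≤ bigB U ρ₀ k :=
    (mul_le_of_le_one_left hβ.le hν1).trans hβB
  rw [gamma, mul_max_of_nonneg _ _ hν.le]
  refine max_le_max hνβ ?_
  have hm := mIdx_le hν hβ
  set m : ℝ := (mIdx U ν ρ₀ k : ℝ) with hmdef
  have hm0 : 0 ≤ m := Nat.cast_nonneg _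
  have hνm : ν * m ≤ mBar U ρ₀ k := by
    have h1 : ν * m ≤ ν * (1 + (200 * (|(k : ℝ)| * supNorm U) + 160000 * beta U ν ρ₀ k) / ν) := by
      gcongr
    have h2 : ν * (1 + (200 * (|(k : ℝ)| * supNorm U) + 160000 * beta U ν ρ₀ k) / ν) =
        ν + 200 * (|(k : ℝ)| * supNorm U) + 160000 * beta U ν ρ₀ k := by
      field_simp; ring
    rw [mBar]
    linarith
  have hνm0 : 0 ≤ ν * m := by positivity
  have hν2 : ν * ν ≤ 1 := by nlinarith
  have e1 : ν * bigLambda U ν ρ₀ k ≤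
      (k : ℝ) ^ 2 + mBar U ρ₀ k ^ 2 + mBar U ρ₀ k + 1 / 2 := by
    have e : ν * bigLambda U ν ρ₀ k =
        ν * ν * (k : ℝ) ^ 2 + (ν * m) ^ 2 + ν * (ν * m) + ν * ν * (1 / 2) := by
      rw [bigLambda]; ring
    rw [e]
    have i1 : ν * ν * (k : ℝ) ^ 2 ≤ (k : ℝ) ^ 2 := mul_le_of_le_one_left (sq_nonneg _) hν2
    have i2 : (ν * m) ^ 2 ≤ mBar U ρ₀ k ^ 2 := by gcongr
    have i3 : ν * (ν * m) ≤ mBar U ρ₀ k := (mul_le_of_le_one_left hνm0 hν1).trans hνm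
    linarith
  have hlog := log_theta_inv_mem hν hβ
  have e2 : ν * ((delta U ν ρ₀ k)⁻¹ * log (theta U ν ρ₀ k)⁻¹) ≤
      bigB U ρ₀ k / 2 * (max 0 (log (320000 * bigB U ρ₀ k)) + 1) := by
    have hB : 0 ≤ bigB U ρ₀ k := hβ.le.trans hβB
    rw [delta, inv_inv, ← mul_assoc]
    calc ν * beta U ν ρ₀ k * log (theta U ν ρ₀ k)⁻¹ ≤ bigB U ρ₀ k * (1 / 2) :=
          mul_le_mul hνβ hlog.2 hlog.1 hB
      _ = bigB U ρ₀ k / 2 * 1 := by ring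
      _ ≤ _ := by
        gcongr
        linarith [le_max_left 0 (log (320000 * bigB U ρ₀ k))]
  rw [mul_add]
  linarith

theorem log_div_nonneg {a N : ℝ} (ha : 0 < a) (h : a ≤ N) : 0 ≤ log (N / a) :=
  Real.log_nonneg (by rwa [le_div_iff₀ ha, one_mul])

theorem exists_zero_mode (hs : SmoothTorus ρ₀) (hmean : ∫ p, ρ₀ p ∂μ2 = 0) (hne : ρ₀ ≠ 0)
    (h : ¬ ∃ k : ℤ, k ≠ 0 ∧ 0 < modeNorm ρ₀ k) : ∃ l : ℤ, l ≠ 0 ∧ 0 < ‖coeff ρ₀ 0 l‖ := by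
  obtain ⟨k, l, hkl, hc⟩ := exists_coeff_ne_zero hs hmean hne
  have hk : k = 0 := by
    by_contra hk
    exact h ⟨k, hk, (norm_pos_iff.2 hc).trans_le (norm_coeff_le hs.memLp k l)⟩
  subst hk
  exact ⟨l, by simpa using hkl, norm_pos_iff.2 hc⟩

/-- `c₂` is the infimum of a nonempty set bounded below by `β₀`, hence lies in its closure. A closed
property of all candidates passes to `c₂` without showing that the minimum is attained. -/
theorem c2_mem_closure (hs : SmoothTorus ρ₀) (hmean : ∫ p, ρ₀ p ∂μ2 = 0) (hne : ρ₀ ≠ 0)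
    (P : ℝ → Prop) (hP : IsClosed {c | P c})
    (h1 : ∀ k : ℤ, k ≠ 0 → 0 < modeNorm ρ₀ k → P (max (beta0 U ν ρ₀)
      (gamma U ν ρ₀ k + beta0 U ν ρ₀ * log (norm2 ρ₀ / modeNorm ρ₀ k))))
    (h2 : ∀ l : ℤ, l ≠ 0 → 0 < ‖coeff ρ₀ 0 l‖ → P (max (beta0 U ν ρ₀)
      (ν * (l : ℝ) ^ 2 + beta0 U ν ρ₀ * log (norm2 ρ₀ / ‖coeff ρ₀ 0 l‖)))) :
    P (c2 U ν ρ₀) := by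
  rw [c2]
  split_ifs with h
  · obtain ⟨k, hk, ha⟩ := h
    refine closure_minimal ?_ hP (csInf_mem_closure ⟨_, k, hk, ha, rfl⟩ ⟨beta0 U ν ρ₀, ?_⟩)
    · rintro c ⟨k, hk, ha, rfl⟩
      exact h1 k hk ha
    · rintro c ⟨k, hk, ha, rfl⟩
      exact le_max_left _ _
  · obtain ⟨l, hl, ha⟩ := exists_zero_mode hs hmean hne h
    refine closure_minimal ?_ hP (csInf_mem_closure ⟨_, l, hl, ha, rfl⟩ ⟨beta0 U ν ρ₀, ?_⟩)
    · rintro c ⟨l, hl, ha, rfl⟩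
      exact h2 l hl ha
    · rintro c ⟨l, hl, ha, rfl⟩
      exact le_max_left _ _

theorem beta0_le_c2 (hs : SmoothTorus ρ₀) (hmean : ∫ p, ρ₀ p ∂μ2 = 0) (hne : ρ₀ ≠ 0) :
    beta0 U ν ρ₀ ≤ c2 U ν ρ₀ :=
  c2_mem_closure hs hmean hne (fun c => beta0 U ν ρ₀ ≤ c) isClosed_Ici
    (fun _ _ _ => le_max_left _ _) fun _ _ _ => le_max_left _ _

theorem c2_pos (hs : SmoothTorus ρ₀) (hmean : ∫ p, ρ₀ p ∂μ2 = 0) (hne : ρ₀ ≠ 0) (hν : 0 < ν) :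
    0 < c2 U ν ρ₀ :=
  (beta0_pos hs hmean hne hν).trans_le (beta0_le_c2 hs hmean hne)

theorem constC_pos (hs : SmoothTorus ρ₀) (hmean : ∫ p, ρ₀ p ∂μ2 = 0) (hne : ρ₀ ≠ 0) :
    0 < constC U ρ₀ := by
  have hB : 0 < bigB0 U ρ₀ := beta0_pos hs hmean hne one_pos
  refine hB.trans_le ?_
  rw [constC]
  split_ifs with h
  · obtain ⟨k, hk, ha⟩ := h
    refine le_csInf ⟨_, k, hk, ha, rfl⟩ ?_
    rintro c ⟨k, hk, ha, rfl⟩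
    exact le_max_left _ _
  · obtain ⟨l, hl, ha⟩ := exists_zero_mode hs hmean hne h
    refine le_csInf ⟨_, l, hl, ha, rfl⟩ ?_
    rintro c ⟨l, hl, ha, rfl⟩
    exact le_max_left _ _

theorem c2_le_constC_div (hs : SmoothTorus ρ₀) (hmean : ∫ p, ρ₀ p ∂μ2 = 0) (hne : ρ₀ ≠ 0)
    (hν : 0 < ν) (hν1 : ν ≤ 1) : c2 U ν ρ₀ ≤ constC U ρ₀ / ν := by
  rw [le_div_iff₀ hν, mul_comm]
  have hβ0 := beta0_mul_le (U := U) (ρ₀ := ρ₀) hν hν1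
  have key : ∀ {x y L : ℝ}, ν * x ≤ y → 0 ≤ L → ν * max (beta0 U ν ρ₀) (x + beta0 U ν ρ₀ * L) ≤
      max (bigB0 U ρ₀) (y + bigB0 U ρ₀ * L) := fun {x y L} hxy hL => by
    rw [mul_max_of_nonneg _ _ hν.le]
    refine max_le_max hβ0 ?_
    nlinarith [mul_le_mul_of_nonneg_right hβ0 hL]
  rw [c2, constC]
  split_ifs with h
  · obtain ⟨k, hk, ha⟩ := h
    refine le_csInf ⟨_, k, hk, ha, rfl⟩ ?_
    rintro c ⟨k, hk, ha, rfl⟩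
    refine le_trans (mul_le_mul_of_nonneg_left (csInf_le ⟨beta0 U ν ρ₀, ?_⟩ ⟨k, hk, ha, rfl⟩) hν.le)
      (key (gamma_mul_le hs hν hν1 hk ha) (log_div_nonneg ha (modeNorm_le hs k)))
    rintro c ⟨k, hk, ha, rfl⟩
    exact le_max_left _ _
  · obtain ⟨l, hl, ha⟩ := exists_zero_mode hs hmean hne h
    refine le_csInf ⟨_, l, hl, ha, rfl⟩ ?_
    rintro c ⟨l, hl, ha, rfl⟩
    refine le_trans (mul_le_mul_of_nonneg_left (csInf_le ⟨beta0 U ν ρ₀, ?_⟩ ⟨l, hl, ha, rfl⟩) hν.le)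
      (key ?_ (log_div_nonneg ha ((norm_coeff_le hs.memLp 0 l).trans (modeNorm_le hs 0))))
    · rintro c ⟨l, hl, ha, rfl⟩
      exact le_max_left _ _
    · rw [← mul_assoc]
      exact mul_le_of_le_one_left (sq_nonneg _) (by nlinarith)

/-! ### The cutoffs in the definition of `R_*` -/

theorem cutK0_spec (hs : SmoothTorus ρ₀) (hne : ρ₀ ≠ 0) :
    (∑' k : ℤ, if (cutK0 ρ₀ : ℤ) < |k| then modeNorm ρ₀ k ^ 2 else 0) ≤ norm2 ρ₀ ^ 2 / 2 := by
  obtain ⟨J, -, hJ⟩ := exists_tail_le (hasSum_norm1_xMode_sq (hs.memLp (p := 2)))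
    (fun _ => sq_nonneg _) (pow_pos (norm2_pos hs hne) 2)
  exact Nat.sInf_mem (s := {J : ℕ | (∑' k : ℤ, if (J : ℤ) < |k| then modeNorm ρ₀ k ^ 2 else 0) ≤
    norm2 ρ₀ ^ 2 / 2}) ⟨J, hJ⟩

theorem cutJ_spec (hs : SmoothTorus ρ₀) {k : ℤ} (ha : 0 < modeNorm ρ₀ k) :
    1 ≤ cutJ ρ₀ k ∧ (∑' l : ℤ, if (cutJ ρ₀ k : ℤ) < |l| then ‖coeff ρ₀ k l‖ ^ 2 else 0) ≤
      modeNorm ρ₀ k ^ 2 / 2 := by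
  obtain ⟨J, hJ⟩ := exists_tail_le (hasSum_coeff_sq (hs.memLp (p := 2)) k)
    (fun _ => sq_nonneg _) (pow_pos ha 2)
  exact Nat.sInf_mem (s := {J : ℕ | 1 ≤ J ∧
    (∑' l : ℤ, if (J : ℤ) < |l| then ‖coeff ρ₀ k l‖ ^ 2 else 0) ≤ modeNorm ρ₀ k ^ 2 / 2}) ⟨J, hJ⟩

theorem cutJ_le_cutN (k : ℤ) : cutJ ρ₀ k ≤ cutN U ν ρ₀ k := by
  rw [cutN]
  split_ifs with h
  · rw [h]
  · exact (le_max_left _ _).trans (le_max_left _ _)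

theorem shear_le_cutN (hν : 0 < ν) (k : ℤ) : |(k : ℝ)| * supNorm U ≤ ν * cutN U ν ρ₀ k := by
  rw [cutN]
  split_ifs with h
  · subst h; simp; positivity
  · have h1 : |(k : ℝ)| * supNorm U / ν ≤ (⌈|(k : ℝ)| * supNorm U / ν⌉₊ : ℝ) := Nat.le_ceil _
    rw [div_le_iff₀' hν] at h1
    refine h1.trans ?_
    gcongr
    exact (le_max_right _ _).trans (le_max_left _ _)

theorem sum_low_ge (hs : SmoothTorus ρ₀) {k : ℤ} (ha : 0 < modeNorm ρ₀ k) {N : ℕ}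
    (hN : cutJ ρ₀ k ≤ N) :
    modeNorm ρ₀ k ^ 2 ≤ 2 * ∑ l ∈ Finset.Icc (-(N : ℤ)) N, ‖coeff ρ₀ k l‖ ^ 2 := by
  have h1 := (cutJ_spec hs ha).2
  have h2 := hasSum_coeff_sq (hs.memLp (p := 2)) k
  rw [(hasSum_tail h2 _).tsum_eq] at h1
  have h3 : ∑ l ∈ Finset.Icc (-(cutJ ρ₀ k : ℤ)) (cutJ ρ₀ k), ‖coeff ρ₀ k l‖ ^ 2 ≤
      ∑ l ∈ Finset.Icc (-(N : ℤ)) N, ‖coeff ρ₀ k l‖ ^ 2 :=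
    Finset.sum_le_sum_of_subset_of_nonneg (Finset.Icc_subset_Icc (by omega) (by omega))
      fun _ _ _ => sq_nonneg _
  have e : norm1 (xMode ρ₀ k) = modeNorm ρ₀ k := rfl
  rw [e] at h1
  linarith

theorem bddAbove_radius_set : BddAbove {r : ℝ | ∃ k : ℤ, |k| ≤ (cutK U ν ρ₀ : ℤ) ∧
    0 < modeNorm ρ₀ k ∧ r = (k : ℝ) ^ 2 + (cutN U ν ρ₀ k : ℝ) ^ 2} := by
  refine Set.Finite.bddAbove (Set.Finite.subset ((Set.finite_Icc (-(cutK U ν ρ₀ : ℤ))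
    (cutK U ν ρ₀)).image fun k : ℤ => (k : ℝ) ^ 2 + (cutN U ν ρ₀ k : ℝ) ^ 2) ?_)
  rintro r ⟨k, hk, -, rfl⟩
  exact ⟨k, abs_le.1 hk, rfl⟩

theorem le_RStar_sq {k : ℤ} (hk : |k| ≤ (cutK U ν ρ₀ : ℤ)) (ha : 0 < modeNorm ρ₀ k) :
    (k : ℝ) ^ 2 + (cutN U ν ρ₀ k : ℝ) ^ 2 ≤ RStar U ν ρ₀ ^ 2 := by
  have h := le_csSup bddAbove_radius_set ⟨k, hk, ha, rfl⟩
  rw [RStar, Real.sq_sqrt (le_trans (by positivity) h)]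
  exact h

theorem sum_modes_ge (hs : SmoothTorus ρ₀) (hne : ρ₀ ≠ 0) : norm2 ρ₀ ^ 2 / 2 ≤
    ∑ k ∈ Finset.Icc (-(cutK U ν ρ₀ : ℤ)) (cutK U ν ρ₀), modeNorm ρ₀ k ^ 2 := by
  have h1 := cutK0_spec hs hne
  have h2 := hasSum_modeNorm_sq (hs.memLp (p := 2))
  rw [(hasSum_tail h2 _).tsum_eq] at h1
  have hK : cutK0 ρ₀ ≤ cutK U ν ρ₀ := le_max_right _ _
  have h3 : ∑ k ∈ Finset.Icc (-(cutK0 ρ₀ : ℤ)) (cutK0 ρ₀), modeNorm ρ₀ k ^ 2 ≤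
      ∑ k ∈ Finset.Icc (-(cutK U ν ρ₀ : ℤ)) (cutK U ν ρ₀), modeNorm ρ₀ k ^ 2 :=
    Finset.sum_le_sum_of_subset_of_nonneg (Finset.Icc_subset_Icc (by omega) (by omega))
      fun _ _ _ => sq_nonneg _
  linarith

theorem RStar_pos (hs : SmoothTorus ρ₀) (hne : ρ₀ ≠ 0) : 0 < RStar U ν ρ₀ := by
  have h1 := sum_modes_ge (U := U) (ν := ν) hs hne
  have h2 : 0 < norm2 ρ₀ ^ 2 / 2 := by have := norm2_pos hs hne; positivity
  obtain ⟨k, hk, hk'⟩ := Finset.exists_lt_of_sum_lt (s := Finset.Icc (-(cutK U ν ρ₀ : ℤ))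
    (cutK U ν ρ₀)) (f := fun _ => (0 : ℝ)) (g := fun k => modeNorm ρ₀ k ^ 2)
    (by simpa using h2.trans_le h1)
  have ha : 0 < modeNorm ρ₀ k :=
    lt_of_le_of_ne (modeNorm_nonneg _ _) fun h => by simp [← h] at hk'
  have h3 := le_RStar_sq (abs_le.2 (Finset.mem_Icc.1 hk)) ha
  have h4 : (1 : ℝ) ≤ cutN U ν ρ₀ k := by
    exact_mod_cast (cutJ_spec hs ha).1.trans (cutJ_le_cutN k)
  refine lt_of_le_of_ne (Real.sqrt_nonneg _) fun h => ?_
  rw [← h] at h3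
  nlinarith [sq_nonneg (k : ℝ)]

end Datum

/-! ### Lower bounds for solutions -/

theorem exp_neg_le_one_sub_half {x : ℝ} (h0 : 0 ≤ x) (h1 : x ≤ 1) : exp (-x) ≤ 1 - x / 2 := by
  rw [Real.exp_neg, inv_eq_one_div, div_le_iff₀ (exp_pos x)]
  nlinarith [Real.add_one_le_exp x]

/-- While `βt ≤ 1`, the linear bound dominates `N e^{-βt}` because `e^{-x} ≤ 1 - x/2` on `[0, 1]`.
Once `βt > 1`, the loss `N/a` is at most `e^{β log(N/a) t}` and is absorbed by the exponent. -/
theorem mul_exp_neg_le_of_short_of_long {N a β γ t X : ℝ} (ha : 0 < a) (haN : a ≤ N) (hβ : 0 < β)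
    (ht : 0 ≤ t) (hshort : N - β * N / 2 * t ≤ X) (hlong : a * exp (-(γ * t)) ≤ X) :
    N * exp (-(max β (γ + β * log (N / a)) * t)) ≤ X := by
  have hN : 0 < N := ha.trans_le haN
  by_cases h : β * t ≤ 1
  · refine le_trans ?_ hshort
    have h1 := exp_neg_le_one_sub_half (mul_nonneg hβ.le ht) h
    have h2 : exp (-(max β (γ + β * log (N / a)) * t)) ≤ exp (-(β * t)) := by
      gcongr; exact le_max_left _ _
    nlinarith [mul_le_mul_of_nonneg_left (h2.trans h1) hN.le]
  · refine le_trans ?_ hlong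
    have hlog : 0 ≤ log (N / a) := log_div_nonneg ha haN
    have h1 : γ * t + log (N / a) ≤ max β (γ + β * log (N / a)) * t := by
      have := mul_le_mul_of_nonneg_right (le_max_right β (γ + β * log (N / a))) ht
      nlinarith
    have h2 : exp (-(max β (γ + β * log (N / a)) * t)) ≤ exp (-(γ * t) - log (N / a)) :=
      exp_le_exp.2 (by linarith)
    rw [Real.exp_sub, Real.exp_log (by positivity)] at h2
    refine (mul_le_mul_of_nonneg_left h2 hN.le).trans (le_of_eq ?_)
    field_simp

section Solution

variable {U : ℝ → T1 → ℝ} {ν : ℝ} {ρ₀ : T2 → ℂ} {ρ : ℝ → Lp ℂ 2 μ2}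

theorem exists_isEvolution (hU : BoundedShear U) (hρ : IsSolution U ν ρ₀ ρ) (hν : 0 ≤ ν) (k : ℤ) :
    ∃ B : ℝ → Lp ℂ 2 μ1 → Lp ℂ 2 μ1,
      IsEvolution basis1 (fun l => ν * ((k : ℝ) ^ 2 + (l : ℝ) ^ 2)) k (supNorm U) B
        (fun t => modeLp k (ρ (max t 0))) := by
  obtain ⟨V, hV, hM, hUV⟩ := exists_bounded_representative hU
  exact ⟨_, isEvolution_mode hρ hV (supNorm_nonneg U) hM hUV hν k⟩

theorem coeff_initial (hρ : IsSolution U ν ρ₀ ρ) (k l : ℤ) : coeff (ρ 0) k l = coeff ρ₀ k l :=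
  coeff_congr hρ.initial k l

/-- `ρ 0` agrees with `ρ₀` only almost everywhere on the torus; comparing Fourier coefficients
avoids an argument on slices. -/
theorem norm1_xMode_initial (hρ : IsSolution U ν ρ₀ ρ) (hs : SmoothTorus ρ₀) (k : ℤ) :
    norm1 (xMode (ρ 0) k) = modeNorm ρ₀ k := by
  have h1 := hasSum_coeff_sq (Lp.memLp (ρ 0)) k
  simp_rw [coeff_initial hρ] at h1
  have h2 := h1.unique (hasSum_coeff_sq hs.memLp k)
  exact (pow_left_inj₀ (norm1_nonneg _) (norm1_nonneg _) two_ne_zero).1 h2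

theorem norm1_xMode_le_exp (hU : BoundedShear U) (hρ : IsSolution U ν ρ₀ ρ) (hs : SmoothTorus ρ₀)
    (hν : 0 ≤ ν) (k : ℤ) {t : ℝ} (ht : 0 ≤ t) :
    norm1 (xMode (ρ t) k) ≤ exp (-(ν * k ^ 2 * t)) * modeNorm ρ₀ k := by
  obtain ⟨V, hV, hM, hUV⟩ := exists_bounded_representative hU
  have h := norm_mode_le hρ hV (supNorm_nonneg U) hM hUV hν k ht
  rwa [norm1_xMode_initial hρ hs] at h

/-- `Λ` lies `|k|M` above the top low eigenvalue `ν(k² + N²)`. The next one is higher by `ν(2N + 1)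
≥ 2|k|M`, so the gap is `η = |k|M` on both sides. -/
theorem signed_energy_mode (hU : BoundedShear U) (hρ : IsSolution U ν ρ₀ ρ) (hs : SmoothTorus ρ₀)
    (hν : 0 < ν) (k : ℤ) {N : ℕ} (hN : |(k : ℝ)| * supNorm U ≤ ν * N) {t : ℝ} (ht : 0 ≤ t) :
    2 * ∑ l ∈ Finset.Icc (-(N : ℤ)) N, ‖coeff ρ₀ k l‖ ^ 2 - modeNorm ρ₀ k ^ 2 ≤
      exp (2 * (ν * ((k : ℝ) ^ 2 + (N : ℝ) ^ 2) + |(k : ℝ)| * supNorm U) * t) *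
        (2 * ∑ l ∈ Finset.Icc (-(N : ℤ)) N, ‖coeff (ρ t) k l‖ ^ 2 -
          norm1 (xMode (ρ t) k) ^ 2) := by
  obtain ⟨B, hB⟩ := exists_isEvolution hU hρ hν.le k
  have hη : 0 ≤ |(k : ℝ)| * supNorm U := mul_nonneg (abs_nonneg _) (supNorm_nonneg U)
  have h := hB.signed_energy_le (supNorm_nonneg U) (Finset.Icc (-(N : ℤ)) N)
    (Λ := ν * ((k : ℝ) ^ 2 + (N : ℝ) ^ 2) + |(k : ℝ)| * supNorm U) hη (fun l hl => ?_)
    (fun l hl => ?_) (Or.inr le_rfl) ht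
  · simp_rw [inner_basis1_modeLp, norm_modeLp, max_eq_left ht, max_self, coeff_initial hρ,
      norm1_xMode_initial hρ hs] at h
    exact h
  · have h1 : |l| ≤ (N : ℤ) := abs_le.2 (Finset.mem_Icc.1 hl)
    have h2 : (l : ℝ) ^ 2 ≤ (N : ℝ) ^ 2 := by
      rw [← sq_abs (l : ℝ)]
      have : |(l : ℝ)| ≤ N := by exact_mod_cast h1
      gcongr
    gcongr
  · have h1 : (N : ℤ) + 1 ≤ |l| := by
      by_contra hc
      exact hl (Finset.mem_Icc.2 (abs_le.1 (by omega)))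
    have h2 : ((N : ℝ) + 1) ^ 2 ≤ (l : ℝ) ^ 2 := by
      rw [← sq_abs (l : ℝ)]
      have : (N : ℝ) + 1 ≤ |(l : ℝ)| := by exact_mod_cast h1
      gcongr
    have h3 := mul_le_mul_of_nonneg_left h2 hν.le
    nlinarith

theorem sum_coeff_sq_le (r : Lp ℂ 2 μ2) (k : ℤ) (s : Finset ℤ) :
    ∑ l ∈ s, ‖coeff r k l‖ ^ 2 ≤ norm1 (xMode r k) ^ 2 :=
  sum_le_hasSum s (fun _ _ => sq_nonneg _) (hasSum_coeff_sq (Lp.memLp r) k)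

theorem short_time_mode (hU : BoundedShear U) (hρ : IsSolution U ν ρ₀ ρ) (hs : SmoothTorus ρ₀)
    (hν : 0 < ν) {k : ℤ} (ha : 0 < modeNorm ρ₀ k) {t : ℝ} (ht : 0 ≤ t) :
    modeNorm ρ₀ k - beta U ν ρ₀ k * modeNorm ρ₀ k / 2 * t ≤ norm1 (xMode (ρ t) k) := by
  obtain ⟨B, hB⟩ := exists_isEvolution hU hρ hν.le k
  have hn : ‖modeLp k (ρ (max 0 0))‖ = modeNorm ρ₀ k := by
    rw [norm_modeLp, max_self, norm1_xMode_initial hρ hs]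
  have h := hB.sub_mul_le_norm (supNorm_nonneg U) (fun l => by positivity)
    (A := ν * modeA ρ₀ k) (mul_nonneg hν.le (modeA_nonneg _ _)) ?_ ?_ ht
  · simp only [hn] at h
    rw [norm_modeLp, max_eq_left ht] at h
    rw [beta_mul_modeNorm ha]
    linarith
  · simp_rw [inner_basis1_modeLp, max_self, coeff_initial hρ]
    have e : (fun l : ℤ => (ν * ((k : ℝ) ^ 2 + (l : ℝ) ^ 2) * ‖coeff ρ₀ k l‖) ^ 2) =
        fun l : ℤ => ν ^ 2 * (((k : ℝ) ^ 2 + (l : ℝ) ^ 2) * ‖coeff ρ₀ k l‖) ^ 2 := by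
      ext l; ring
    rw [e, mul_pow]
    exact (hasSum_modeA_sq hs k).mul_left (ν ^ 2)
  · intro h0
    simp only [h0, norm_zero] at hn
    linarith

/-- Chebyshev: the energy in `|l| > m` is at most `m⁻⁴‖A_k g_k‖² ≤ a_k²/4`, which leaves `2·(3/4) -
1 = 1/2`. -/
theorem low_modes_ge (hs : SmoothTorus ρ₀) {k : ℤ} {m : ℕ} (hm : 1 ≤ m)
    (hA : 2 * modeA ρ₀ k ≤ (m : ℝ) ^ 2 * modeNorm ρ₀ k) :
    modeNorm ρ₀ k ^ 2 / 2 ≤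
      2 * ∑ l ∈ Finset.Icc (-(m : ℤ)) m, ‖coeff ρ₀ k l‖ ^ 2 - modeNorm ρ₀ k ^ 2 := by
  have hm0 : (0 : ℝ) < m := by exact_mod_cast hm
  have htail := hasSum_tail (hasSum_coeff_sq (hs.memLp (p := 2)) k) m
  have hle := hasSum_le (fun l => ?_) htail ((hasSum_modeA_sq hs k).mul_left (1 / (m : ℝ) ^ 4))
  · have h1 : 1 / (m : ℝ) ^ 4 * modeA ρ₀ k ^ 2 ≤ modeNorm ρ₀ k ^ 2 / 4 := by
      rw [one_div_mul_eq_div, div_le_iff₀ (by positivity)]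
      have := pow_le_pow_left₀ (mul_nonneg zero_le_two (modeA_nonneg ρ₀ k)) hA 2
      nlinarith
    have e : norm1 (xMode ρ₀ k) = modeNorm ρ₀ k := rfl
    rw [e] at hle
    linarith
  · split_ifs with h
    · rw [one_div_mul_eq_div, le_div_iff₀ (by positivity), mul_pow, mul_comm]
      refine mul_le_mul_of_nonneg_right ?_ (sq_nonneg _)
      have h1 : (m : ℝ) ≤ |(l : ℝ)| := by exact_mod_cast h.le
      have h2 : (m : ℝ) ^ 2 ≤ (l : ℝ) ^ 2 := by
        rw [← sq_abs (l : ℝ)]; gcongr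
      have h3 : (m : ℝ) ^ 2 ≤ (k : ℝ) ^ 2 + (l : ℝ) ^ 2 := by linarith [sq_nonneg (k : ℝ)]
      calc (m : ℝ) ^ 4 = ((m : ℝ) ^ 2) ^ 2 := by ring
        _ ≤ _ := by gcongr
    · positivity

theorem mode_lower_bound (hU : BoundedShear U) (hρ : IsSolution U ν ρ₀ ρ) (hs : SmoothTorus ρ₀)
    (hν : 0 < ν) {k : ℤ} (hk : k ≠ 0) (ha : 0 < modeNorm ρ₀ k) {t : ℝ} (ht : 0 ≤ t) :
    modeNorm ρ₀ k * exp (-(gamma U ν ρ₀ k * t)) ≤ norm1 (xMode (ρ t) k) := by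
  have hβ : 0 < beta U ν ρ₀ k := beta_pos hs hν hk ha
  by_cases h : beta U ν ρ₀ k * t ≤ 1
  · have h0 := short_time_mode hU hρ hs hν ha ht
    have h1 := exp_neg_le_one_sub_half (mul_nonneg hβ.le ht) h
    have h2 : exp (-(gamma U ν ρ₀ k * t)) ≤ exp (-(beta U ν ρ₀ k * t)) := by
      gcongr; exact beta_le_gamma k
    nlinarith [mul_le_mul_of_nonneg_left (h2.trans h1) ha.le]
  · obtain ⟨hm1, hm2, hm3⟩ := mIdx_spec hν hβ
    have hΛγ := bigLambda_le_gamma hν hβ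
    set m := mIdx U ν ρ₀ k with hm
    have hm1' : (1 : ℝ) ≤ m := by exact_mod_cast hm1
    have hkM : 0 ≤ |(k : ℝ)| * supNorm U := mul_nonneg (abs_nonneg _) (supNorm_nonneg U)
    -- `2ν‖A_k g_k‖ ≤ β_k a_k`, and `β_k ≤ νm ≤ νm²`.
    have hA : 2 * modeA ρ₀ k ≤ (m : ℝ) ^ 2 * modeNorm ρ₀ k := by
      have h1 := beta_mul_modeNorm (U := U) (ν := ν) ha
      have h2 : beta U ν ρ₀ k ≤ ν * (m : ℝ) ^ 2 := by
        have : ν * (m : ℝ) ≤ ν * (m : ℝ) ^ 2 := by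
          have : (m : ℝ) ≤ (m : ℝ) ^ 2 := by nlinarith
          gcongr
        linarith
      have h3 := mul_le_mul_of_nonneg_right h2 ha.le
      have h4 := mul_nonneg hkM ha.le
      refine le_of_mul_le_mul_left ?_ hν
      linarith
    have hlow := low_modes_ge hs hm1 hA
    have hcone := signed_energy_mode hU hρ hs hν k (N := m) (by linarith) ht
    set Λ' := ν * ((k : ℝ) ^ 2 + (m : ℝ) ^ 2) + |(k : ℝ)| * supNorm U with hΛ'
    have hsum := sum_coeff_sq_le (ρ t) k (Finset.Icc (-(m : ℤ)) m)
    have h1 : modeNorm ρ₀ k ^ 2 / 2 ≤ exp (2 * Λ' * t) * norm1 (xMode (ρ t) k) ^ 2 :=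
      hlow.trans (hcone.trans (mul_le_mul_of_nonneg_left (by linarith) (exp_pos _).le))
    -- `Λ_k - Λ' = νm + ν/2 - |k|M` is at least `β_k` by the choice of `m_k`, and `β_k t > 1` here.
    -- The resulting factor `e^{2(γ_k - Λ')t} ≥ 2` absorbs the `1/2` lost in `low_modes_ge`.
    have hgap : 1 ≤ (gamma U ν ρ₀ k - Λ') * t := by
      have e : bigLambda U ν ρ₀ k - Λ' = ν * m + ν / 2 - |(k : ℝ)| * supNorm U := by
        rw [bigLambda, hΛ']; ring
      have g1 : beta U ν ρ₀ k ≤ gamma U ν ρ₀ k - Λ' := by linarith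
      have g2 := mul_le_mul_of_nonneg_right g1 ht
      linarith
    have h2 : 2 ≤ exp (2 * ((gamma U ν ρ₀ k - Λ') * t)) := by
      linarith [Real.add_one_le_exp (2 * ((gamma U ν ρ₀ k - Λ') * t))]
    refine le_of_sq_le_sq ?_ (norm1_nonneg _)
    have e1 : (modeNorm ρ₀ k * exp (-(gamma U ν ρ₀ k * t))) ^ 2 * exp (2 * Λ' * t) *
        exp (2 * ((gamma U ν ρ₀ k - Λ') * t)) = modeNorm ρ₀ k ^ 2 := by
      rw [mul_pow, ← Real.exp_nat_mul, mul_assoc, mul_assoc, ← Real.exp_add, ← Real.exp_add]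
      rw [show ((2 : ℕ) : ℝ) * -(gamma U ν ρ₀ k * t) + (2 * Λ' * t +
        2 * ((gamma U ν ρ₀ k - Λ') * t)) = 0 by push_cast; ring, Real.exp_zero, mul_one]
    set Y := (modeNorm ρ₀ k * exp (-(gamma U ν ρ₀ k * t))) ^ 2 with hY
    have hY0 : 0 ≤ Y * exp (2 * Λ' * t) := mul_nonneg (sq_nonneg _) (exp_pos _).le
    have h3 : Y * exp (2 * Λ' * t) ≤ norm1 (xMode (ρ t) k) ^ 2 * exp (2 * Λ' * t) := by
      nlinarith [mul_le_mul_of_nonneg_left h2 hY0]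
    exact le_of_mul_le_mul_right h3 (exp_pos _)

/-- For `k = 0` the shear term vanishes, and with `Λ = νl²` the integrand of the energy identity is
zero. For `l = 0` this is conservation of the mean. -/
theorem norm_coeff_zero_mode (hU : BoundedShear U) (hρ : IsSolution U ν ρ₀ ρ) (hν : 0 ≤ ν) (l : ℤ)
    {t : ℝ} (ht : 0 ≤ t) :
    ‖coeff (ρ t) 0 l‖ = ‖coeff ρ₀ 0 l‖ * exp (-(ν * (l : ℝ) ^ 2 * t)) := by
  obtain ⟨B, hB⟩ := exists_isEvolution hU hρ hν 0
  have h := exp_mul_norm_sq_sub_eq_integral (ν * (l : ℝ) ^ 2) ht (hB.intervalIntegrable l t ht)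
    fun s hs => hB.eq_integral l s hs.1
  simp_rw [IsEvolution.integrand_eq] at h
  simp only [Int.cast_zero, inner_basis1_modeLp, max_eq_left ht, max_self, coeff_initial hρ] at h
  have hz : ∀ s : ℝ, exp (2 * (ν * (l : ℝ) ^ 2) * s) * (2 * ((ν * (l : ℝ) ^ 2 -
      ν * ((0 : ℝ) ^ 2 + (l : ℝ) ^ 2)) * ‖coeff (ρ (max s 0)) 0 l‖ ^ 2 + 0 *
        ((starRingEnd ℂ) (coeff (ρ (max s 0)) 0 l) *
          inner ℂ (basis1 l) (B s (modeLp 0 (ρ (max s 0))))).im)) = 0 := fun s => by ring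
  simp_rw [hz, intervalIntegral.integral_zero] at h
  have h2 : (exp (ν * (l : ℝ) ^ 2 * t) * ‖coeff (ρ t) 0 l‖) ^ 2 = ‖coeff ρ₀ 0 l‖ ^ 2 := by
    rw [mul_pow, ← Real.exp_nat_mul]
    have : ((2 : ℕ) : ℝ) * (ν * (l : ℝ) ^ 2 * t) = 2 * (ν * (l : ℝ) ^ 2) * t := by
      push_cast; ring
    rw [this]; linarith
  have h3 := (pow_left_inj₀ (by positivity) (norm_nonneg _) two_ne_zero).1 h2
  rw [← h3, Real.exp_neg]
  field_simp

theorem norm_solution_lower_bound (hU : BoundedShear U) (hρ : IsSolution U ν ρ₀ ρ)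
    (hs : SmoothTorus ρ₀) (hmean : ∫ p, ρ₀ p ∂μ2 = 0) (hne : ρ₀ ≠ 0) (hν : 0 < ν)
    {t : ℝ} (ht : 0 ≤ t) : norm2 ρ₀ * exp (-(c2 U ν ρ₀ * t)) ≤ ‖ρ t‖ := by
  obtain ⟨V, hV, hM, hUV⟩ := exists_bounded_representative hU
  have hN := norm2_pos hs hne
  have hβ : 0 < beta0 U ν ρ₀ := beta0_pos hs hmean hne hν
  have hshort : norm2 ρ₀ - beta0 U ν ρ₀ * norm2 ρ₀ / 2 * t ≤ ‖ρ t‖ := by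
    have h := sub_mul_le_norm_solution hρ hs hV (supNorm_nonneg U) hM hUV hν.le hN ht
    have e : beta0 U ν ρ₀ * norm2 ρ₀ =
        2 * (ν * norm2 (lap ρ₀) + supNorm U * norm2 (dx ρ₀)) := by
      rw [beta0, div_mul_cancel₀ _ hN.ne']
    rw [e]
    linarith
  have hle : ∀ k, norm1 (xMode (ρ t) k) ≤ ‖ρ t‖ := fun k => by
    rw [norm_eq_norm2]; exact norm1_xMode_le (Lp.memLp _) k
  refine c2_mem_closure hs hmean hne (fun c => norm2 ρ₀ * exp (-(c * t)) ≤ ‖ρ t‖)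
    (isClosed_le (by fun_prop) continuous_const) (fun k hk ha => ?_) fun l _ ha => ?_
  · exact mul_exp_neg_le_of_short_of_long ha (modeNorm_le hs k) hβ ht hshort
      ((mode_lower_bound hU hρ hs hν hk ha ht).trans (hle k))
  · refine mul_exp_neg_le_of_short_of_long ha
      ((norm_coeff_le hs.memLp 0 l).trans (modeNorm_le hs 0)) hβ ht hshort ?_
    rw [← norm_coeff_zero_mode hU hρ hν.le l ht]
    exact (norm_coeff_le (Lp.memLp _) 0 l).trans (hle 0)

/-! ### The ratio of the `Ḣ⁻¹` norm to the `L²` norm -/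

/-- For `|k| > K`, `νk² ≥ νK² ≥ 2c₂`, so the tail in `k` is at most `e^{-2c₂t}‖ρ₀‖²/2`. By the
exponential lower bound this is at most `‖ρ(t)‖²/2`. -/
theorem sum_low_modes_ge (hU : BoundedShear U) (hρ : IsSolution U ν ρ₀ ρ)
    (hs : SmoothTorus ρ₀) (hmean : ∫ p, ρ₀ p ∂μ2 = 0) (hne : ρ₀ ≠ 0) (hν : 0 < ν)
    {t : ℝ} (ht : 0 ≤ t) : ‖ρ t‖ ^ 2 / 2 ≤
      ∑ k ∈ Finset.Icc (-(cutK U ν ρ₀ : ℤ)) (cutK U ν ρ₀), norm1 (xMode (ρ t) k) ^ 2 := by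
  set K := cutK U ν ρ₀ with hK
  have hc := c2_pos (U := U) hs hmean hne hν
  have h1 := hasSum_tail (hasSum_norm1_xMode_sq (Lp.memLp (ρ t))) K
  have h0 := hasSum_tail (hasSum_modeNorm_sq (hs.memLp (p := 2))) K
  have hKc : 2 * c2 U ν ρ₀ ≤ ν * (K : ℝ) ^ 2 := by
    have h2 : √(2 * c2 U ν ρ₀ / ν) ≤ K := by
      refine (Nat.le_ceil _).trans ?_
      exact_mod_cast (le_max_left _ _ : _ ≤ cutK U ν ρ₀)
    rw [Real.sqrt_le_left (Nat.cast_nonneg _), div_le_iff₀' hν] at h2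
    exact h2
  have hle := hasSum_le (fun k => ?_) h1 (h0.mul_left (exp (-(2 * c2 U ν ρ₀ * t))))
  · have h3 := sum_modes_ge (U := U) (ν := ν) hs hne
    rw [← hK] at h3
    have h4 := norm_solution_lower_bound hU hρ hs hmean hne hν ht
    have h5 : (norm2 ρ₀ * exp (-(c2 U ν ρ₀ * t))) ^ 2 ≤ ‖ρ t‖ ^ 2 :=
      pow_le_pow_left₀ (mul_nonneg (norm2_nonneg _) (exp_pos _).le) h4 2
    rw [mul_pow, ← Real.exp_nat_mul, show ((2 : ℕ) : ℝ) * -(c2 U ν ρ₀ * t) =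
      -(2 * c2 U ν ρ₀ * t) by push_cast; ring] at h5
    rw [← norm_eq_norm2] at hle
    have h6 : exp (-(2 * c2 U ν ρ₀ * t)) * (norm2 ρ₀ ^ 2 -
        ∑ k ∈ Finset.Icc (-(K : ℤ)) K, modeNorm ρ₀ k ^ 2) ≤
        exp (-(2 * c2 U ν ρ₀ * t)) * (norm2 ρ₀ ^ 2 / 2) :=
      mul_le_mul_of_nonneg_left (by linarith) (exp_pos _).le
    linarith
  · split_ifs with h
    · have h2 := norm1_xMode_le_exp hU hρ hs hν.le k ht
      have h3 := pow_le_pow_left₀ (norm1_nonneg _) h2 2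
      rw [mul_pow, ← Real.exp_nat_mul] at h3
      refine h3.trans (mul_le_mul_of_nonneg_right (exp_le_exp.2 ?_) (sq_nonneg _))
      have h4 : (K : ℝ) ≤ |(k : ℝ)| := by exact_mod_cast h.le
      have h5 : (K : ℝ) ^ 2 ≤ (k : ℝ) ^ 2 := by rw [← sq_abs (k : ℝ)]; gcongr
      have h6 : c2 U ν ρ₀ ≤ ν * (k : ℝ) ^ 2 := by
        have := mul_le_mul_of_nonneg_left h5 hν.le
        linarith
      have := mul_le_mul_of_nonneg_right h6 ht
      push_cast
      linarith
    · simp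

/-- `N_k ≥ J_k` makes the signed energy nonnegative at time `0`, and `νN_k ≥ |k|M` provides the gap
that keeps it so. -/
theorem cone_mode (hU : BoundedShear U) (hρ : IsSolution U ν ρ₀ ρ)
    (hs : SmoothTorus ρ₀) (hν : 0 < ν) {k : ℤ} (ha : 0 < modeNorm ρ₀ k) {t : ℝ} (ht : 0 ≤ t) :
    norm1 (xMode (ρ t) k) ^ 2 ≤
      2 * ∑ l ∈ Finset.Icc (-(cutN U ν ρ₀ k : ℤ)) (cutN U ν ρ₀ k), ‖coeff (ρ t) k l‖ ^ 2 := by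
  have h1 := signed_energy_mode hU hρ hs hν k (shear_le_cutN (ρ₀ := ρ₀) hν k) ht
  have h2 := sum_low_ge hs ha (cutJ_le_cutN (U := U) (ν := ν) k)
  have h3 := nonneg_of_mul_nonneg_right ((sub_nonneg.2 h2).trans h1) (exp_pos _)
  linarith

theorem summable_normHneg (r : Lp ℂ 2 μ2) : Summable (fun q : ℤ × ℤ =>
    if q = 0 then 0 else ‖coeff r q.1 q.2‖ ^ 2 / ((q.1 : ℝ) ^ 2 + (q.2 : ℝ) ^ 2)) := by
  refine Summable.of_nonneg_of_le (fun q => ?_) (fun q => ?_)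
    (hasSum_coeff_sq_prod (Lp.memLp r)).summable
  · split_ifs <;> positivity
  · split_ifs with h
    · positivity
    · refine div_le_self (sq_nonneg _) ?_
      have h1 : (1 : ℤ) ≤ q.1 ^ 2 + q.2 ^ 2 := by
        by_contra hc
        have h2 : q.1 ^ 2 = 0 := by nlinarith [sq_nonneg q.1, sq_nonneg q.2]
        have h3 : q.2 ^ 2 = 0 := by nlinarith [sq_nonneg q.1, sq_nonneg q.2]
        exact h (Prod.ext (pow_eq_zero_iff two_ne_zero |>.1 h2)
          (pow_eq_zero_iff two_ne_zero |>.1 h3))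
      exact_mod_cast h1

/-- The coefficient at `(0, 0)` may be counted on the left but is absent from the norm, hence `h0`.
-/
theorem sum_le_normHneg_sq (r : Lp ℂ 2 μ2) (h0 : coeff r 0 0 = 0) (s : Finset ℤ)
    (S : ℤ → Finset ℤ) {R : ℝ}
    (hsub : ∀ k ∈ s, ∀ l ∈ S k, (k : ℝ) ^ 2 + (l : ℝ) ^ 2 ≤ R ^ 2) :
    (∑ k ∈ s, ∑ l ∈ S k, ‖coeff r k l‖ ^ 2) / R ^ 2 ≤ normHneg r ^ 2 := by
  have hsm := summable_normHneg r
  have hnn : ∀ q : ℤ × ℤ, (0 : ℝ) ≤ if q = 0 then 0 else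
      ‖coeff r q.1 q.2‖ ^ 2 / ((q.1 : ℝ) ^ 2 + (q.2 : ℝ) ^ 2) := fun q => by
    split_ifs <;> positivity
  rw [normHneg, Real.sq_sqrt (tsum_nonneg hnn), hsm.tsum_prod, Finset.sum_div]
  refine le_trans (Finset.sum_le_sum fun k hk => ?_)
    (hsm.prod.sum_le_tsum s fun k _ => tsum_nonneg fun l => hnn (k, l))
  rw [Finset.sum_div]
  refine le_trans (Finset.sum_le_sum fun l hl => ?_)
    ((hsm.prod_factor k).sum_le_tsum (S k) fun l _ => hnn (k, l))
  split_ifs with h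
  · rw [Prod.mk_eq_zero] at h
    rw [h.1, h.2, h0]; simp
  · have hpos : 0 < (k : ℝ) ^ 2 + (l : ℝ) ^ 2 := by
      refine lt_of_le_of_ne (by positivity) fun he => h ?_
      have h2 : (k : ℝ) ^ 2 = 0 := by nlinarith [sq_nonneg (k : ℝ), sq_nonneg (l : ℝ)]
      have h3 : (l : ℝ) ^ 2 = 0 := by nlinarith [sq_nonneg (k : ℝ), sq_nonneg (l : ℝ)]
      rw [Prod.mk_eq_zero]
      exact ⟨by exact_mod_cast pow_eq_zero_iff two_ne_zero |>.1 h2,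
        by exact_mod_cast pow_eq_zero_iff two_ne_zero |>.1 h3⟩
    exact div_le_div_of_nonneg_left (sq_nonneg _) hpos (hsub k hk l hl)

theorem ratio_lower_bound (hU : BoundedShear U) (hρ : IsSolution U ν ρ₀ ρ)
    (hs : SmoothTorus ρ₀) (hmean : ∫ p, ρ₀ p ∂μ2 = 0) (hne : ρ₀ ≠ 0) (hν : 0 < ν)
    {t : ℝ} (ht : 0 ≤ t) : 1 / (2 * RStar U ν ρ₀) ≤ normHneg (ρ t) / ‖ρ t‖ := by
  have hR : 0 < RStar U ν ρ₀ := RStar_pos hs hne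
  have hX : 0 < ‖ρ t‖ := (mul_pos (norm2_pos hs hne) (exp_pos _)).trans_le
    (norm_solution_lower_bound hU hρ hs hmean hne hν ht)
  have h00 : coeff (ρ t) 0 0 = 0 := by
    have h := norm_coeff_zero_mode hU hρ hν.le 0 ht
    rw [coeff_zero_zero ρ₀, hmean, norm_zero, zero_mul] at h
    exact norm_eq_zero.1 h
  set s := (Finset.Icc (-(cutK U ν ρ₀ : ℤ)) (cutK U ν ρ₀)).filter
    (fun k => 0 < modeNorm ρ₀ k) with hsdef
  -- Modes absent from the datum stay absent, so restricting to `a_k > 0` loses no energy.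
  have hzero : ∀ k, ¬ 0 < modeNorm ρ₀ k → norm1 (xMode (ρ t) k) = 0 := fun k hk => by
    have h1 : modeNorm ρ₀ k = 0 := le_antisymm (not_lt.1 hk) (modeNorm_nonneg _ _)
    have h2 := norm1_xMode_le_exp hU hρ hs hν.le k ht
    rw [h1, mul_zero] at h2
    exact le_antisymm h2 (norm1_nonneg _)
  have h1 := sum_low_modes_ge hU hρ hs hmean hne hν ht
  have h2 : ∑ k ∈ Finset.Icc (-(cutK U ν ρ₀ : ℤ)) (cutK U ν ρ₀), norm1 (xMode (ρ t) k) ^ 2 =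
      ∑ k ∈ s, norm1 (xMode (ρ t) k) ^ 2 := by
    rw [hsdef, Finset.sum_filter]
    refine Finset.sum_congr rfl fun k _ => ?_
    split_ifs with h
    · rfl
    · rw [hzero k h]; simp
  have h3 : ∑ k ∈ s, norm1 (xMode (ρ t) k) ^ 2 ≤ 2 * ∑ k ∈ s,
      ∑ l ∈ Finset.Icc (-(cutN U ν ρ₀ k : ℤ)) (cutN U ν ρ₀ k), ‖coeff (ρ t) k l‖ ^ 2 := by
    rw [Finset.mul_sum]
    exact Finset.sum_le_sum fun k hk =>
      cone_mode hU hρ hs hν (Finset.mem_filter.1 hk).2 ht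
  have h4 := sum_le_normHneg_sq (ρ t) h00 s
    (fun k => Finset.Icc (-(cutN U ν ρ₀ k : ℤ)) (cutN U ν ρ₀ k)) fun k hk l hl => by
      have hk' := Finset.mem_filter.1 hk
      refine le_trans ?_ (le_RStar_sq (abs_le.2 (Finset.mem_Icc.1 hk'.1)) hk'.2)
      have h5 : |(l : ℝ)| ≤ cutN U ν ρ₀ k := by
        exact_mod_cast abs_le.2 (Finset.mem_Icc.1 hl)
      rw [← sq_abs (l : ℝ)]
      gcongr
  have h5 : (‖ρ t‖ / (2 * RStar U ν ρ₀)) ^ 2 ≤ normHneg (ρ t) ^ 2 := by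
    refine le_trans ?_ h4
    rw [div_pow, mul_pow, ← div_div]
    gcongr
    linarith
  have h6 := le_of_sq_le_sq h5 (Real.sqrt_nonneg _)
  rw [le_div_iff₀ hX, one_div_mul_eq_div]
  exact h6

end Solution

end ShearFlow

theorem theorem1p2
    (U : ℝ → ShearFlow.T1 → ℝ) (hU : ShearFlow.BoundedShear U)
    (ρ₀ : ShearFlow.T2 → ℂ) (hsmooth : ShearFlow.SmoothTorus ρ₀)
    (hmean : ∫ p, ρ₀ p ∂ShearFlow.μ2 = 0) (hne : ρ₀ ≠ 0) :
    0 < ShearFlow.constC U ρ₀ ∧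
    ∀ ν : ℝ, 0 < ν →
      0 < ShearFlow.c2 U ν ρ₀ ∧
      (ν ≤ 1 → ShearFlow.c2 U ν ρ₀ ≤ ShearFlow.constC U ρ₀ / ν) ∧
      0 < ShearFlow.RStar U ν ρ₀ ∧
      ∀ ρ : ℝ → Lp ℂ 2 ShearFlow.μ2, ShearFlow.IsSolution U ν ρ₀ ρ →
        ∀ t : ℝ, 0 ≤ t →
          ShearFlow.norm2 ρ₀ * Real.exp (-(ShearFlow.c2 U ν ρ₀ * t)) ≤ ‖ρ t‖ ∧
          1 / (2 * ShearFlow.RStar U ν ρ₀) ≤ ShearFlow.normHneg (ρ t) / ‖ρ t‖ :=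
  ⟨ShearFlow.constC_pos hsmooth hmean hne, fun _ hν =>
    ⟨ShearFlow.c2_pos hsmooth hmean hne hν, ShearFlow.c2_le_constC_div hsmooth hmean hne hν,
      ShearFlow.RStar_pos hsmooth hne, fun _ hρ _ ht =>
        ⟨ShearFlow.norm_solution_lower_bound hU hρ hsmooth hmean hne hν ht,
          ShearFlow.ratio_lower_bound hU hρ hsmooth hmean hne hν ht⟩⟩⟩
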